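/- Let $p$ be a prime. Consider adaptive circuits with finitely many quantum wires, each a qudit with basis $\{|x\rangle : x\in\mathbb F_p\}$, and finitely many classical wires with values in $\mathbb F_p$. In addition to the input qudits, all other qudits start in $|0\rangle$ and all classical wires at $0$; at the end some qudits are designated as output and everything else is discarded. A circuit is a sequence of layers. The gates of one layer act on pairwise disjoint sets of qudits, and none of them writes a classical wire that another one reads or writes (but a classical wire may be read by any number of gates). The depth is the number of layers; the size is the number of wires plus the number of gates. The basic gates are: all one-qudit unitaries; all one-qudit gates controlled by one other qudit, $|x\rangle|\psi\rangle\mapsto|x\rangle U_x|\psi\rangle$ with $U_0,\dots,U_{p-1}$ unitary; measurement of a qudit in the computational basis with the outcome written on a classical wire; one-qudit unitaries chosen according to the value of one classical wire; and arbitrary classical gates with at most two inputs. * $\mathsf{i}\text{-}\mathsf{QNC}_p[p]_{\mathsf c}$ is the class of families $(\Phi_n)_{n\in\mathbb N}$, where $\Phi_n$ is a quantum operation from $n$ qudits to some number $m(n)$ of qudits, that are implemented exactly (as maps on density matrices) by a (non-uniform) family of circuits of constant depth and of size polynomial in $n$ consisting of basic gates and classical $\mathrm{MOD}_p$ gates of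 unbounded fan-in, where $\mathrm{MOD}_p(x)=1$ if $\sum_i x_i\equiv 0 \pmod p$ and $\mathrm{MOD}_p(x)=0$ otherwise. * $\mathsf{i}\text{-}\mathsf{QTC}_p$ is the class defined in the same way with circuits consisting of basic gates, multi-qudit controlled gates (a one-qudit unitary is applied to a target qudit if any number of other qudits are in prescribed basis states) and quantum threshold gates of unbounded fan-in, $\mathsf{qTH}_k|x_0,x_1,\dots,x_s\rangle=|x_0+\mathrm{TH}_k(x_1,\dots,x_s) \bmod p,\,x_1,\dots,x_s\rangle$ for any $k,s\in\mathbb N$, where $\mathrm{TH}_k(x)=1$ if $\sum_i x_i\ge k$ (integer sum of representatives in $\{0,\dots,p-1\}$) and $\mathrm{TH}_k(x)=0$ otherwise. Then $$\mathsf{i}\text{-}\mathsf{QNC}_p[p]_{\mathsf c}=\mathsf{i}\text{-}\mathsf{QTC}_p .$$ Moreover, the quantum modular gate $\mathsf{qMOD}_p|x_0,x_1,\dots,x_k\rangle=|x_0+(x_1+\dots+x_k)\bmod p,\,x_1,\dots,x_k\rangle$, as a family of operations indexed by the number $k+1$ of qudits, belongs to $\mathsf{i}\text{-}\mathsf{QNC}_p[p]_{\mathsf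 c}$. -/

import Mathlib

noncomputable section

namespace QuditCircuit

/-! Quantum wires carry qudits of dimension `p`, with computational basis labelled by `ZMod p`.
Classical wires carry values of `ZMod p` (a bit is a value in `{0, 1}`, a measurement outcome is an
arbitrary value). `Q` and `C` are the finite types of quantum and classical wires. -/

/-- The gates, each placed on its wires. -/
inductive Gate (p : ℕ) [NeZero p] (Q C : Type) : Type
  /-- A one-qudit unitary `U` on `q`. -/
  | oneQudit (q : Q) (U : Matrix.unitaryGroup (ZMod p) ℂ)
  /-- A one-qudit gate on `t` controlled by one qudit `a`: `|x⟩|ψ⟩ ↦ |x⟩ U_x |ψ⟩`. -/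
  | ctrl (a t : Q) (h : a ≠ t) (U : ZMod p → Matrix.unitaryGroup (ZMod p) ℂ)
  /-- Feed-forward: the unitary `U_v` is applied to `q`, where `v` is the value of the classical
  wire `c`. -/
  | classicalCtrl (c : C) (q : Q) (U : ZMod p → Matrix.unitaryGroup (ZMod p) ℂ)
  /-- Measurement of `q` in the computational basis; the outcome is written on `w`. -/
  | measure (q : Q) (w : C)
  /-- A classical gate of bounded fan-in: `w := f a b`. -/
  | boundedClassical (a b w : C) (f : ZMod p → ZMod p → ZMod p)
  /-- The classical gate `MOD_p` of unbounded fan-in: `w` becomes `1` if the sum of the inputs is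
  `0` modulo `p`, and `0` otherwise. -/
  | classicalMod (S : Finset C) (w : C)
  /-- Generalized Toffoli gate: `U` is applied to `t` if every control `i ∈ S` is in the basis
  state `v i`. -/
  | multiCtrl (S : Finset Q) (v : Q → ZMod p) (t : Q) (h : t ∉ S)
      (U : Matrix.unitaryGroup (ZMod p) ℂ)
  /-- The quantum threshold gate `|x_t, x_S⟩ ↦ |x_t + TH_k(x_S) mod p, x_S⟩`. -/
  | qThreshold (k : ℕ) (S : Finset Q) (t : Q) (h : t ∉ S)

/-- The classical-quantum states: to each assignment of the classical wires, the unnormalised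
density matrix of the quantum wires. -/
abbrev CQState (p : ℕ) (Q C : Type) : Type :=
  (C → ZMod p) → Matrix (Q → ZMod p) (Q → ZMod p) ℂ

section Operators

variable {p : ℕ} {Q : Type}

/-- The matrix of `|x⟩ ↦ |x + a⟩` on one qudit. -/
def shift (a : ZMod p) : Matrix (ZMod p) (ZMod p) ℂ :=
  fun y x => if y = x + a then 1 else 0

/-- The operator that applies the one-qudit matrix `U x` to the qudit `t` of the basis state
`|x⟩`, where `U x` depends only on the coordinates of `x` other than `t`. -/
def localOp [Fintype Q] [DecidableEq Q] (t : Q)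
    (U : (Q → ZMod p) → Matrix (ZMod p) (ZMod p) ℂ) :
    Matrix (Q → ZMod p) (Q → ZMod p) ℂ :=
  fun y x => if ∀ i, i ≠ t → y i = x i then U x (y t) (x t) else 0

/-- The projection `|m⟩⟨m|` on the qudit `q`. -/
def proj [Fintype Q] [DecidableEq Q] (q : Q) (m : ZMod p) :
    Matrix (Q → ZMod p) (Q → ZMod p) ℂ :=
  Matrix.diagonal fun x => if x q = m then 1 else 0

/-- `TH_k(x_S)`: equal to `1` if the integer sum of the entries (represented in
`{0, …, p - 1}`) is at least `k`, and to `0` otherwise. -/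
def threshold (k : ℕ) (S : Finset Q) (x : Q → ZMod p) : ZMod p :=
  if k ≤ ∑ i ∈ S, (x i).val then 1 else 0

end Operators

section Semantics

variable {p : ℕ} [NeZero p] {Q C : Type} [Fintype Q] [DecidableEq Q] [Fintype C] [DecidableEq C]

/-- Conjugation by an operator on the quantum wires that may depend on the classical values. -/
def conjBy (K : (C → ZMod p) → Matrix (Q → ZMod p) (Q → ZMod p) ℂ) (ρ : CQState p Q C) :
    CQState p Q C :=
  fun c => K c * ρ c * (K c).conjTranspose

/-- The classical wire `w` is overwritten by `f c`. -/
def writeClassical (w : C) (f : (C → ZMod p) → ZMod p) (ρ : CQState p Q C) : CQState p Q C :=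
  fun c' => ∑ c, if Function.update c w (f c) = c' then ρ c else 0

/-- The action of a gate on classical-quantum states. -/
def Gate.apply : Gate p Q C → CQState p Q C → CQState p Q C
  | .oneQudit q U => conjBy fun _ => localOp q fun _ => U
  | .ctrl a t _ U => conjBy fun _ => localOp t fun x => U (x a)
  | .classicalCtrl w q U => conjBy fun c => localOp q fun _ => U (c w)
  | .measure q w => fun ρ c' =>
      ∑ c, ∑ m, if Function.update c w m = c' then proj q m * ρ c * proj q m else 0
  | .boundedClassical a b w f => writeClassical w fun c => f (c a) (c b)
  | .classicalMod S w => writeClassical w fun c => if ∑ i ∈ S, c i = 0 then 1 else 0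
  | .multiCtrl S v t _ U =>
      conjBy fun _ => localOp t fun x => if ∀ i ∈ S, x i = v i then U else 1
  | .qThreshold k S t _ => conjBy fun _ => localOp t fun x => shift (threshold k S x)

/-- The quantum wires on which a gate acts (controls included). -/
def Gate.qwires : Gate p Q C → Finset Q
  | .oneQudit q _ => {q}
  | .ctrl a t _ _ => {a, t}
  | .classicalCtrl _ q _ => {q}
  | .measure q _ => {q}
  | .boundedClassical _ _ _ _ => ∅
  | .classicalMod _ _ => ∅
  | .multiCtrl S _ t _ _ => insert t S
  | .qThreshold _ S t _ => insert t S

/-- The classical wires that a gate reads. -/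
def Gate.creads : Gate p Q C → Finset C
  | .classicalCtrl c _ _ => {c}
  | .boundedClassical a b _ _ => {a, b}
  | .classicalMod S _ => S
  | _ => ∅

/-- The classical wires that a gate writes. -/
def Gate.cwrites : Gate p Q C → Finset C
  | .measure _ w => {w}
  | .boundedClassical _ _ w _ => {w}
  | .classicalMod _ w => {w}
  | _ => ∅

/-- Two gates may stand in the same layer: they act on different qudits, and neither writes a
classical wire that the other one reads or writes. A classical wire may be read by any number of
gates of a layer (unbounded classical fan-out); a qudit may not. -/
def Gate.Compatible (g h : Gate p Q C) : Prop :=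
  Disjoint g.qwires h.qwires ∧ Disjoint g.cwrites h.cwrites ∧
    Disjoint g.cwrites h.creads ∧ Disjoint g.creads h.cwrites

/-- The gates common to all classes considered (adaptive circuits over all one-qudit unitaries):
one-qudit unitaries, singly controlled one-qudit gates, measurement, classical feed-forward and
classical gates of bounded fan-in. -/
def Gate.IsQNC : Gate p Q C → Prop
  | .oneQudit _ _ => True
  | .ctrl _ _ _ _ => True
  | .classicalCtrl _ _ _ => True
  | .measure _ _ => True
  | .boundedClassical _ _ _ _ => True
  | _ => False

/-- The gates of `i-QNC_p[p]_c`: in addition, classical `MOD_p` gates. -/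
def Gate.IsQNCModC : Gate p Q C → Prop
  | .classicalMod _ _ => True
  | g => g.IsQNC

/-- The gates of `i-QTC_p`: in addition, multi-qudit controlled one-qudit unitaries (generalized
Toffoli gates) and quantum threshold gates. -/
def Gate.IsQTC : Gate p Q C → Prop
  | .multiCtrl _ _ _ _ _ => True
  | .qThreshold _ _ _ _ => True
  | g => g.IsQNC

end Semantics

/-- A circuit on the quantum wires `Q` and the classical wires `C`, with `n` input qudits and `m`
output qudits: the positions of the input and of the output qudits, and the layers of gates (in
order of time). -/
structure Circuit (p : ℕ) [NeZero p] (n m : ℕ) (Q C : Type) [Fintype Q] [DecidableEq Q]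
    [Fintype C] [DecidableEq C] where
  /-- The positions of the input qudits; all other qudits start in `|0⟩`. -/
  inp : Fin n ↪ Q
  /-- The positions of the output qudits; all other qudits are discarded at the end. -/
  out : Fin m ↪ Q
  /-- The layers. -/
  layers : List (List (Gate p Q C))
  /-- The gates of each layer act in parallel. -/
  parallel : ∀ L ∈ layers, L.Pairwise Gate.Compatible

namespace Circuit

variable {p : ℕ} [NeZero p] {n m : ℕ} {Q C : Type} [Fintype Q] [DecidableEq Q]
  [Fintype C] [DecidableEq C]

/-- The number of layers. -/
def depth (K : Circuit p n m Q C) : ℕ := K.layers.length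

/-- The number of wires plus the number of gates. -/
def size (K : Circuit p n m Q C) : ℕ :=
  Fintype.card Q + Fintype.card C + (K.layers.map List.length).sum

/-- The initial state: the input `σ` on the input qudits, `|0⟩` on the other qudits, and all
classical wires `0`. -/
def initial (K : Circuit p n m Q C) (σ : Matrix (Fin n → ZMod p) (Fin n → ZMod p) ℂ) :
    CQState p Q C :=
  fun c => if c = 0 then
    (fun x y => if ∀ q, (∀ i, K.inp i ≠ q) → x q = 0 ∧ y q = 0
      then σ (fun i => x (K.inp i)) (fun i => y (K.inp i)) else 0)
    else 0

/-- The final state: the gates of all layers are applied in order. -/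
def run (K : Circuit p n m Q C) (ρ : CQState p Q C) : CQState p Q C :=
  K.layers.flatten.foldl (fun τ g => g.apply τ) ρ

/-- The reduced state on the output qudits: all classical wires are forgotten and all other qudits
are traced out. -/
def reduced (K : Circuit p n m Q C) (ρ : CQState p Q C) :
    Matrix (Fin m → ZMod p) (Fin m → ZMod p) ℂ :=
  fun u v => ∑ c, ∑ x, ∑ y,
    if (∀ i, x (K.out i) = u i) ∧ (∀ i, y (K.out i) = v i) ∧
        (∀ q, (∀ i, K.out i ≠ q) → x q = y q)
    then ρ c x y else 0

/-- The quantum operation (channel) that a circuit implements. -/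
def channel (K : Circuit p n m Q C) (σ : Matrix (Fin n → ZMod p) (Fin n → ZMod p) ℂ) :
    Matrix (Fin m → ZMod p) (Fin m → ZMod p) ℂ :=
  K.reduced (K.run (K.initial σ))

end Circuit

/-- A family of maps on density matrices, the `n`-th one from `n` qudits to `outSize n` qudits. -/
structure OpFamily (p : ℕ) where
  /-- The number of output qudits. -/
  outSize : ℕ → ℕ
  /-- The map for `n` input qudits. -/
  map (n : ℕ) : Matrix (Fin n → ZMod p) (Fin n → ZMod p) ℂ →
    Matrix (Fin (outSize n) → ZMod p) (Fin (outSize n) → ZMod p) ℂ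

/-- The families of quantum operations implemented exactly by (non-uniform) circuits of constant
depth and polynomial size whose gates all belong to the gate set `G`. -/
def constDepthClass (p : ℕ) [NeZero p] (G : ∀ Q C : Type, Gate p Q C → Prop) :
    Set (OpFamily p) :=
  {F | ∃ (d : ℕ) (P : Polynomial ℕ), ∀ n, ∃ (Q C : Type) (_ : Fintype Q) (_ : DecidableEq Q)
    (_ : Fintype C) (_ : DecidableEq C) (K : Circuit p n (F.outSize n) Q C),
    (∀ L ∈ K.layers, ∀ g ∈ L, G Q C g) ∧ K.depth ≤ d ∧ K.size ≤ P.eval n ∧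
      ∀ σ, K.channel σ = F.map n σ}

/-- The class `i-QNC_p[p]_c`. -/
def iQNCModC (p : ℕ) [NeZero p] : Set (OpFamily p) :=
  constDepthClass p fun _ _ g => g.IsQNCModC

/-- The class `i-QTC_p`. -/
def iQTC (p : ℕ) [NeZero p] : Set (OpFamily p) :=
  constDepthClass p fun _ _ g => g.IsQTC

/-- The quantum gate `qMOD_p |x_0, x_1, …, x_k⟩ = |x_0 + (x_1 + ⋯ + x_k) mod p, x_1, …, x_k⟩`. -/
def qMOD (p k : ℕ) : Matrix (Fin (k + 1) → ZMod p) (Fin (k + 1) → ZMod p) ℂ :=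
  localOp 0 fun x => shift (∑ i : Fin k, x i.succ)

/-- The family of the operations `qMOD_p` on `n ≥ 1` qudits (nothing happens for `n = 0`). -/
def qMODFamily (p : ℕ) [NeZero p] : OpFamily p where
  outSize n := n
  map
    | 0 => fun σ => σ
    | k + 1 => fun σ => qMOD p k * σ * (qMOD p k).conjTranspose

end QuditCircuit

end

noncomputable section

namespace QuditCircuit

set_option linter.unusedSectionVars false

section

variable {p : ℕ} [NeZero p] {Q C : Type} [Fintype Q] [DecidableEq Q] [Fintype C] [DecidableEq C]

/-! ### Pointwise formulas -/

/-! Both inclusions come from replacing every gate of a circuit by a subcircuit of constant depth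
with polynomially many ancillas, which start and end clean. The notion `Realizes` records such a
replacement on a zone of wires. Maps in independent zones commute (`IsAction.commute`), so the gates
of a layer can be replaced in parallel, and since ancillas are returned clean, successive layers
reuse them (`exists_circuit_of_realizes_gates`, `constDepthClass_subset`).

From `MOD_p` to thresholds: let N be the integer sum of the n inputs. For each j ≤ n the two bits [N
≥ pj] and [N < pj + 1] add up to 1 + [N = pj]. So p divides N exactly when all these bits together
sum to at least n + 2, which is again a threshold. A classical threshold is obtained by loading the
values into fresh qudits, applying the quantum gate and measuring its target
(`realizes_classicalMod`).

From thresholds to `MOD_p`: the engine is fan-out by measurement. Ancillas b_i in uniform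
superposition are compared along the chain q, b_0, b_1, …; the measured differences have classical
prefix sums, computed by `MOD_p` gates in a bounded number of rounds, and subtracting these turns
every b_i into a copy of q (`exists_realizes_copy`). Copies are erased by measuring them in the
Fourier basis and correcting a phase on q that depends only on the sum of the outcomes
(`exists_realizes_uncopy`). With copies at hand, arbitrarily many gates controlled by q run in one
layer (`realizes_star_fin`). Diagonal controlled gates are symmetric in control and target, so such
a star also collects phases from many qudits onto q; between Fourier gates this is the modular sum
(`realizes_sum`), which is `qMOD` itself.

Fan-out and sums give products of phases, each depending on a pair of modular linear combinations of
functions of the inputs (`realizes_phases`). A function g of an integer count N < J ≤ p^A is then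
computed exactly as follows. For every value j and every a < A, a digit qudit receives the phases
exp(2πi b (N - j) / p^(a+1)) in the Fourier basis. If N = j, all its digits stay 0. Otherwise, for
the a with p^a exactly dividing N - j, the a-th digit is shifted by a nonzero amount, so the digits
of j cannot all vanish, whatever superposition the remaining ones are in. The indicator of y = 0 is
the average over s of Re ω^(s·y), with ω = exp(2πi/p), so a phase conditioned on it is a product of
p^A phases on the linear forms s·y (`prod_zeroPhase`); p^A is polynomial because A is about log_p J.
Inverting the comparison leaves the phase ω^(g(N) t) on the target t, and Fourier gates make it the
addition of g(N) (`CountData.realizes_shift`). Thresholds are such additions, and a generalized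
Toffoli gate computes the flag [all controls match], applies one controlled gate and uncomputes the
flag. -/

theorem localOp_mul_apply {α : Type*} (t : Q) (U : (Q → ZMod p) → Matrix (ZMod p) (ZMod p) ℂ)
    (M : Matrix (Q → ZMod p) α ℂ) (x : Q → ZMod p) (y : α) :
    (localOp t U * M) x y =
      ∑ a, U (Function.update x t a) (x t) a * M (Function.update x t a) y := by
  rw [Matrix.mul_apply]
  symm
  refine Fintype.sum_of_injective (fun a => Function.update x t a)
    (Function.update_injective x t) _ _ ?_ ?_
  · intro z hz
    have : ¬ ∀ i, i ≠ t → x i = z i := by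
      intro h
      refine hz ⟨z t, ?_⟩
      funext i
      by_cases hi : i = t
      · subst hi; simp
      · simp [hi, h i hi]
    simp [localOp, this]
  · intro a
    have : ∀ i, i ≠ t → x i = Function.update x t a i := fun i hi => by simp [hi]
    simp only [localOp]
    rw [if_pos this]
    simp

theorem mul_localOp_conjTranspose_apply {α : Type*} (t : Q)
    (U : (Q → ZMod p) → Matrix (ZMod p) (ZMod p) ℂ)
    (M : Matrix α (Q → ZMod p) ℂ) (x : α) (y : Q → ZMod p) :
    (M * (localOp t U).conjTranspose) x y =
      ∑ b, M x (Function.update y t b) * star (U (Function.update y t b) (y t) b) := by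
  have h : M * (localOp t U).conjTranspose = (localOp t U * M.conjTranspose).conjTranspose := by
    simp
  rw [h, Matrix.conjTranspose_apply, localOp_mul_apply, star_sum]
  refine Finset.sum_congr rfl fun b _ => ?_
  simp [mul_comm]

theorem conjBy_localOp_apply (t : Q) (U : (C → ZMod p) → (Q → ZMod p) → Matrix (ZMod p) (ZMod p) ℂ)
    (ρ : CQState p Q C) (c : C → ZMod p) (x y : Q → ZMod p) :
    conjBy (fun c => localOp t (U c)) ρ c x y =
      ∑ b, (∑ a, U c (Function.update x t a) (x t) a *
        ρ c (Function.update x t a) (Function.update y t b)) *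
          star (U c (Function.update y t b) (y t) b) := by
  simp only [conjBy]
  rw [mul_localOp_conjTranspose_apply]
  simp only [localOp_mul_apply]

/-- The assignments that can be sent to `c` are among the updates of `c` at `w`, which leaves a sum
over the overwritten value `v`. -/
theorem writeClassical_apply (w : C) (f : (C → ZMod p) → ZMod p) (ρ : CQState p Q C)
    (c : C → ZMod p) :
    writeClassical w f ρ c = ∑ v, if f (Function.update c w v) = c w
      then ρ (Function.update c w v) else 0 := by
  simp only [writeClassical]
  symm
  refine Fintype.sum_of_injective (fun a => Function.update c w a)
    (Function.update_injective c w) _ _ ?_ ?_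
  · intro z hz
    rw [if_neg]
    rintro rfl
    exact hz ⟨z w, by simp⟩
  · intro v
    simp only [Function.update_idem]
    congr 1
    rw [eq_iff_iff, Function.update_eq_iff]
    simp

theorem localOp_proj (q : Q) (m : ZMod p) :
    localOp q (fun _ => Matrix.diagonal fun a => if a = m then 1 else 0) = proj q m := by
  ext y x
  simp only [localOp, proj, Matrix.diagonal_apply]
  by_cases h : y = x
  · subst h; simp
  · rw [if_neg h]
    split_ifs with h1 h2 h3
    · exact absurd (funext fun i => by by_cases hi : i = q; · rw [hi, h2]
                                       · exact h1 i hi) h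
    · exact absurd (funext fun i => by by_cases hi : i = q; · rw [hi, h2]
                                       · exact h1 i hi) h
    all_goals rfl

theorem conjTranspose_proj (q : Q) (m : ZMod p) :
    (proj q m : Matrix (Q → ZMod p) (Q → ZMod p) ℂ).conjTranspose = proj q m := by
  rw [proj, Matrix.diagonal_conjTranspose]
  congr 1
  funext x
  simp only [Pi.star_apply]
  split_ifs <;> simp

/-- For a fixed outcome a measurement is a projection followed by writing a constant. This splits it
into the two generators of `IsAction`. -/
theorem apply_measure_eq_sum (q : Q) (w : C) (ρ : CQState p Q C) :
    (Gate.measure q w).apply ρ = ∑ m : ZMod p, writeClassical w (fun _ => m)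
      (conjBy (fun _ => localOp q
        (fun _ => Matrix.diagonal fun a => if a = m then 1 else 0)) ρ) := by
  funext c
  simp only [Gate.apply, localOp_proj, Finset.sum_apply, writeClassical, conjBy,
    conjTranspose_proj]
  rw [Finset.sum_comm]

theorem apply_measure (q : Q) (w : C) (ρ : CQState p Q C) (c : C → ZMod p) (x y : Q → ZMod p) :
    (Gate.measure q w).apply ρ c x y =
      if x q = c w ∧ y q = c w then ∑ v, ρ (Function.update c w v) x y else 0 := by
  have h : (Gate.measure q w).apply ρ c =
      ∑ v, proj q (c w) * ρ (Function.update c w v) * proj q (c w) := by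
    rw [apply_measure_eq_sum, Finset.sum_apply]
    simp only [writeClassical_apply, localOp_proj, conjBy, conjTranspose_proj]
    rw [Finset.sum_eq_single (c w)]
    · simp
    · intro m _ hm
      simp [hm]
    · simp
  rw [h, Matrix.sum_apply]
  simp only [proj, Matrix.mul_diagonal, Matrix.diagonal_mul]
  by_cases h1 : x q = c w ∧ y q = c w
  · simp [h1.1, h1.2]
  · rw [if_neg h1]
    refine Finset.sum_eq_zero fun v _ => ?_
    by_cases hx : x q = c w
    · have hy : y q ≠ c w := fun hy => h1 ⟨hx, hy⟩
      simp [hy]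
    · simp [hx]

/-! ### Local actions -/

/-- The maps on classical-quantum states that act on the qudits of `W`, read the classical wires of
`R` and write those of `V`. -/
inductive IsAction (W : Set Q) (R V : Set C) : (CQState p Q C → CQState p Q C) → Prop
  | conj (t : Q) (ht : t ∈ W) (U : (C → ZMod p) → (Q → ZMod p) → Matrix (ZMod p) (ZMod p) ℂ)
      (hU : ∀ c c' x x', (∀ b ∈ R, c b = c' b) → (∀ q ∈ W, x q = x' q) → U c x = U c' x') :
      IsAction W R V (conjBy fun c => localOp t (U c))
  | write (w : C) (hw : w ∈ V) (f : (C → ZMod p) → ZMod p)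
      (hf : ∀ c c', (∀ b ∈ R, c b = c' b) → f c = f c') : IsAction W R V (writeClassical w f)
  | id : IsAction W R V id
  | comp {S T} (hS : IsAction W R V S) (hT : IsAction W R V T) : IsAction W R V (S ∘ T)
  | sum {ι : Type} (s : Finset ι) (T : ι → CQState p Q C → CQState p Q C)
      (hT : ∀ i, IsAction W R V (T i)) : IsAction W R V (fun ρ => ∑ i ∈ s, T i ρ)

theorem conjBy_sum {ι : Type} (s : Finset ι)
    (K : (C → ZMod p) → Matrix (Q → ZMod p) (Q → ZMod p) ℂ) (ρ : ι → CQState p Q C) :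
    conjBy K (∑ i ∈ s, ρ i) = ∑ i ∈ s, conjBy K (ρ i) := by
  funext c
  simp [conjBy, Finset.mul_sum, Finset.sum_mul]

theorem writeClassical_sum {ι : Type} (s : Finset ι) (w : C) (f : (C → ZMod p) → ZMod p)
    (ρ : ι → CQState p Q C) :
    writeClassical w f (∑ i ∈ s, ρ i) = ∑ i ∈ s, writeClassical w f (ρ i) := by
  funext c
  simp only [writeClassical, Finset.sum_apply]
  rw [Finset.sum_comm]
  refine Finset.sum_congr rfl fun c' _ => ?_
  split_ifs <;> simp

theorem IsAction.map_sum {W : Set Q} {R V : Set C} {T : CQState p Q C → CQState p Q C}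
    (hT : IsAction W R V T) {ι : Type} (s : Finset ι) (ρ : ι → CQState p Q C) :
    T (∑ i ∈ s, ρ i) = ∑ i ∈ s, T (ρ i) := by
  induction hT generalizing ι with
  | conj t ht U hU => exact conjBy_sum _ _ _
  | write w hw f hf => exact writeClassical_sum _ _ _ _
  | id => rfl
  | comp hS hT ihS ihT => simp [ihS, ihT]
  | sum s' T hT ih => simp only [ih]; rw [Finset.sum_comm]

theorem IsAction.mono {W W' : Set Q} {R R' V V' : Set C} {T : CQState p Q C → CQState p Q C}
    (hT : IsAction W R V T) (hW : W ⊆ W') (hR : R ⊆ R') (hV : V ⊆ V') : IsAction W' R' V' T := by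
  induction hT with
  | conj t ht U hU =>
    exact .conj t (hW ht) U fun c c' x x' hc hx =>
      hU c c' x x' (fun b hb => hc b (hR hb)) (fun q hq => hx q (hW hq))
  | write w hw f hf => exact .write w (hV hw) f fun c c' hc => hf c c' fun b hb => hc b (hR hb)
  | id => exact .id
  | comp hS hT ihS ihT => exact .comp ihS ihT
  | sum s' T hT ih => exact .sum s' T ih

theorem Gate.isAction (g : Gate p Q C) :
    IsAction (g.qwires : Set Q) (g.creads : Set C) (g.cwrites : Set C) g.apply := by
  cases g with
  | oneQudit q U =>
    exact .conj q (by simp [Gate.qwires]) (fun _ _ => (U : Matrix (ZMod p) (ZMod p) ℂ))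
      fun _ _ _ _ _ _ => rfl
  | ctrl a t h U =>
    refine .conj t (by simp [Gate.qwires])
      (fun _ x => (U (x a) : Matrix (ZMod p) (ZMod p) ℂ)) ?_
    intro c c' x x' _ hx
    rw [hx a (by simp [Gate.qwires])]
  | classicalCtrl w q U =>
    refine .conj q (by simp [Gate.qwires])
      (fun c _ => (U (c w) : Matrix (ZMod p) (ZMod p) ℂ)) ?_
    intro c c' x x' hc _
    rw [hc w (by simp [Gate.creads])]
  | measure q w =>
    rw [show (Gate.measure q w : Gate p Q C).apply = _ from funext (apply_measure_eq_sum q w)]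
    refine .sum _ (fun m ρ => writeClassical w (fun _ => m)
      (conjBy (fun _ => localOp q
        (fun _ => Matrix.diagonal fun a => if a = m then 1 else 0)) ρ)) fun m => ?_
    exact .comp (.write w (by simp [Gate.cwrites]) (fun _ => m) fun _ _ _ => rfl)
      (.conj q (by simp [Gate.qwires])
        (fun _ _ => Matrix.diagonal fun a => if a = m then 1 else 0) fun _ _ _ _ _ _ => rfl)
  | boundedClassical a b w f =>
    refine .write w (by simp [Gate.cwrites]) _ ?_
    intro c c' hc
    rw [hc a (by simp [Gate.creads]), hc b (by simp [Gate.creads])]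
  | classicalMod S w =>
    refine .write w (by simp [Gate.cwrites]) _ ?_
    intro c c' hc
    rw [Finset.sum_congr rfl fun i hi => hc i (by simpa [Gate.creads] using hi)]
  | multiCtrl S v t h U =>
    have hT : (Gate.multiCtrl S v t h U).apply = conjBy (C := C) fun _ => localOp t
        fun x => ((if ∀ i ∈ S, x i = v i then U else 1 : Matrix.unitaryGroup (ZMod p) ℂ) :
          Matrix (ZMod p) (ZMod p) ℂ) := by
      funext ρ
      simp only [Gate.apply]
      congr! 3
      funext x
      split_ifs <;> rfl
    rw [hT]
    refine .conj t (by simp [Gate.qwires]) (fun _ x =>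
      ((if ∀ i ∈ S, x i = v i then U else 1 : Matrix.unitaryGroup (ZMod p) ℂ) :
          Matrix (ZMod p) (ZMod p) ℂ)) ?_
    intro c c' x x' _ hx
    have : (∀ i ∈ S, x i = v i) ↔ (∀ i ∈ S, x' i = v i) :=
      forall₂_congr fun i hi => by rw [hx i (by simp [Gate.qwires, hi])]
    simp only [this]
  | qThreshold k S t h =>
    refine .conj t (by simp [Gate.qwires]) (fun _ x => shift (threshold k S x)) ?_
    intro c c' x x' _ hx
    have : threshold k S x = threshold k S x' := by
      simp only [threshold]
      rw [Finset.sum_congr rfl fun i hi => by rw [hx i (by simp [Gate.qwires, hi])]]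
    simp only [this]

/-! ### Independent actions commute -/

/-- In either product only one intermediate basis state connects `x` to `y`: it takes one of the
coordinates `t`, `t'` from `x` and everything else from `y`. The operators `U` and `U'` do not see
the coordinate that the other one changes. -/
theorem localOp_comm {t t' : Q} (h : t ≠ t')
    {U U' : (Q → ZMod p) → Matrix (ZMod p) (ZMod p) ℂ}
    (hU : ∀ x a, U (Function.update x t' a) = U x)
    (hU' : ∀ x a, U' (Function.update x t a) = U' x) :
    localOp t U * localOp t' U' = localOp t' U' * localOp t U := by
  ext y x
  rw [localOp_mul_apply, localOp_mul_apply]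
  rw [Finset.sum_eq_single (x t), Finset.sum_eq_single (x t')]
  · simp only [localOp]
    have h1 : (∀ i, i ≠ t' → Function.update y t (x t) i = x i) ↔
        (∀ i, i ≠ t → Function.update y t' (x t') i = x i) := by
      constructor
      · intro H i hi
        by_cases hi' : i = t'
        · simp [hi']
        · simpa [hi, hi'] using H i hi'
      · intro H i hi
        by_cases hi' : i = t
        · simp [hi']
        · simpa [hi, hi'] using H i hi'
    by_cases h2 : ∀ i, i ≠ t' → Function.update y t (x t) i = x i
    · rw [if_pos h2, if_pos (h1.1 h2)]
      have e1 : U (Function.update y t (x t)) = U x := by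
        rw [← hU _ (x t'), ← hU x (x t')]
        congr 1
        funext i
        by_cases hi : i = t'
        · simp [hi]
        · simpa [hi] using h2 i hi
      have e2 : U' (Function.update y t' (x t')) = U' x := by
        rw [← hU' _ (x t), ← hU' x (x t)]
        congr 1
        funext i
        by_cases hi : i = t
        · simp [hi]
        · simpa [hi] using h1.1 h2 i hi
      rw [e1, e2]
      simp only [Function.update_of_ne h.symm, Function.update_of_ne h]
      ring
    · rw [if_neg h2, if_neg (fun H => h2 (h1.2 H))]
      simp
  · intro b _ hb
    have : ¬ ∀ i, i ≠ t → Function.update y t' b i = x i := fun H => hb (by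
      simpa using H t' h.symm)
    simp [localOp, this]
  · simp
  · intro b _ hb
    have : ¬ ∀ i, i ≠ t' → Function.update y t b i = x i := fun H => hb (by
      simpa using H t h)
    simp [localOp, this]
  · simp

theorem conjBy_comp (K L : (C → ZMod p) → Matrix (Q → ZMod p) (Q → ZMod p) ℂ)
    (ρ : CQState p Q C) : conjBy K (conjBy L ρ) = conjBy (fun c => K c * L c) ρ := by
  funext c
  simp [conjBy, Matrix.mul_assoc]

theorem conjBy_writeClassical {K : (C → ZMod p) → Matrix (Q → ZMod p) (Q → ZMod p) ℂ}
    {w : C} (hK : ∀ c v, K (Function.update c w v) = K c) (f : (C → ZMod p) → ZMod p)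
    (ρ : CQState p Q C) : conjBy K (writeClassical w f ρ) = writeClassical w f (conjBy K ρ) := by
  funext c
  simp only [conjBy, writeClassical_apply]
  rw [Matrix.mul_sum, Matrix.sum_mul]
  refine Finset.sum_congr rfl fun v _ => ?_
  split_ifs <;> simp [hK]

/-- The classical wires are transformed by `F`. -/
def pushClassical (F : (C → ZMod p) → (C → ZMod p)) (ρ : CQState p Q C) : CQState p Q C :=
  fun c' => ∑ c, if F c = c' then ρ c else 0

theorem writeClassical_eq_pushClassical (w : C) (f : (C → ZMod p) → ZMod p) :
    (writeClassical w f : CQState p Q C → CQState p Q C) =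
      pushClassical fun c => Function.update c w (f c) := rfl

/-- Deterministic classical gates compose as functions, so the correctness of classical subcircuits
reduces to identities between maps on assignments. -/
theorem pushClassical_comp (F G : (C → ZMod p) → (C → ZMod p)) (ρ : CQState p Q C) :
    pushClassical F (pushClassical G ρ) = pushClassical (fun c => F (G c)) ρ := by
  funext c'
  simp only [pushClassical, ← Finset.sum_filter]
  rw [Finset.sum_sigma']
  simp only [Finset.sum_filter]
  rw [← Finset.sum_filter]
  refine Finset.sum_bij' (fun a _ => a.2) (fun c _ => ⟨G c, c⟩) ?_ ?_ ?_ ?_ ?_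
  all_goals simp +contextual

theorem writeClassical_comm {w w' : C} (h : w ≠ w') {f f' : (C → ZMod p) → ZMod p}
    (hf : ∀ c v, f (Function.update c w' v) = f c) (hf' : ∀ c v, f' (Function.update c w v) = f' c)
    (ρ : CQState p Q C) :
    writeClassical w f (writeClassical w' f' ρ) = writeClassical w' f' (writeClassical w f ρ) := by
  simp only [writeClassical_eq_pushClassical, pushClassical_comp]
  congr 1
  funext c
  simp [hf, hf', Function.update_comm h]

/-- Compositions and sums inherit commutation, which leaves conjugations against writes. There,
disjointness means that neither map changes what the parameter `U` or `f` of the other depends on.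
-/
theorem IsAction.commute {W W' : Set Q} {R R' V V' : Set C} {S T : CQState p Q C → CQState p Q C}
    (hS : IsAction W R V S) (hT : IsAction W' R' V' T) (hW : Disjoint W W') (hV : Disjoint V V')
    (h₁ : Disjoint V R') (h₂ : Disjoint R V') (ρ : CQState p Q C) : S (T ρ) = T (S ρ) := by
  have upd {ι : Type} [DecidableEq ι] (A B : Set ι) (h : Disjoint A B) {a : ι} (ha : a ∈ B)
      (x : ι → ZMod p) (v : ZMod p) : ∀ i ∈ A, Function.update x a v i = x i := fun i hi => by
    rw [Function.update_of_ne]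
    rintro rfl
    exact Set.disjoint_left.1 h hi ha
  induction hS generalizing ρ with
  | conj t ht U hU =>
    induction hT generalizing ρ with
    | conj t' ht' U' hU' =>
      rw [conjBy_comp, conjBy_comp]
      congr 1
      funext c
      refine localOp_comm (hW.ne_of_mem ht ht') ?_ ?_
      · exact fun x a => hU _ _ _ _ (fun _ _ => rfl) (upd _ _ hW ht' x a)
      · exact fun x a => hU' _ _ _ _ (fun _ _ => rfl) (upd _ _ hW.symm ht x a)
    | write w hw f hf =>
      refine conjBy_writeClassical (fun c v => ?_) f ρ
      congr 1
      funext x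
      exact hU _ _ _ _ (upd _ _ h₂ hw c v) fun _ _ => rfl
    | id => rfl
    | comp hS hT ihS ihT => simp only [Function.comp]; rw [ihS, ihT]
    | sum s T hT ih => rw [conjBy_sum]; simp only [ih]
  | write w hw f hf =>
    induction hT generalizing ρ with
    | conj t' ht' U' hU' =>
      refine (conjBy_writeClassical (fun c v => ?_) f ρ).symm
      congr 1
      funext x
      exact hU' _ _ _ _ (upd _ _ h₁.symm hw c v) fun _ _ => rfl
    | write w' hw' f' hf' =>
      refine writeClassical_comm (hV.ne_of_mem hw hw') ?_ ?_ ρ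
      · exact fun c v => hf _ _ (upd _ _ h₂ hw' c v)
      · exact fun c v => hf' _ _ (upd _ _ h₁.symm hw c v)
    | id => rfl
    | comp hS hT ihS ihT => simp only [Function.comp]; rw [ihS, ihT]
    | sum s T hT ih => rw [writeClassical_sum]; simp only [ih]
  | id => rfl
  | comp hS hT ihS ihT => simp only [Function.comp]; rw [ihT, ihS]
  | sum s T' hT' ih => rw [hT.map_sum]; simp only [ih]

/-! ### Clean wires -/

/-- The qudits of `A` are in the state `|0⟩` and the classical wires of `B` have the value `0`. -/
def Clean (A : Set Q) (B : Set C) (ρ : CQState p Q C) : Prop :=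
  ∀ c x y, ρ c x y ≠ 0 → (∀ b ∈ B, c b = 0) ∧ (∀ q ∈ A, x q = 0 ∧ y q = 0)

theorem Clean.mono {A A' : Set Q} {B B' : Set C} {ρ : CQState p Q C} (h : Clean A B ρ)
    (hA : A' ⊆ A) (hB : B' ⊆ B) : Clean A' B' ρ := fun c x y hρ =>
  ⟨fun b hb => (h c x y hρ).1 b (hB hb), fun q hq => (h c x y hρ).2 q (hA hq)⟩

theorem Clean.union {A A' : Set Q} {B B' : Set C} {ρ : CQState p Q C} (h : Clean A B ρ)
    (h' : Clean A' B' ρ) : Clean (A ∪ A') (B ∪ B') ρ := fun c x y hρ =>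
  ⟨fun b hb => hb.elim ((h c x y hρ).1 b) ((h' c x y hρ).1 b),
    fun q hq => hq.elim ((h c x y hρ).2 q) ((h' c x y hρ).2 q)⟩

theorem Clean.sum {ι : Type} {A : Set Q} {B : Set C} (s : Finset ι) {ρ : ι → CQState p Q C}
    (h : ∀ i ∈ s, Clean A B (ρ i)) : Clean A B (∑ i ∈ s, ρ i) := by
  intro c x y hne
  rw [Finset.sum_apply, Matrix.sum_apply] at hne
  obtain ⟨i, hi, hne⟩ := Finset.exists_ne_zero_of_sum_ne_zero hne
  exact h i hi c x y hne

/-- A nonzero entry of the image stems from a nonzero entry of `ρ` whose indices agree with it on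
`A` and `B`. -/
theorem IsAction.clean {W : Set Q} {R V : Set C} {T : CQState p Q C → CQState p Q C}
    (hT : IsAction W R V T) {A : Set Q} {B : Set C} (hA : Disjoint A W) (hB : Disjoint B V)
    {ρ : CQState p Q C} (hρ : Clean A B ρ) : Clean A B (T ρ) := by
  induction hT generalizing ρ with
  | conj t ht U hU =>
    intro c x y hne
    rw [conjBy_localOp_apply] at hne
    obtain ⟨b, -, hne⟩ := Finset.exists_ne_zero_of_sum_ne_zero hne
    obtain ⟨a, -, hne⟩ := Finset.exists_ne_zero_of_sum_ne_zero (left_ne_zero_of_mul hne)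
    obtain ⟨h1, h2⟩ := hρ _ _ _ (right_ne_zero_of_mul hne)
    refine ⟨h1, fun q hq => ?_⟩
    have hqt : q ≠ t := fun h => Set.disjoint_left.1 hA hq (h ▸ ht)
    simpa [hqt] using h2 q hq
  | write w hw f hf =>
    intro c x y hne
    rw [writeClassical_apply, Matrix.sum_apply] at hne
    obtain ⟨v, -, hne⟩ := Finset.exists_ne_zero_of_sum_ne_zero hne
    split_ifs at hne
    · obtain ⟨h1, h2⟩ := hρ _ _ _ hne
      refine ⟨fun b hb => ?_, h2⟩
      have hbw : b ≠ w := fun h => Set.disjoint_left.1 hB hb (h ▸ hw)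
      simpa [hbw] using h1 b hb
    · exact absurd rfl hne
  | id => exact hρ
  | comp hS hT ihS ihT => exact ihS (ihT hρ)
  | sum s T hT ih => exact Clean.sum s fun i _ => ih i hρ

end

section

variable {p : ℕ} [NeZero p] {Q C : Type} [Fintype Q] [DecidableEq Q] [Fintype C] [DecidableEq C]

/-! ### Realizing maps by layers of gates inside a zone -/

/-- The gates of a list, applied in order. -/
def runGates (L : List (Gate p Q C)) (ρ : CQState p Q C) : CQState p Q C :=
  L.foldl (fun τ g => g.apply τ) ρ

/-- Layers of gates, applied in order. -/
def runLayers (Ls : List (List (Gate p Q C))) (ρ : CQState p Q C) : CQState p Q C :=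
  runGates Ls.flatten ρ

theorem runGates_append (L M : List (Gate p Q C)) (ρ : CQState p Q C) :
    runGates (L ++ M) ρ = runGates M (runGates L ρ) := by
  simp [runGates]

theorem runLayers_cons (L : List (Gate p Q C)) (Ls : List (List (Gate p Q C)))
    (ρ : CQState p Q C) : runLayers (L :: Ls) ρ = runLayers Ls (runGates L ρ) := by
  simp [runLayers, runGates_append]

theorem runLayers_append (Ls Ms : List (List (Gate p Q C))) (ρ : CQState p Q C) :
    runLayers (Ls ++ Ms) ρ = runLayers Ms (runLayers Ls ρ) := by
  simp [runLayers, runGates_append]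

/-- A zone of the wires: the qudits `ext` that gates act on, the classical wires `reads` that they
may read and `writes` that they may read and write, and ancillary qudits and classical wires, which
are clean at the beginning and at the end. -/
structure Zone (Q C : Type) where
  /-- The qudits acted on. -/
  ext : Set Q
  /-- The classical wires that are only read. -/
  reads : Set C
  /-- The classical wires that are written. -/
  writes : Set C
  /-- The ancillary qudits. -/
  anc : Set Q
  /-- The ancillary classical wires. -/
  canc : Set C

/-- All qudits of a zone. -/
def Zone.qudits (Z : Zone Q C) : Set Q := Z.ext ∪ Z.anc

/-- All classical wires that may be written. -/
def Zone.outs (Z : Zone Q C) : Set C := Z.writes ∪ Z.canc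

/-- All classical wires that may be read. -/
def Zone.ins (Z : Zone Q C) : Set C := Z.reads ∪ Z.outs

/-- The zone `Z` is contained in the zone `Z'`, whose additional ancillas lie outside `Z`. -/
structure Zone.Sub (Z Z' : Zone Q C) : Prop where
  qudits : Z.qudits ⊆ Z'.qudits
  ins : Z.ins ⊆ Z'.ins
  outs : Z.outs ⊆ Z'.outs
  anc : Z.anc ⊆ Z'.anc
  canc : Z.canc ⊆ Z'.canc
  disj_ext : Disjoint Z'.anc Z.ext
  disj_writes : Disjoint Z'.canc Z.writes

/-- Gates in two independent zones may be executed in parallel. -/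
structure Zone.Indep (Z Z' : Zone Q C) : Prop where
  qudits : Disjoint Z.qudits Z'.qudits
  outs_ins : Disjoint Z.outs Z'.ins
  ins_outs : Disjoint Z.ins Z'.outs

/-- The union of two zones. -/
def Zone.union (Z Z' : Zone Q C) : Zone Q C :=
  ⟨Z.ext ∪ Z'.ext, Z.reads ∪ Z'.reads, Z.writes ∪ Z'.writes, Z.anc ∪ Z'.anc, Z.canc ∪ Z'.canc⟩

theorem Zone.Indep.symm {Z Z' : Zone Q C} (h : Z.Indep Z') : Z'.Indep Z :=
  ⟨h.qudits.symm, h.ins_outs.symm, h.outs_ins.symm⟩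

theorem Zone.outs_subset_ins (Z : Zone Q C) : Z.outs ⊆ Z.ins := Set.subset_union_right

theorem Zone.qudits_union (Z Z' : Zone Q C) : (Z.union Z').qudits = Z.qudits ∪ Z'.qudits := by
  simp only [Zone.qudits, Zone.union]; exact Set.union_union_union_comm _ _ _ _

theorem Zone.outs_union (Z Z' : Zone Q C) : (Z.union Z').outs = Z.outs ∪ Z'.outs := by
  simp only [Zone.outs, Zone.union]; exact Set.union_union_union_comm _ _ _ _

theorem Zone.ins_union (Z Z' : Zone Q C) : (Z.union Z').ins = Z.ins ∪ Z'.ins := by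
  rw [Zone.ins, Zone.outs_union]
  simp only [Zone.ins, Zone.union]; exact Set.union_union_union_comm _ _ _ _

theorem Zone.Sub.union {Z₁ Z₂ Z : Zone Q C} (h₁ : Z₁.Sub Z) (h₂ : Z₂.Sub Z) :
    (Z₁.union Z₂).Sub Z where
  qudits := by rw [Zone.qudits_union]; exact Set.union_subset h₁.qudits h₂.qudits
  ins := by rw [Zone.ins_union]; exact Set.union_subset h₁.ins h₂.ins
  outs := by rw [Zone.outs_union]; exact Set.union_subset h₁.outs h₂.outs
  anc := Set.union_subset h₁.anc h₂.anc
  canc := Set.union_subset h₁.canc h₂.canc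
  disj_ext := Set.disjoint_union_right.2 ⟨h₁.disj_ext, h₂.disj_ext⟩
  disj_writes := Set.disjoint_union_right.2 ⟨h₁.disj_writes, h₂.disj_writes⟩

theorem Zone.Indep.union_left {Z₁ Z₂ Z : Zone Q C} (h₁ : Z₁.Indep Z) (h₂ : Z₂.Indep Z) :
    (Z₁.union Z₂).Indep Z where
  qudits := by rw [Zone.qudits_union]; exact Set.disjoint_union_left.2 ⟨h₁.qudits, h₂.qudits⟩
  outs_ins := by
    rw [Zone.outs_union]; exact Set.disjoint_union_left.2 ⟨h₁.outs_ins, h₂.outs_ins⟩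
  ins_outs := by
    rw [Zone.ins_union]; exact Set.disjoint_union_left.2 ⟨h₁.ins_outs, h₂.ins_outs⟩

/-- The gate acts inside the zone. -/
structure Gate.InZone (g : Gate p Q C) (Z : Zone Q C) : Prop where
  qwires : (g.qwires : Set Q) ⊆ Z.qudits
  creads : (g.creads : Set C) ⊆ Z.ins
  cwrites : (g.cwrites : Set C) ⊆ Z.outs

theorem Gate.InZone.mono {g : Gate p Q C} {Z Z' : Zone Q C} (h : g.InZone Z)
    (hq : Z.qudits ⊆ Z'.qudits) (hi : Z.ins ⊆ Z'.ins) (ho : Z.outs ⊆ Z'.outs) : g.InZone Z' :=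
  ⟨h.qwires.trans hq, h.creads.trans hi, h.cwrites.trans ho⟩

theorem Gate.InZone.compatible {g h : Gate p Q C} {Z Z' : Zone Q C} (hg : g.InZone Z)
    (hh : h.InZone Z') (hZ : Z.Indep Z') : g.Compatible h := by
  simp only [Gate.Compatible, ← Finset.disjoint_coe]
  exact ⟨hZ.qudits.mono hg.qwires hh.qwires,
    hZ.outs_ins.mono hg.cwrites (hh.cwrites.trans Z'.outs_subset_ins),
    hZ.outs_ins.mono hg.cwrites hh.creads, hZ.ins_outs.mono hg.creads hh.cwrites⟩

theorem isAction_runGates {L : List (Gate p Q C)} {Z : Zone Q C} (h : ∀ g ∈ L, g.InZone Z) :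
    IsAction Z.qudits Z.ins Z.outs (runGates L) := by
  induction L with
  | nil => exact .id
  | cons g L ih =>
    have hg := h g (by simp)
    exact (ih fun g' hg' => h g' (by simp [hg'])).comp
      (g.isAction.mono hg.qwires hg.creads hg.cwrites)

theorem isAction_runLayers {Ls : List (List (Gate p Q C))} {Z : Zone Q C}
    (h : ∀ L ∈ Ls, ∀ g ∈ L, g.InZone Z) : IsAction Z.qudits Z.ins Z.outs (runLayers Ls) :=
  isAction_runGates fun g hg => by
    obtain ⟨L, hL, hg⟩ := List.mem_flatten.1 hg
    exact h L hL g hg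

/-- Parallel composition of two sequences of layers. -/
def zipLayers {α : Type*} : List (List α) → List (List α) → List (List α)
  | [], Ms => Ms
  | L :: Ls, [] => L :: Ls
  | L :: Ls, M :: Ms => (L ++ M) :: zipLayers Ls Ms

theorem length_zipLayers {α : Type*} (Ls Ms : List (List α)) :
    (zipLayers Ls Ms).length = max Ls.length Ms.length := by
  induction Ls generalizing Ms with
  | nil => simp [zipLayers]
  | cons L Ls ih =>
    cases Ms with
    | nil => simp [zipLayers]
    | cons M Ms => simp [zipLayers, ih]

theorem forall_mem_zipLayers {α : Type*} {P P₁ P₂ : List α → Prop} {Ls Ms : List (List α)}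
    (h₁ : ∀ L ∈ Ls, P₁ L) (h₂ : ∀ L ∈ Ms, P₂ L) (hP₁ : ∀ L, P₁ L → P L) (hP₂ : ∀ L, P₂ L → P L)
    (h : ∀ L M, P₁ L → P₂ M → P (L ++ M)) : ∀ L ∈ zipLayers Ls Ms, P L := by
  induction Ls generalizing Ms with
  | nil => exact fun L hL => hP₂ L (h₂ L hL)
  | cons L Ls ih =>
    cases Ms with
    | nil => exact fun L hL => hP₁ L (h₁ L hL)
    | cons M Ms =>
      intro N hN
      rcases List.mem_cons.1 hN with rfl | hN
      · exact h _ _ (h₁ _ (by simp)) (h₂ _ (by simp))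
      · exact ih (fun L hL => h₁ L (by simp [hL])) (fun L hL => h₂ L (by simp [hL])) N hN

/-- In the zipped sequence the first layer `M` runs before the rest of `Ls`. It is moved past these
layers because maps in independent zones commute. -/
theorem runLayers_zipLayers {Z Z' : Zone Q C} (hZ : Z.Indep Z') {Ls Ms : List (List (Gate p Q C))}
    (h₁ : ∀ L ∈ Ls, ∀ g ∈ L, g.InZone Z) (h₂ : ∀ L ∈ Ms, ∀ g ∈ L, g.InZone Z')
    (ρ : CQState p Q C) : runLayers (zipLayers Ls Ms) ρ = runLayers Ms (runLayers Ls ρ) := by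
  induction Ls generalizing Ms ρ with
  | nil => rfl
  | cons L Ls ih =>
    cases Ms with
    | nil => rfl
    | cons M Ms =>
      have h₁' : ∀ L ∈ Ls, ∀ g ∈ L, g.InZone Z := fun L hL => h₁ L (by simp [hL])
      have h₂' : ∀ L ∈ Ms, ∀ g ∈ L, g.InZone Z' := fun L hL => h₂ L (by simp [hL])
      rw [zipLayers, runLayers_cons, runLayers_cons, runLayers_cons, ih h₁' h₂', runGates_append]
      congr 1
      exact (isAction_runLayers h₁').commute (isAction_runGates fun g hg => h₂ M (by simp) g hg)
        hZ.qudits (hZ.outs_ins.mono_right Z'.outs_subset_ins) hZ.outs_ins hZ.ins_outs _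

/-- `T` is the effect of at most `d` layers of gates from `G` inside the zone `Z` on the states
where the ancillas of `Z` are clean. -/
def Realizes (G : Gate p Q C → Prop) (Z : Zone Q C) (d : ℕ)
    (T : CQState p Q C → CQState p Q C) : Prop :=
  ∃ Ls : List (List (Gate p Q C)), Ls.length ≤ d ∧
    (∀ L ∈ Ls, L.Pairwise Gate.Compatible ∧ ∀ g ∈ L, G g ∧ g.InZone Z) ∧
    ∀ ρ, Clean Z.anc Z.canc ρ → runLayers Ls ρ = T ρ ∧ Clean Z.anc Z.canc (T ρ)

namespace Realizes

variable {G : Gate p Q C → Prop} {Z Z' : Zone Q C} {d d' : ℕ} {S T : CQState p Q C → CQState p Q C}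

theorem id : Realizes G Z d id :=
  ⟨[], by simp, by simp, fun _ hρ => ⟨rfl, hρ⟩⟩

theorem comp (hS : Realizes G Z d S) (hT : Realizes G Z d' T) :
    Realizes G Z (d' + d) (S ∘ T) := by
  obtain ⟨Ls, h1, h2, h3⟩ := hS
  obtain ⟨Ms, h1', h2', h3'⟩ := hT
  refine ⟨Ms ++ Ls, by simp; omega, ?_, fun ρ hρ => ?_⟩
  · intro L hL
    rcases List.mem_append.1 hL with hL | hL
    · exact h2' L hL
    · exact h2 L hL
  · obtain ⟨e1, c1⟩ := h3' ρ hρ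
    obtain ⟨e2, c2⟩ := h3 _ c1
    exact ⟨by rw [runLayers_append, e1, e2]; rfl, c2⟩

/-- This is how working wires become ancillas. A composite is built in a zone `Z` that treats them
as exterior or written wires; the zone `Z'` may list them as ancillas as soon as the total map, on
clean states, is known to return them clean. -/
theorem restrict (hT : Realizes G Z d T) (hq : Z.qudits ⊆ Z'.qudits) (hi : Z.ins ⊆ Z'.ins)
    (ho : Z.outs ⊆ Z'.outs) (hA : Z.anc ⊆ Z'.anc) (hB : Z.canc ⊆ Z'.canc) (hd : d ≤ d')
    (h : ∀ ρ, Clean Z'.anc Z'.canc ρ → T ρ = S ρ ∧ Clean Z'.anc Z'.canc (S ρ)) :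
    Realizes G Z' d' S := by
  obtain ⟨Ls, h1, h2, h3⟩ := hT
  refine ⟨Ls, h1.trans hd, fun L hL => ⟨(h2 L hL).1, fun g hg => ⟨((h2 L hL).2 g hg).1,
    ((h2 L hL).2 g hg).2.mono hq hi ho⟩⟩, fun ρ hρ => ?_⟩
  rw [(h3 ρ (hρ.mono hA hB)).1, (h ρ hρ).1]
  exact ⟨rfl, (h ρ hρ).2⟩

/-- Wires of `A` and `B` that are ancillas of `Z` are returned clean by the definition of
`Realizes`; the others are outside everything that the layers change. -/
theorem clean_of_disjoint (hT : Realizes G Z d T) {A : Set Q} {B : Set C}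
    (hA : Disjoint A Z.ext) (hB : Disjoint B Z.writes) {ρ : CQState p Q C} (hρ : Clean A B ρ)
    (hρ' : Clean Z.anc Z.canc ρ) : Clean A B (T ρ) := by
  obtain ⟨Ls, h1, h2, h3⟩ := hT
  obtain ⟨h4, h5⟩ := h3 ρ hρ'
  have h6 : Clean (A \ Z.anc) (B \ Z.canc) (T ρ) := by
    rw [← h4]
    refine (isAction_runLayers (Z := Z) fun L hL g hg => ((h2 L hL).2 g hg).2).clean ?_ ?_
      (hρ.mono Set.sdiff_subset Set.sdiff_subset)
    · exact Set.disjoint_union_right.2 ⟨hA.mono_left Set.sdiff_subset, Set.disjoint_sdiff_left⟩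
    · exact Set.disjoint_union_right.2 ⟨hB.mono_left Set.sdiff_subset, Set.disjoint_sdiff_left⟩
  exact (h6.union h5).mono (by simp) (by simp)

theorem mono (hT : Realizes G Z d T) (h : Z.Sub Z') (hd : d ≤ d') : Realizes G Z' d' T :=
  hT.restrict h.qudits h.ins h.outs h.anc h.canc hd fun _ hρ =>
    ⟨rfl, hT.clean_of_disjoint h.disj_ext h.disj_writes hρ (hρ.mono h.anc h.canc)⟩

theorem congr (hT : Realizes G Z d T) (h : ∀ ρ, Clean Z.anc Z.canc ρ → T ρ = S ρ) :
    Realizes G Z d S :=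
  hT.restrict subset_rfl subset_rfl subset_rfl subset_rfl subset_rfl le_rfl fun ρ hρ =>
    ⟨h ρ hρ, h ρ hρ ▸ by obtain ⟨_, _, _, h3⟩ := hT; exact (h3 ρ hρ).2⟩

/-- The layers are zipped, so the depth does not add up. Independence ensures that each map
preserves the cleanness of the ancillas of the other. -/
theorem par (hS : Realizes G Z d S) (hT : Realizes G Z' d T) (hZ : Z.Indep Z') :
    Realizes G (Z.union Z') d (T ∘ S) := by
  have hS' := hS
  have hT' := hT
  obtain ⟨Ls, h1, h2, h3⟩ := hS
  obtain ⟨Ms, h1', h2', h3'⟩ := hT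
  refine ⟨zipLayers Ls Ms, by rw [length_zipLayers]; exact max_le h1 h1', ?_, fun ρ hρ => ?_⟩
  · refine forall_mem_zipLayers h2 h2' ?_ ?_ ?_
    · exact fun L hL => ⟨hL.1, fun g hg => ⟨(hL.2 g hg).1, (hL.2 g hg).2.mono
        (by rw [Zone.qudits_union]; exact Set.subset_union_left)
        (by rw [Zone.ins_union]; exact Set.subset_union_left)
        (by rw [Zone.outs_union]; exact Set.subset_union_left)⟩⟩
    · exact fun L hL => ⟨hL.1, fun g hg => ⟨(hL.2 g hg).1, (hL.2 g hg).2.mono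
        (by rw [Zone.qudits_union]; exact Set.subset_union_right)
        (by rw [Zone.ins_union]; exact Set.subset_union_right)
        (by rw [Zone.outs_union]; exact Set.subset_union_right)⟩⟩
    · intro L M hL hM
      refine ⟨List.pairwise_append.2 ⟨hL.1, hM.1, fun g hg h hh =>
        (hL.2 g hg).2.compatible (hM.2 h hh).2 hZ⟩, fun g hg => ?_⟩
      rcases List.mem_append.1 hg with hg | hg
      · exact ⟨(hL.2 g hg).1, (hL.2 g hg).2.mono
          (by rw [Zone.qudits_union]; exact Set.subset_union_left)
          (by rw [Zone.ins_union]; exact Set.subset_union_left)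
          (by rw [Zone.outs_union]; exact Set.subset_union_left)⟩
      · exact ⟨(hM.2 g hg).1, (hM.2 g hg).2.mono
          (by rw [Zone.qudits_union]; exact Set.subset_union_right)
          (by rw [Zone.ins_union]; exact Set.subset_union_right)
          (by rw [Zone.outs_union]; exact Set.subset_union_right)⟩
  · have c1 : Clean Z.anc Z.canc ρ := hρ.mono Set.subset_union_left Set.subset_union_left
    have c2 : Clean Z'.anc Z'.canc ρ := hρ.mono Set.subset_union_right Set.subset_union_right
    obtain ⟨e1, c3⟩ := h3 ρ c1
    have dq : Disjoint Z'.anc Z.ext :=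
      (hZ.qudits.mono Set.subset_union_left Set.subset_union_right).symm
    have dc : Disjoint Z'.canc Z.writes :=
      (hZ.outs_ins.mono Set.subset_union_left
        (Set.subset_union_right.trans Z'.outs_subset_ins)).symm
    have c4 : Clean Z'.anc Z'.canc (S ρ) := hS'.clean_of_disjoint dq dc c2 c1
    obtain ⟨e2, c5⟩ := h3' _ c4
    have dq' : Disjoint Z.anc Z'.ext :=
      hZ.qudits.mono Set.subset_union_right Set.subset_union_left
    have dc' : Disjoint Z.canc Z'.writes :=
      hZ.outs_ins.mono Set.subset_union_right
        (Set.subset_union_left.trans Z'.outs_subset_ins)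
    have c6 := hT'.clean_of_disjoint dq' dc' c3 c4
    refine ⟨?_, c6.union c5⟩
    rw [runLayers_zipLayers hZ (fun L hL g hg => ((h2 L hL).2 g hg).2)
      (fun L hL g hg => ((h2' L hL).2 g hg).2), e1, e2]
    rfl

theorem gate (g : Gate p Q C) (hg : G g) (hZ : g.InZone Z) (hA : Disjoint Z.anc g.qwires)
    (hB : Disjoint Z.canc g.cwrites) : Realizes G Z 1 g.apply :=
  ⟨[[g]], by simp, by simpa using ⟨hg, hZ⟩, fun ρ hρ => ⟨by simp [runLayers, runGates],
    g.isAction.clean hA hB hρ⟩⟩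

/-- Parallel composition of a family of maps in independent zones. -/
theorem family {ι : Type*} [DecidableEq ι] (s : Finset ι) (Z : ι → Zone Q C) (Z' : Zone Q C)
    (T : ι → CQState p Q C → CQState p Q C) (Tf : Finset ι → CQState p Q C → CQState p Q C)
    (hT : ∀ i ∈ s, Realizes G (Z i) d (T i)) (hZ : ∀ i ∈ s, (Z i).Sub Z')
    (hind : ∀ i ∈ s, ∀ j ∈ s, i ≠ j → (Z i).Indep (Z j)) (h0 : ∀ ρ, Tf ∅ ρ = ρ)
    (hstep : ∀ i ∈ s, ∀ t ⊆ s, i ∉ t → ∀ ρ, Clean Z'.anc Z'.canc ρ →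
      T i (Tf t ρ) = Tf (insert i t) ρ) : Realizes G Z' d (Tf s) := by
  -- Induction over the subset `t` already treated. The invariant carries a zone that stays
  -- independent of all the zones not yet used, so that `par` applies once more.
  suffices H : ∀ t ⊆ s, ∃ Zt : Zone Q C, Zt.Sub Z' ∧ (∀ i ∈ s, i ∉ t → Zt.Indep (Z i)) ∧
      ∃ Tt, Realizes G Zt d Tt ∧ ∀ ρ, Clean Z'.anc Z'.canc ρ → Tt ρ = Tf t ρ by
    obtain ⟨Zt, h1, -, Tt, h2, h3⟩ := H s subset_rfl
    exact (h2.mono h1 le_rfl).congr h3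
  intro t
  induction t using Finset.induction_on with
  | empty =>
    refine fun _ => ⟨⟨∅, ∅, ∅, ∅, ∅⟩, ?_, ?_, _, Realizes.id, fun ρ _ => (h0 ρ).symm⟩
    · constructor <;> simp [Zone.qudits, Zone.ins, Zone.outs]
    · intro i _ _
      constructor <;> simp [Zone.qudits, Zone.ins, Zone.outs]
  | insert i t hi ih =>
    intro hs
    have his : i ∈ s := hs (Finset.mem_insert_self _ _)
    have hts : t ⊆ s := fun j hj => hs (Finset.mem_insert_of_mem hj)
    obtain ⟨Zt, h1, h2, Tt, h3, h4⟩ := ih hts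
    refine ⟨Zt.union (Z i), h1.union (hZ i his), fun j hj hjt => ?_, _,
      h3.par (hT i his) (h2 i his hi), fun ρ hρ => ?_⟩
    · simp only [Finset.mem_insert, not_or] at hjt
      exact (h2 j hj hjt.2).union_left (hind i his j hj (Ne.symm hjt.1))
    · simp only [Function.comp]
      rw [h4 ρ hρ, hstep i his t hts hi ρ hρ]

end Realizes

end

section

variable {p : ℕ} [NeZero p] {Q C : Type} [Fintype Q] [DecidableEq Q] [Fintype C] [DecidableEq C]
  {Q' C' : Type} [Fintype Q'] [DecidableEq Q'] [Fintype C'] [DecidableEq C']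

/-! ### Embedding a circuit into more wires -/

/-- The gate placed on the images of its wires. -/
def Gate.map (e : Q ↪ Q') (f : C ↪ C') : Gate p Q C → Gate p Q' C'
  | .oneQudit q U => .oneQudit (e q) U
  | .ctrl a t h U => .ctrl (e a) (e t) (fun h' => h (e.injective h')) U
  | .classicalCtrl c q U => .classicalCtrl (f c) (e q) U
  | .measure q w => .measure (e q) (f w)
  | .boundedClassical a b w g => .boundedClassical (f a) (f b) (f w) g
  | .classicalMod S w => .classicalMod (S.map f) (f w)
  | .multiCtrl S v t h U => .multiCtrl (S.map e) (Function.extend e v 0) (e t) (by simpa using h) U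
  | .qThreshold k S t h => .qThreshold k (S.map e) (e t) (by simpa using h)

/-- The state of more wires, the additional ones being clean. -/
def embed (e : Q ↪ Q') (f : C ↪ C') (ρ : CQState p Q C) : CQState p Q' C' :=
  fun c x y => if (∀ b, (∀ a, f a ≠ b) → c b = 0) ∧ ∀ q, (∀ i, e i ≠ q) → x q = 0 ∧ y q = 0
    then ρ (c ∘ f) (x ∘ e) (y ∘ e) else 0

theorem embed_of_pos (e : Q ↪ Q') (f : C ↪ C') (ρ : CQState p Q C) {c : C' → ZMod p}
    {x y : Q' → ZMod p} (hc : ∀ b, (∀ a, f a ≠ b) → c b = 0)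
    (hx : ∀ q, (∀ i, e i ≠ q) → x q = 0 ∧ y q = 0) :
    embed e f ρ c x y = ρ (c ∘ f) (x ∘ e) (y ∘ e) := if_pos ⟨hc, hx⟩

theorem embed_of_neg (e : Q ↪ Q') (f : C ↪ C') (ρ : CQState p Q C) {c : C' → ZMod p}
    {x y : Q' → ZMod p} (h : ¬((∀ b, (∀ a, f a ≠ b) → c b = 0) ∧
      ∀ q, (∀ i, e i ≠ q) → x q = 0 ∧ y q = 0)) : embed e f ρ c x y = 0 := if_neg h

theorem clean_embed (e : Q ↪ Q') (f : C ↪ C') (ρ : CQState p Q C) :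
    Clean (Set.range e)ᶜ (Set.range f)ᶜ (embed e f ρ) := by
  intro c x y h
  simp only [embed, ne_eq, ite_eq_right_iff, not_forall] at h
  obtain ⟨⟨h1, h2⟩, -⟩ := h
  exact ⟨fun b hb => h1 b fun a ha => hb ⟨a, ha⟩, fun q hq => h2 q fun a ha => hq ⟨a, ha⟩⟩

theorem update_embedding_comp {α β γ : Type*} [DecidableEq α] [DecidableEq β] (e : α ↪ β)
    (x : β → γ) (i : α) (a : γ) :
    Function.update x (e i) a ∘ e = Function.update (x ∘ e) i a :=
  Function.update_comp_eq_of_injective x e.injective i a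

theorem embed_conjBy (e : Q ↪ Q') (f : C ↪ C') (t : Q)
    (U : (C → ZMod p) → (Q → ZMod p) → Matrix (ZMod p) (ZMod p) ℂ) (ρ : CQState p Q C) :
    conjBy (fun c => localOp (e t) fun x => U (c ∘ f) (x ∘ e)) (embed e f ρ) =
      embed e f (conjBy (fun c => localOp t (U c)) ρ) := by
  funext c
  ext x y
  have hc (a b : ZMod p) : (∀ q, (∀ i, e i ≠ q) →
      Function.update x (e t) a q = 0 ∧ Function.update y (e t) b q = 0) ↔
      ∀ q, (∀ i, e i ≠ q) → x q = 0 ∧ y q = 0 := by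
    refine forall₂_congr fun q hq => ?_
    rw [Function.update_of_ne (hq t).symm, Function.update_of_ne (hq t).symm]
  have hl := conjBy_localOp_apply (e t) (fun c x => U (c ∘ f) (x ∘ e)) (embed e f ρ) c x y
  rw [hl]
  simp only [embed, hc, update_embedding_comp]
  split_ifs
  · have hr := conjBy_localOp_apply t U ρ (c ∘ f) (x ∘ e) (y ∘ e)
    rw [hr]
    rfl
  · simp

theorem embed_writeClassical (e : Q ↪ Q') (f : C ↪ C') (w : C) (F : (C → ZMod p) → ZMod p)
    (ρ : CQState p Q C) :
    writeClassical (f w) (fun c => F (c ∘ f)) (embed e f ρ) = embed e f (writeClassical w F ρ) := by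
  funext c
  ext x y
  have hc (v : ZMod p) : (∀ b, (∀ i, f i ≠ b) → Function.update c (f w) v b = 0) ↔
      ∀ b, (∀ i, f i ≠ b) → c b = 0 := by
    refine forall₂_congr fun q hq => ?_
    rw [Function.update_of_ne (hq w).symm]
  by_cases h : (∀ b, (∀ a, f a ≠ b) → c b = 0) ∧ ∀ q, (∀ i, e i ≠ q) → x q = 0 ∧ y q = 0
  · rw [embed_of_pos _ _ _ h.1 h.2, writeClassical_apply, writeClassical_apply, Matrix.sum_apply,
      Matrix.sum_apply]
    refine Finset.sum_congr rfl fun v _ => ?_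
    simp only [Function.comp_apply, update_embedding_comp]
    split_ifs
    · rw [embed_of_pos _ _ _ ((hc v).2 h.1) h.2, update_embedding_comp]
    · rfl
  · rw [embed_of_neg _ _ _ h, writeClassical_apply, Matrix.sum_apply]
    refine Finset.sum_eq_zero fun v _ => ?_
    split_ifs
    · rw [embed_of_neg _ _ _ fun h' => h ⟨(hc v).1 h'.1, h'.2⟩]
    · rfl

theorem embed_sum {ι : Type} (s : Finset ι) (e : Q ↪ Q') (f : C ↪ C') (ρ : ι → CQState p Q C) :
    embed e f (∑ i ∈ s, ρ i) = ∑ i ∈ s, embed e f (ρ i) := by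
  funext c
  ext x y
  simp only [embed, Finset.sum_apply, Matrix.sum_apply]
  split_ifs <;> simp

theorem Gate.map_apply_embed (e : Q ↪ Q') (f : C ↪ C') (g : Gate p Q C) (ρ : CQState p Q C) :
    (g.map e f).apply (embed e f ρ) = embed e f (g.apply ρ) := by
  cases g with
  | oneQudit q U => exact embed_conjBy e f q (fun _ _ => (U : Matrix (ZMod p) (ZMod p) ℂ)) ρ
  | ctrl a t h U =>
    exact embed_conjBy e f t (fun _ x => (U (x a) : Matrix (ZMod p) (ZMod p) ℂ)) ρ
  | classicalCtrl w q U =>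
    exact embed_conjBy e f q (fun c _ => (U (c w) : Matrix (ZMod p) (ZMod p) ℂ)) ρ
  | measure q w =>
    rw [Gate.map, apply_measure_eq_sum, apply_measure_eq_sum, embed_sum]
    refine Finset.sum_congr rfl fun m _ => ?_
    rw [← embed_writeClassical e f w (fun _ => m), ← embed_conjBy e f q
      (fun _ _ => Matrix.diagonal fun a => if a = m then 1 else 0)]
  | boundedClassical a b w g => exact embed_writeClassical e f w (fun c => g (c a) (c b)) ρ
  | classicalMod S w =>
    rw [Gate.apply, ← embed_writeClassical]
    simp only [Gate.map, Gate.apply, Finset.sum_map, Function.comp_apply]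
  | multiCtrl S v t h U =>
    rw [Gate.apply, ← embed_conjBy e f t
      (fun _ x => if ∀ i ∈ S, x i = v i then (U : Matrix (ZMod p) (ZMod p) ℂ) else 1)]
    simp only [Gate.map, Gate.apply, Finset.forall_mem_map, Function.comp_apply,
      e.injective.extend_apply]
  | qThreshold k S t h =>
    rw [Gate.apply, ← embed_conjBy e f t (fun _ x => shift (threshold k S x))]
    simp only [Gate.map, Gate.apply, threshold, Finset.sum_map, Function.comp_apply]

theorem runGates_map_embed (e : Q ↪ Q') (f : C ↪ C') (L : List (Gate p Q C)) (ρ : CQState p Q C) :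
    runGates (L.map (Gate.map e f)) (embed e f ρ) = embed e f (runGates L ρ) := by
  induction L generalizing ρ with
  | nil => rfl
  | cons g L ih =>
    have h := ih (g.apply ρ)
    rw [← Gate.map_apply_embed] at h
    exact h

namespace Circuit

variable {n m : ℕ}

theorem initial_apply (K : Circuit p n m Q C) (σ : Matrix (Fin n → ZMod p) (Fin n → ZMod p) ℂ)
    (c : C → ZMod p) (x y : Q → ZMod p) :
    K.initial σ c x y = if c = 0 ∧ ∀ q, (∀ i, K.inp i ≠ q) → x q = 0 ∧ y q = 0
      then σ (fun i => x (K.inp i)) (fun i => y (K.inp i)) else 0 := by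
  by_cases hc : c = 0 <;> simp [initial, hc]

theorem initial_embed (K : Circuit p n m Q C) (K' : Circuit p n m Q' C') (e : Q ↪ Q') (f : C ↪ C')
    (h : K'.inp = K.inp.trans e) (σ : Matrix (Fin n → ZMod p) (Fin n → ZMod p) ℂ) :
    K'.initial σ = embed e f (K.initial σ) := by
  funext c
  ext x y
  have hc : c = 0 ↔ (∀ b, (∀ a, f a ≠ b) → c b = 0) ∧ c ∘ f = 0 := by
    constructor
    · rintro rfl
      exact ⟨fun _ _ => rfl, rfl⟩
    · rintro ⟨h1, h2⟩
      funext b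
      by_cases hb : ∃ a, f a = b
      · obtain ⟨a, rfl⟩ := hb
        exact congrFun h2 a
      · exact h1 b fun a ha => hb ⟨a, ha⟩
  have hq : (∀ q, (∀ i, K.inp.trans e i ≠ q) → x q = 0 ∧ y q = 0) ↔
      (∀ q, (∀ i, e i ≠ q) → x q = 0 ∧ y q = 0) ∧
        ∀ q, (∀ i, K.inp i ≠ q) → (x ∘ e) q = 0 ∧ (y ∘ e) q = 0 := by
    constructor
    · intro H
      refine ⟨fun q hq => H q fun i => hq _, fun q hq => H (e q) fun i hi => hq i ?_⟩
      exact e.injective hi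
    · rintro ⟨H1, H2⟩ q hq
      by_cases hb : ∃ a, e a = q
      · obtain ⟨a, rfl⟩ := hb
        exact H2 a fun i hi => hq i (by simp [hi])
      · exact H1 q fun a ha => hb ⟨a, ha⟩
  rw [← h] at hq
  rw [initial_apply]
  by_cases H : (∀ b, (∀ a, f a ≠ b) → c b = 0) ∧ ∀ q, (∀ i, e i ≠ q) → x q = 0 ∧ y q = 0
  · rw [embed_of_pos _ _ _ H.1 H.2, initial_apply]
    have h1 : (c = 0 ∧ ∀ q, (∀ i, K'.inp i ≠ q) → x q = 0 ∧ y q = 0) ↔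
        (c ∘ f = 0 ∧ ∀ q, (∀ i, K.inp i ≠ q) → (x ∘ e) q = 0 ∧ (y ∘ e) q = 0) := by
      rw [hc, hq]
      tauto
    refine if_congr h1 ?_ rfl
    simp only [h]
    rfl
  · rw [embed_of_neg _ _ _ H, if_neg fun h' => H ⟨(hc.1 h'.1).1, (hq.1 h'.2).1⟩]

/-- An embedded state is supported on extensions by zero, so the sums over the larger index sets
reindex to the smaller ones. The traced-out additional qudits are 0 on both sides. -/
theorem reduced_embed (K : Circuit p n m Q C) (K' : Circuit p n m Q' C') (e : Q ↪ Q') (f : C ↪ C')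
    (h : K'.out = K.out.trans e) (ρ : CQState p Q C) : K'.reduced (embed e f ρ) = K.reduced ρ := by
  have he : ∀ x : Q → ZMod p, Function.extend e x 0 ∘ e = x := fun x => Function.extend_comp e.injective x 0
  have hf : ∀ x : C → ZMod p, Function.extend f x 0 ∘ f = x := fun x => Function.extend_comp f.injective x 0
  have inj {α β : Type} (g : α ↪ β) :
      Function.Injective fun x : α → ZMod p => Function.extend g x 0 := by
    intro x y hxy
    have := congrArg (· ∘ g) hxy
    simpa only [Function.extend_comp g.injective] using this
  have surj {α β : Type} (g : α ↪ β) (x : β → ZMod p) (hx : ∀ q, (∀ i, g i ≠ q) → x q = 0) :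
      x ∈ Set.range fun x : α → ZMod p => Function.extend g x 0 := by
    refine ⟨x ∘ g, ?_⟩
    funext q
    by_cases hq : ∃ a, g a = q
    · obtain ⟨a, rfl⟩ := hq
      simp only [g.injective.extend_apply, Function.comp]
    · beta_reduce
      rw [Function.extend_apply' _ _ _ hq, hx q fun a ha => hq ⟨a, ha⟩]
      rfl
  have zero {α β : Type} (g : α ↪ β) (x : α → ZMod p) (q : β) (hq : ∀ i, g i ≠ q) :
      Function.extend g x 0 q = 0 := by
    rw [Function.extend_apply' _ _ _ (by simpa using hq)]
    rfl
  ext u v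
  simp only [reduced]
  symm
  refine Fintype.sum_of_injective _ (inj f) _ _ ?_ fun c => ?_
  · intro c hc
    refine Finset.sum_eq_zero fun x _ => Finset.sum_eq_zero fun y _ => ?_
    split_ifs
    · exact if_neg fun H => hc (surj f c H.1)
    · rfl
  refine Fintype.sum_of_injective _ (inj e) _ _ ?_ fun x => ?_
  · intro x hx
    refine Finset.sum_eq_zero fun y _ => ?_
    split_ifs
    · exact if_neg fun H => hx (surj e x fun q hq => (H.2 q hq).1)
    · rfl
  refine Fintype.sum_of_injective _ (inj e) _ _ ?_ fun y => ?_
  · intro y hy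
    split_ifs
    · exact if_neg fun H => hy (surj e y fun q hq => (H.2 q hq).2)
    · rfl
  have h1 : embed e f ρ (Function.extend f c 0) (Function.extend e x 0) (Function.extend e y 0) =
      ρ c x y := by
    simp only [embed]
    rw [if_pos ⟨zero f c, fun q hq => ⟨zero e x q hq, zero e y q hq⟩⟩, hf, he, he]
  have h2 : (∀ q, (∀ i, K'.out i ≠ q) → Function.extend e x 0 q = Function.extend e y 0 q) ↔
      ∀ q, (∀ i, K.out i ≠ q) → x q = y q := by
    rw [h]
    constructor
    · intro H q hq
      simpa only [e.injective.extend_apply] using H (e q) fun i hi => hq i (e.injective hi)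
    · intro H q hq
      by_cases hb : ∃ a, e a = q
      · obtain ⟨a, rfl⟩ := hb
        simp only [e.injective.extend_apply]
        exact H a fun i hi => hq i (by simp [hi])
      · rw [zero e x q fun a ha => hb ⟨a, ha⟩, zero e y q fun a ha => hb ⟨a, ha⟩]
  simp only [h1, h2]
  simp only [h, Function.Embedding.trans_apply, e.injective.extend_apply]

end Circuit

/-! ### Size of layers -/

/-- A wire that is acted on by the gate. -/
def Gate.label : Gate p Q C → Q ⊕ C
  | .oneQudit q _ => .inl q
  | .ctrl _ t _ _ => .inl t
  | .classicalCtrl _ q _ => .inl q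
  | .measure q _ => .inl q
  | .boundedClassical _ _ w _ => .inr w
  | .classicalMod _ w => .inr w
  | .multiCtrl _ _ t _ _ => .inl t
  | .qThreshold _ _ t _ => .inl t

/-- The gates of a layer have distinct labels. This bounds their number by the number of wires, and
it makes a block of ancillas indexed by the label private to its gate. -/
theorem Gate.Compatible.label_ne {g h : Gate p Q C} (H : g.Compatible h) : g.label ≠ h.label := by
  obtain ⟨h1, h2, -, -⟩ := H
  rw [Finset.disjoint_left] at h1 h2
  intro hl
  cases g <;> cases h <;>
    simp_all [Gate.label, Gate.qwires, Gate.cwrites]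

theorem length_le_of_pairwise_compatible {L : List (Gate p Q C)} (h : L.Pairwise Gate.Compatible) :
    L.length ≤ Fintype.card Q + Fintype.card C := by
  have : (L.map Gate.label).Nodup :=
    List.pairwise_map.2 (h.imp fun h => h.label_ne)
  simpa using this.length_le_card

/-- A circuit from layers that realize a map. -/
theorem Realizes.exists_circuit {G : Gate p Q C → Prop} {Z : Zone Q C} {d : ℕ}
    {T : CQState p Q C → CQState p Q C} (hT : Realizes G Z d T) {n m : ℕ} (inp : Fin n ↪ Q)
    (out : Fin m ↪ Q) : ∃ K : Circuit p n m Q C, K.inp = inp ∧ K.out = out ∧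
      (∀ L ∈ K.layers, ∀ g ∈ L, G g) ∧ K.depth ≤ d ∧
      K.size ≤ (Fintype.card Q + Fintype.card C) * (d + 1) ∧
      ∀ ρ, Clean Z.anc Z.canc ρ → K.run ρ = T ρ := by
  obtain ⟨Ls, h1, h2, h3⟩ := hT
  refine ⟨⟨inp, out, Ls, fun L hL => (h2 L hL).1⟩, rfl, rfl,
    fun L hL g hg => ((h2 L hL).2 g hg).1, h1, ?_, fun ρ hρ => (h3 ρ hρ).1⟩
  have : (Ls.map List.length).sum ≤ Ls.length * (Fintype.card Q + Fintype.card C) := by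
    have := List.sum_le_card_nsmul (Ls.map List.length) (Fintype.card Q + Fintype.card C) (by
      intro k hk
      obtain ⟨L, hL, rfl⟩ := List.mem_map.1 hk
      exact length_le_of_pairwise_compatible (h2 L hL).1)
    simpa using this
  simp only [Circuit.size]
  nlinarith

/-! ### Replacing gates -/

/-- The zone of a gate that is replaced by gates with additional ancillas `X` and `Y`. -/
def Gate.zone (X Y : Type) (g : Gate p Q C) :
    Zone (Q ⊕ (Q ⊕ C) × X) (C ⊕ (Q ⊕ C) × Y) where
  ext := Sum.inl '' g.qwires
  reads := Sum.inl '' g.creads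
  writes := Sum.inl '' g.cwrites
  anc := Set.range fun x => Sum.inr (g.label, x)
  canc := Set.range fun y => Sum.inr (g.label, y)

theorem Gate.Compatible.zone_indep {X Y : Type} {g h : Gate p Q C} (H : g.Compatible h) :
    (g.zone X Y).Indep (h.zone X Y) := by
  have hl := H.label_ne
  obtain ⟨h1, h2, h3, h4⟩ := H
  rw [Finset.disjoint_left] at h1 h2 h3 h4
  constructor
  all_goals
    rw [Set.disjoint_left]
    simp only [Zone.qudits, Zone.ins, Zone.outs, Gate.zone]
    rintro (a | ⟨l, a⟩) <;> simp <;> grind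

/-- Each wire owns a block of `X` qudits and `Y` classical wires, used by the gate with that label.
The blocks come back clean and serve all layers of `K`, hence the factor 1 + |X| + |Y| for the wires
and `d` for the depth. -/
theorem exists_circuit_of_realizes_gates {n m d : ℕ} {X Y : Type} [Fintype X] [DecidableEq X]
    [Fintype Y] [DecidableEq Y] (K : Circuit p n m Q C)
    {G : Gate p (Q ⊕ (Q ⊕ C) × X) (C ⊕ (Q ⊕ C) × Y) → Prop}
    (h : ∀ L ∈ K.layers, ∀ g ∈ L, Realizes G (g.zone X Y) d
      (g.map Function.Embedding.inl Function.Embedding.inl).apply) :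
    ∃ K' : Circuit p n m (Q ⊕ (Q ⊕ C) × X) (C ⊕ (Q ⊕ C) × Y),
      (∀ L ∈ K'.layers, ∀ g ∈ L, G g) ∧ K'.depth ≤ d * K.depth ∧
      K'.size ≤ (Fintype.card Q + Fintype.card C) * (1 + Fintype.card X + Fintype.card Y) *
        (d * K.depth + 1) ∧ ∀ σ, K'.channel σ = K.channel σ := by
  set e : Q ↪ Q ⊕ (Q ⊕ C) × X := Function.Embedding.inl
  set f : C ↪ C ⊕ (Q ⊕ C) × Y := Function.Embedding.inl
  let Z : Zone (Q ⊕ (Q ⊕ C) × X) (C ⊕ (Q ⊕ C) × Y) :=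
    ⟨Set.range e, ∅, Set.range f, (Set.range e)ᶜ, (Set.range f)ᶜ⟩
  have hsub (g : Gate p Q C) : (g.zone X Y).Sub Z := by
    constructor
    all_goals
      simp only [Zone.qudits, Zone.ins, Zone.outs, Gate.zone, Z]
      first
      | simp
      | rw [Set.disjoint_left]; rintro (a | a) <;> simp [e, f]
      | rintro (a | a) <;> simp [e, f]
  -- A single layer: the zone of the gates treated so far remains independent of the zone of any
  -- gate compatible with all of them.
  have hL : ∀ L : List (Gate p Q C), L.Pairwise Gate.Compatible → (∀ g ∈ L,
      Realizes G (g.zone X Y) d (g.map e f).apply) →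
      ∃ ZL : Zone (Q ⊕ (Q ⊕ C) × X) (C ⊕ (Q ⊕ C) × Y), ZL.Sub Z ∧
        (∀ g : Gate p Q C, (∀ g' ∈ L, g.Compatible g') → (g.zone X Y).Indep ZL) ∧
        Realizes G ZL d (runGates (L.map (Gate.map e f))) := by
    intro L hL hr
    induction L with
    | nil =>
      refine ⟨⟨∅, ∅, ∅, ∅, ∅⟩, ?_, ?_, Realizes.id⟩
      · constructor <;> simp [Zone.qudits, Zone.ins, Zone.outs]
      · intro g _
        constructor <;> simp [Zone.qudits, Zone.ins, Zone.outs]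
    | cons g L ih =>
      rw [List.pairwise_cons] at hL
      obtain ⟨ZL, h1, h2, h3⟩ := ih hL.2 fun g' hg' => hr g' (by simp [hg'])
      refine ⟨(g.zone X Y).union ZL, (hsub g).union h1, fun g' hg' => ?_, ?_⟩
      · exact (Zone.Indep.union_left (hg' g (by simp)).zone_indep.symm
          (h2 g' fun g'' h'' => hg' g'' (by simp [h''])).symm).symm
      · exact (hr g (by simp)).par h3 (h2 g hL.1)
  have hZ : Realizes G Z (d * K.depth) (runLayers (K.layers.map (List.map (Gate.map e f)))) := by
    rw [Circuit.depth]
    have hp := K.parallel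
    revert hp h
    generalize K.layers = Ls
    intro h hp
    induction Ls with
    | nil => exact Realizes.id
    | cons L Ls ih =>
      obtain ⟨ZL, h1, -, h3⟩ := hL L (hp L (by simp)) (h L (by simp))
      have := (ih (fun L hL => h L (by simp [hL])) fun L hL => hp L (by simp [hL])).comp
        (h3.mono h1 le_rfl)
      rw [List.length_cons, mul_add, mul_one, add_comm]
      exact this.congr fun ρ _ => by simp [runLayers_cons]
  obtain ⟨K', h1, h2, h3, h4, h5, h6⟩ := hZ.exists_circuit (K.inp.trans e) (K.out.trans e)
  refine ⟨K', h3, h4, h5.trans (le_of_eq ?_), fun σ => ?_⟩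
  · simp only [Fintype.card_sum, Fintype.card_prod]
    ring
  · rw [Circuit.channel, Circuit.initial_embed K K' e f h1, h6 _ (clean_embed e f _)]
    have : runLayers (K.layers.map (List.map (Gate.map e f))) (embed e f (K.initial σ)) =
        embed e f (K.run (K.initial σ)) := by
      rw [runLayers, ← List.map_flatten, runGates_map_embed]
      rfl
    rw [this, Circuit.reduced_embed K K' e f h2]
    rfl

end

section

variable {p : ℕ} [NeZero p] {Q C : Type} [Fintype Q] [DecidableEq Q] [Fintype C] [DecidableEq C]

/-! ### Families of one-qudit operators -/

section FamOp

variable {ι : Type*} [DecidableEq ι]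

/-- One-qudit operators `M k x` on the qudits `r k`, for `k ∈ s`. -/
def famOp (s : Finset ι) (r : ι → Q) (M : ι → (Q → ZMod p) → Matrix (ZMod p) (ZMod p) ℂ) :
    Matrix (Q → ZMod p) (Q → ZMod p) ℂ :=
  fun y x => if ∀ j, (∀ k ∈ s, r k ≠ j) → y j = x j
    then ∏ k ∈ s, M k x (y (r k)) (x (r k)) else 0

theorem famOp_empty (r : ι → Q) (M : ι → (Q → ZMod p) → Matrix (ZMod p) (ZMod p) ℂ) :
    famOp ∅ r M = 1 := by
  ext y x
  simp only [famOp, Matrix.one_apply, funext_iff]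
  simp

theorem localOp_mul_famOp {s : Finset ι} {k : ι} (hk : k ∉ s) {r : ι → Q}
    (hr : Function.Injective r) {M : ι → (Q → ZMod p) → Matrix (ZMod p) (ZMod p) ℂ}
    (hM : ∀ x x', (∀ j, (∀ k, r k ≠ j) → x j = x' j) → M k x = M k x') :
    localOp (r k) (M k) * famOp s r M = famOp (insert k s) r M := by
  have hne : ∀ k' ∈ s, r k' ≠ r k := fun k' hk' h => hk (hr h ▸ hk')
  ext y x
  rw [localOp_mul_apply, Finset.sum_eq_single (x (r k))]
  · have hc : (∀ j, (∀ k' ∈ s, r k' ≠ j) → Function.update y (r k) (x (r k)) j = x j) ↔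
        ∀ j, (∀ k' ∈ insert k s, r k' ≠ j) → y j = x j := by
      refine forall_congr' fun j => ?_
      by_cases hj : r k = j
      · subst hj; simp
      · rw [Function.update_of_ne (Ne.symm hj)]
        simp [hj]
    simp only [famOp, hc]
    split_ifs with h
    · rw [Finset.prod_insert hk, hM _ x]
      · congr 1
        exact Finset.prod_congr rfl fun k' hk' => by rw [Function.update_of_ne (hne k' hk')]
      · intro j hj
        rw [Function.update_of_ne (hj k).symm]
        exact h j fun k' _ => hj k'
    · simp
  · intro b _ hb
    simp only [famOp]
    rw [if_neg, mul_zero]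
    intro H
    exact hb (by simpa using H (r k) hne)
  · simp

/-- The intermediate states are `x` with arbitrary values on the qudits `r k`. Summing a product
over all these values gives the product of the one-qudit matrix entries, and the `M k` do not see
the values. -/
theorem famOp_mul_famOp [Fintype ι] {r : ι → Q} (hr : Function.Injective r)
    {M N : ι → (Q → ZMod p) → Matrix (ZMod p) (ZMod p) ℂ}
    (hM : ∀ k x x', (∀ j, (∀ k, r k ≠ j) → x j = x' j) → M k x = M k x') :
    famOp Finset.univ r M * famOp Finset.univ r N =
      famOp Finset.univ r fun k x => M k x * N k x := by
  ext y x
  have hinj : Function.Injective fun v : ι → ZMod p => Function.extend r v x := by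
    intro v w h
    have := congrArg (· ∘ r) h
    simpa only [Function.extend_comp hr] using this
  have hoff : ∀ (v : ι → ZMod p) j, (∀ k, r k ≠ j) → Function.extend r v x j = x j :=
    fun v j hj => Function.extend_apply' _ _ _ (by simpa using hj)
  rw [Matrix.mul_apply]
  transitivity ∑ v : ι → ZMod p, famOp Finset.univ r M y (Function.extend r v x) *
    famOp Finset.univ r N (Function.extend r v x) x
  · symm
    refine Fintype.sum_of_injective _ hinj _ _ ?_ fun _ => rfl
    intro z hz
    rw [mul_eq_zero]
    right
    simp only [famOp]
    rw [if_neg]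
    intro H
    refine hz ⟨z ∘ r, ?_⟩
    funext j
    by_cases hj : ∃ k, r k = j
    · obtain ⟨k, rfl⟩ := hj
      simp [hr.extend_apply]
    · beta_reduce
      rw [Function.extend_apply' _ _ _ hj, H j fun k _ h => hj ⟨k, h⟩]
  · simp only [famOp, Finset.mem_univ, true_imp_iff]
    have hc : ∀ v : ι → ZMod p, (∀ j, (∀ k, r k ≠ j) → y j = Function.extend r v x j) ↔
        ∀ j, (∀ k, r k ≠ j) → y j = x j :=
      fun v => forall₂_congr fun j hj => by rw [hoff v j hj]
    simp only [hc]
    split_ifs with h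
    · simp only [Matrix.mul_apply]
      rw [Finset.prod_univ_sum, Fintype.piFinset_univ]
      refine Finset.sum_congr rfl fun v _ => ?_
      rw [if_pos (hoff v), ← Finset.prod_mul_distrib]
      refine Finset.prod_congr rfl fun k _ => ?_
      rw [hM k _ x (hoff v), hr.extend_apply]
    · simp

theorem famOp_diagonal [Fintype ι] {r : ι → Q} (g : ι → (Q → ZMod p) → ZMod p → ℂ) :
    famOp Finset.univ r (fun k x => Matrix.diagonal (g k x)) =
      Matrix.diagonal fun x => ∏ k, g k x (x (r k)) := by
  ext y x
  simp only [famOp, Finset.mem_univ, true_imp_iff, Matrix.diagonal_apply]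
  by_cases h : y = x
  · subst h; simp
  · rw [if_neg h]
    split_ifs with hc
    · obtain ⟨j, hj⟩ := Function.ne_iff.1 h
      have : ∃ k, r k = j := by
        by_contra H
        exact hj (hc j fun k hk => H ⟨k, hk⟩)
      obtain ⟨k, rfl⟩ := this
      exact Finset.prod_eq_zero (Finset.mem_univ k) (if_neg hj)
    · rfl

theorem famOp_one [Fintype ι] {r : ι → Q} :
    famOp Finset.univ r (fun (_ : ι) (_ : Q → ZMod p) => 1) = 1 := by
  have := famOp_diagonal (r := r) fun (_ : ι) (_ : Q → ZMod p) _ => (1 : ℂ)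
  simpa using this

theorem famOp_univ_apply [Fintype ι] (r : ι → Q)
    (M : ι → (Q → ZMod p) → Matrix (ZMod p) (ZMod p) ℂ) (y x : Q → ZMod p) :
    famOp Finset.univ r M y x = if ∀ j, (∀ k, r k ≠ j) → y j = x j
      then ∏ k, M k x (y (r k)) (x (r k)) else 0 := by
  simp [famOp]

theorem localOp_eq_famOp (t : Q) (U : (Q → ZMod p) → Matrix (ZMod p) (ZMod p) ℂ) :
    localOp t U = famOp Finset.univ (fun _ : Unit => t) fun _ => U := by
  ext y x
  rw [famOp_univ_apply]
  simp [localOp, eq_comm]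

end FamOp

theorem localOp_mul_localOp (t : Q) {U V : (Q → ZMod p) → Matrix (ZMod p) (ZMod p) ℂ}
    (hU : ∀ x a, U (Function.update x t a) = U x) :
    localOp t U * localOp t V = localOp t fun x => U x * V x := by
  rw [localOp_eq_famOp, localOp_eq_famOp, famOp_mul_famOp (Function.injective_of_subsingleton _),
    ← localOp_eq_famOp]
  intro _ x x' h
  rw [← hU x (x' t)]
  congr 1
  funext j
  by_cases hj : j = t
  · subst hj; simp
  · simpa [hj] using h j fun _ => Ne.symm hj

theorem localOp_diagonal (t : Q) (g : (Q → ZMod p) → ZMod p → ℂ) :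
    localOp t (fun x => Matrix.diagonal (g x)) = Matrix.diagonal fun x => g x (x t) := by
  rw [localOp_eq_famOp, famOp_diagonal]
  simp

/-! ### Additions in the computational basis -/

/-- The operator `|x⟩ ↦ |x + f x⟩`. -/
def addOp (f : (Q → ZMod p) → (Q → ZMod p)) : Matrix (Q → ZMod p) (Q → ZMod p) ℂ :=
  fun y x => if y = x + f x then 1 else 0

/-- The increment `f x` does not change if increments are added to `x`. -/
def Steady (f : (Q → ZMod p) → (Q → ZMod p)) : Prop := ∀ x z, f (x + f z) = f x

theorem Steady.sub {f : (Q → ZMod p) → (Q → ZMod p)} (hf : Steady f) (x z : Q → ZMod p) :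
    f (x - f z) = f x := by
  rw [← hf (x - f z) z, sub_add_cancel]

theorem Steady.eq_add_iff {f : (Q → ZMod p) → (Q → ZMod p)} (hf : Steady f) {x y : Q → ZMod p} :
    y = x + f x ↔ x = y - f y := by
  constructor
  · rintro rfl; rw [hf, add_sub_cancel_right]
  · rintro rfl; rw [hf.sub, sub_add_cancel]

theorem Steady.of_support {f : (Q → ZMod p) → (Q → ZMod p)} (T : Set Q)
    (h₁ : ∀ x, ∀ q ∉ T, f x q = 0) (h₂ : ∀ x x', (∀ q ∉ T, x q = x' q) → f x = f x') :
    Steady f := fun x z => h₂ _ _ fun q hq => by simp [h₁ z q hq]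

theorem addOp_zero : addOp (fun _ : Q → ZMod p => 0) = 1 := by
  ext y x
  simp [addOp, Matrix.one_apply]

theorem mul_addOp_apply {α : Type*} (M : Matrix α (Q → ZMod p) ℂ)
    (f : (Q → ZMod p) → (Q → ZMod p)) (y : α) (x : Q → ZMod p) :
    (M * addOp f) y x = M y (x + f x) := by
  simp [Matrix.mul_apply, addOp]

theorem addOp_mul_apply {α : Type*} {f : (Q → ZMod p) → (Q → ZMod p)} (hf : Steady f)
    (M : Matrix (Q → ZMod p) α ℂ) (y : Q → ZMod p) (x : α) :
    (addOp f * M) y x = M (y - f y) x := by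
  simp [Matrix.mul_apply, addOp, hf.eq_add_iff]

theorem addOp_mul_addOp (f g : (Q → ZMod p) → (Q → ZMod p)) :
    addOp f * addOp g = addOp fun x => g x + f (x + g x) := by
  ext y x
  rw [mul_addOp_apply]
  simp [addOp, add_assoc]

theorem localOp_shift (t : Q) (a : (Q → ZMod p) → ZMod p) :
    localOp t (fun x => shift (a x)) = addOp fun x => Pi.single t (a x) := by
  ext y x
  simp only [localOp, addOp, shift]
  rw [← ite_and]
  refine if_congr ?_ rfl rfl
  rw [funext_iff]
  constructor
  · rintro ⟨h1, h2⟩ j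
    by_cases hj : j = t
    · subst hj; simp [h2]
    · simp [hj, h1 j hj]
  · intro h
    exact ⟨fun i hi => by simp [h i, hi], by simp [h t]⟩

theorem sum_single_apply {ι : Type*} [Fintype ι] [DecidableEq ι] {r : ι → Q}
    (hr : Function.Injective r) (a : ι → ZMod p) (k : ι) :
    (∑ k', Pi.single (r k') (a k') : Q → ZMod p) (r k) = a k := by
  rw [Finset.sum_apply, Finset.sum_eq_single k]
  · simp
  · intro k' _ hk'
    exact Pi.single_eq_of_ne (fun h => hk' (hr h).symm) _
  · simp

theorem sum_single_apply_of_ne {ι : Type*} [Fintype ι] {r : ι → Q} (a : ι → ZMod p) {j : Q}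
    (hj : ∀ k, r k ≠ j) : (∑ k', Pi.single (r k') (a k') : Q → ZMod p) j = 0 := by
  rw [Finset.sum_apply]
  exact Finset.sum_eq_zero fun k _ => Pi.single_eq_of_ne (hj k).symm _

theorem famOp_shift {ι : Type*} [Fintype ι] [DecidableEq ι] {r : ι → Q}
    (hr : Function.Injective r) (a : ι → (Q → ZMod p) → ZMod p) :
    famOp Finset.univ r (fun k x => shift (a k x)) =
      addOp fun x => ∑ k, Pi.single (r k) (a k x) := by
  ext y x
  rw [famOp_univ_apply]
  simp only [addOp, shift]
  have hiff : y = x + ∑ k, Pi.single (r k) (a k x) ↔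
      (∀ j, (∀ k, r k ≠ j) → y j = x j) ∧ ∀ k, y (r k) = x (r k) + a k x := by
    constructor
    · rintro rfl
      exact ⟨fun j hj => by rw [Pi.add_apply, sum_single_apply_of_ne _ hj, add_zero],
        fun k => by rw [Pi.add_apply, sum_single_apply hr]⟩
    · rintro ⟨h1, h2⟩
      funext j
      by_cases hj : ∃ k, r k = j
      · obtain ⟨k, rfl⟩ := hj
        rw [Pi.add_apply, sum_single_apply hr, h2 k]
      · have hj' : ∀ k, r k ≠ j := fun k hk => hj ⟨k, hk⟩
        rw [h1 j hj', Pi.add_apply, sum_single_apply_of_ne _ hj', add_zero]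
  rw [Finset.prod_ite_zero]
  simp only [Finset.mem_univ, true_imp_iff, hiff, Finset.prod_const_one]
  split_ifs <;> first | rfl | (exfalso; tauto)

/-! ### Conjugation of clean states -/

theorem conjBy_apply (K : (C → ZMod p) → Matrix (Q → ZMod p) (Q → ZMod p) ℂ) (ρ : CQState p Q C)
    (c : C → ZMod p) (x y : Q → ZMod p) :
    conjBy K ρ c x y = ∑ y', (∑ x', K c x x' * ρ c x' y') * star (K c y y') := by
  simp only [conjBy, Matrix.mul_apply, Matrix.conjTranspose_apply]

theorem conjBy_apply_of_unique {K : (C → ZMod p) → Matrix (Q → ZMod p) (Q → ZMod p) ℂ}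
    {ρ : CQState p Q C} {c : C → ZMod p} {x y x₀ y₀ : Q → ZMod p}
    (hx : ∀ x' y', ρ c x' y' ≠ 0 → K c x x' ≠ 0 → x' = x₀)
    (hy : ∀ x' y', ρ c x' y' ≠ 0 → K c y y' ≠ 0 → y' = y₀) :
    conjBy K ρ c x y = K c x x₀ * ρ c x₀ y₀ * star (K c y y₀) := by
  rw [conjBy_apply, Finset.sum_eq_single y₀, Finset.sum_eq_single x₀]
  · intro x' _ hne
    by_contra h
    exact hne (hx x' y₀ (right_ne_zero_of_mul h) (left_ne_zero_of_mul h))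
  · simp
  · intro y' _ hne
    by_contra h
    obtain ⟨x', -, h'⟩ := Finset.exists_ne_zero_of_sum_ne_zero (left_ne_zero_of_mul h)
    exact hne (hy x' y' (right_ne_zero_of_mul h')
      (star_ne_zero.1 (right_ne_zero_of_mul h)))
  · simp

/-- Only columns of clean basis states meet the support of `ρ`. Operator identities with ancillas
are therefore checked on inputs whose ancillas are 0. -/
theorem conjBy_congr_of_clean {A : Set Q} {B : Set C}
    {K L : (C → ZMod p) → Matrix (Q → ZMod p) (Q → ZMod p) ℂ} {ρ : CQState p Q C}
    (hρ : Clean A B ρ) (h : ∀ c x y, (∀ b ∈ B, c b = 0) → (∀ q ∈ A, x q = 0) →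
      K c y x = L c y x) : conjBy K ρ = conjBy L ρ := by
  funext c
  ext x y
  rw [conjBy_apply, conjBy_apply]
  have key : ∀ x' y', (K c x x' * ρ c x' y') * star (K c y y') =
      (L c x x' * ρ c x' y') * star (L c y y') := by
    intro x' y'
    by_cases h0 : ρ c x' y' = 0
    · simp [h0]
    · obtain ⟨h1, h2⟩ := hρ c x' y' h0
      rw [h c x' x h1 fun q hq => (h2 q hq).1, h c y' y h1 fun q hq => (h2 q hq).2]
  simp only [Finset.sum_mul]
  exact Finset.sum_congr rfl fun y' _ => Finset.sum_congr rfl fun x' _ => key x' y'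

theorem conjBy_one (ρ : CQState p Q C) : conjBy (fun _ => 1) ρ = ρ := by
  funext c; simp [conjBy]

theorem conjBy_addOp_apply {f : (C → ZMod p) → (Q → ZMod p) → (Q → ZMod p)}
    (hf : ∀ c, Steady (f c)) (ρ : CQState p Q C) (c : C → ZMod p) (x y : Q → ZMod p) :
    conjBy (fun c => addOp (f c)) ρ c x y = ρ c (x - f c x) (y - f c y) := by
  rw [conjBy_apply_of_unique (x₀ := x - f c x) (y₀ := y - f c y)]
  · simp [addOp, (hf c).sub]
  · intro x' y' _ h
    simpa [addOp, (hf c).eq_add_iff] using h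
  · intro x' y' _ h
    simpa [addOp, (hf c).eq_add_iff] using h

theorem conjBy_diagonal_apply (g : (C → ZMod p) → (Q → ZMod p) → ℂ) (ρ : CQState p Q C)
    (c : C → ZMod p) (x y : Q → ZMod p) :
    conjBy (fun c => Matrix.diagonal (g c)) ρ c x y = g c x * ρ c x y * star (g c y) := by
  simp [conjBy, Matrix.diagonal_conjTranspose, Matrix.mul_diagonal, Matrix.diagonal_mul]

/-- An operator that maps clean basis states to combinations of clean basis states. -/
theorem Clean.conjBy {A : Set Q} {B : Set C}
    {K : (C → ZMod p) → Matrix (Q → ZMod p) (Q → ZMod p) ℂ} {ρ : CQState p Q C}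
    (hρ : Clean A B ρ) (h : ∀ c x y, (∀ q ∈ A, x q = 0) → K c y x ≠ 0 → ∀ q ∈ A, y q = 0) :
    Clean A B (conjBy K ρ) := by
  intro c x y hne
  rw [conjBy_apply] at hne
  obtain ⟨y', -, hne⟩ := Finset.exists_ne_zero_of_sum_ne_zero hne
  obtain ⟨x', -, hne'⟩ := Finset.exists_ne_zero_of_sum_ne_zero (left_ne_zero_of_mul hne)
  obtain ⟨h1, h2⟩ := hρ c x' y' (right_ne_zero_of_mul hne')
  exact ⟨h1, fun q hq => ⟨h c x' x (fun q hq => (h2 q hq).1) (left_ne_zero_of_mul hne') q hq,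
    h c y' y (fun q hq => (h2 q hq).2) (star_ne_zero.1 (right_ne_zero_of_mul hne)) q hq⟩⟩

/-! ### The Fourier transform on one qudit -/

/-- The discrete Fourier transform on one qudit. -/
def fourier : Matrix (ZMod p) (ZMod p) ℂ :=
  fun y x => ((Real.sqrt p)⁻¹ : ℝ) * ZMod.stdAddChar (y * x)

theorem star_stdAddChar (a : ZMod p) : star (ZMod.stdAddChar a : ℂ) = ZMod.stdAddChar (-a) := by
  rw [AddChar.map_neg_eq_conj]
  rfl

theorem sum_stdAddChar_mul (a : ZMod p) :
    ∑ z : ZMod p, (ZMod.stdAddChar (z * a) : ℂ) = if a = 0 then (p : ℂ) else 0 := by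
  rw [AddChar.sum_mulShift a (ZMod.isPrimitive_stdAddChar p), ZMod.card]
  split_ifs <;> simp

theorem sqrt_inv_mul_sqrt_inv : (((Real.sqrt p)⁻¹ : ℝ) : ℂ) * (((Real.sqrt p)⁻¹ : ℝ) : ℂ) =
    (p : ℂ)⁻¹ := by
  rw [← Complex.ofReal_mul, ← mul_inv, Real.mul_self_sqrt (Nat.cast_nonneg p)]
  simp

/-- Orthogonality of characters: the phase `a ↦ ω^(b a)` between Fourier gates is the shift by `b`.
Every addition made out of diagonal gates rests on this. -/
theorem fourier_conj_diagonal (b : ZMod p) :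
    (fourier (p := p)).conjTranspose * Matrix.diagonal (fun a => (ZMod.stdAddChar (b * a) : ℂ)) * fourier =
      shift b := by
  ext y x
  rw [Matrix.mul_apply]
  have : ∀ z, ((fourier (p := p)).conjTranspose * Matrix.diagonal
      (fun a => (ZMod.stdAddChar (b * a) : ℂ)) : Matrix (ZMod p) (ZMod p) ℂ) y z * fourier z x =
      (p : ℂ)⁻¹ * ZMod.stdAddChar (z * (b + x - y)) := by
    intro z
    rw [Matrix.mul_diagonal, Matrix.conjTranspose_apply, fourier, fourier, star_mul',
      star_stdAddChar, ← sqrt_inv_mul_sqrt_inv,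
      show z * (b + x - y) = -(z * y) + b * z + z * x by ring, AddChar.map_add_eq_mul,
      AddChar.map_add_eq_mul]
    simp only [Complex.star_def, Complex.conj_ofReal]
    ring
  simp only [this, ← Finset.mul_sum, sum_stdAddChar_mul, shift]
  have hp : (p : ℂ) ≠ 0 := NeZero.ne _
  have : b + x - y = 0 ↔ y = x + b := by rw [sub_eq_zero, eq_comm, add_comm]
  simp only [this]
  split_ifs <;> simp [hp]

theorem shift_zero : shift (0 : ZMod p) = 1 := by
  ext y x
  simp [shift, Matrix.one_apply]

theorem fourier_conjTranspose_mul_self : (fourier (p := p)).conjTranspose * fourier = 1 := by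
  have := fourier_conj_diagonal (0 : ZMod p)
  simpa [shift_zero] using this

/-- The Fourier transform as a unitary matrix. -/
def fourierU : Matrix.unitaryGroup (ZMod p) ℂ :=
  ⟨fourier, Matrix.mem_unitaryGroup_iff'.2 fourier_conjTranspose_mul_self⟩

theorem shift_mul_shift (a b : ZMod p) : shift a * shift b = shift (a + b) := by
  ext y x
  simp [shift, Matrix.mul_apply, add_assoc, add_comm a b]

theorem conjTranspose_shift (a : ZMod p) : (shift a).conjTranspose = shift (-a) := by
  ext y x
  simp only [shift, Matrix.conjTranspose_apply, ← sub_eq_add_neg, eq_sub_iff_add_eq,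
    @eq_comm _ x]
  split_ifs <;> simp

/-- The shift as a unitary matrix. -/
def shiftU (a : ZMod p) : Matrix.unitaryGroup (ZMod p) ℂ :=
  ⟨shift a, Matrix.mem_unitaryGroup_iff'.2 (by
    rw [Matrix.star_eq_conjTranspose, conjTranspose_shift, shift_mul_shift, neg_add_cancel,
      shift_zero])⟩

/-- A diagonal unitary matrix. -/
def diagU (g : ZMod p → Circle) : Matrix.unitaryGroup (ZMod p) ℂ :=
  ⟨Matrix.diagonal fun a => (g a : ℂ), Matrix.mem_unitaryGroup_iff'.2 (by
    rw [Matrix.star_eq_conjTranspose, Matrix.diagonal_conjTranspose, Matrix.diagonal_mul_diagonal,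
      ← Matrix.diagonal_one]
    congr 1
    funext a
    simp [← Complex.normSq_eq_conj_mul_self])⟩

/-! ### Layers of gates -/

/-- The zone consisting of the wires of a gate. -/
def Gate.ownZone (g : Gate p Q C) : Zone Q C := ⟨g.qwires, g.creads, g.cwrites, ∅, ∅⟩

theorem Gate.Compatible.ownZone_indep {g h : Gate p Q C} (H : g.Compatible h) :
    g.ownZone.Indep h.ownZone := by
  simp only [Gate.Compatible, ← Finset.disjoint_coe] at H
  obtain ⟨h1, h2, h3, h4⟩ := H
  constructor <;> simp only [Zone.qudits, Zone.ins, Zone.outs, Gate.ownZone, Set.union_empty,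
    Set.disjoint_union_left, Set.disjoint_union_right] <;> tauto

theorem Realizes.ownZone {G : Gate p Q C → Prop} {g : Gate p Q C} (hg : G g) :
    Realizes G g.ownZone 1 g.apply := by
  refine Realizes.gate g hg ⟨?_, ?_, ?_⟩ (by simp [Gate.ownZone]) (by simp [Gate.ownZone]) <;>
    simp [Gate.ownZone, Zone.qudits, Zone.ins, Zone.outs]

/-- A layer of gates. -/
theorem Realizes.layer {ι : Type*} [Fintype ι] [DecidableEq ι] {G : Gate p Q C → Prop}
    {Z : Zone Q C} (g : ι → Gate p Q C) (hG : ∀ k, G (g k)) (hZ : ∀ k, (g k).InZone Z)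
    (hA : ∀ k, Disjoint Z.anc (g k).qwires) (hB : ∀ k, Disjoint Z.canc (g k).cwrites)
    (hc : ∀ k l, k ≠ l → (g k).Compatible (g l))
    (Tf : Finset ι → CQState p Q C → CQState p Q C) (h0 : ∀ ρ, Tf ∅ ρ = ρ)
    (hstep : ∀ k t, k ∉ t → ∀ ρ, (g k).apply (Tf t ρ) = Tf (insert k t) ρ) :
    Realizes G Z 1 (Tf Finset.univ) := by
  refine Realizes.family Finset.univ (fun k => (g k).ownZone) Z (fun k => (g k).apply) Tf
    (fun k _ => Realizes.ownZone (hG k)) (fun k _ => ?_)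
    (fun k _ l _ hkl => (hc k l hkl).ownZone_indep) h0 fun k _ t _ hk ρ _ => hstep k t hk ρ
  have := hZ k
  constructor
  · simpa [Gate.ownZone, Zone.qudits] using this.qwires
  · simp only [Gate.ownZone, Zone.ins, Zone.outs, Set.union_empty]
    exact Set.union_subset this.creads (this.cwrites.trans Z.outs_subset_ins)
  · simpa [Gate.ownZone, Zone.outs] using this.cwrites
  · simp [Gate.ownZone]
  · simp [Gate.ownZone]
  · exact hA k
  · exact hB k

/-- A layer of gates that act by one-qudit operators. -/
theorem Realizes.localLayer {ι : Type*} [Fintype ι] [DecidableEq ι] {G : Gate p Q C → Prop}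
    {Z : Zone Q C} (g : ι → Gate p Q C) (r : ι → Q)
    (M : ι → (C → ZMod p) → (Q → ZMod p) → Matrix (ZMod p) (ZMod p) ℂ)
    (hg : ∀ k ρ, (g k).apply ρ = conjBy (fun c => localOp (r k) (M k c)) ρ)
    (hM : ∀ k c x x', (∀ j, (∀ k, r k ≠ j) → x j = x' j) → M k c x = M k c x')
    (hr : Function.Injective r)
    (hG : ∀ k, G (g k)) (hZ : ∀ k, (g k).InZone Z)
    (hA : ∀ k, Disjoint Z.anc (g k).qwires) (hB : ∀ k, Disjoint Z.canc (g k).cwrites)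
    (hc : ∀ k l, k ≠ l → (g k).Compatible (g l)) :
    Realizes G Z 1 (conjBy fun c => famOp Finset.univ r fun k => M k c) := by
  refine Realizes.layer g hG hZ hA hB hc
    (fun s => QuditCircuit.conjBy fun c => QuditCircuit.famOp s r fun k => M k c) ?_ ?_
  · intro ρ
    simp only [famOp_empty, conjBy_one]
  · intro k t hk ρ
    rw [hg, conjBy_comp]
    congr 1
    funext c
    exact localOp_mul_famOp (M := fun k => M k c) hk hr (hM k c)

end

section

variable {p : ℕ} [NeZero p] {Q C : Type} [Fintype Q] [DecidableEq Q] [Fintype C] [DecidableEq C]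

/-! ### Classical operations -/

theorem pushClassical_congr_of_clean {A : Set Q} {B : Set C} {F F' : (C → ZMod p) → (C → ZMod p)}
    {ρ : CQState p Q C} (hρ : Clean A B ρ) (h : ∀ c, (∀ b ∈ B, c b = 0) → F c = F' c) :
    pushClassical F ρ = pushClassical F' ρ := by
  funext c'
  ext x y
  simp only [pushClassical, Matrix.sum_apply]
  refine Finset.sum_congr rfl fun c _ => ?_
  by_cases h0 : ρ c x y = 0
  · split_ifs <;> simp [h0]
  · rw [h c (hρ c x y h0).1]

theorem update_eq_add_single (c : C → ZMod p) (w : C) (v : ZMod p) :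
    Function.update c w v = c + Pi.single w (v - c w) := by
  funext j
  by_cases hj : j = w
  · subst hj; simp
  · simp [hj]

theorem add_sum_single_eq_extend {ι : Type*} [Fintype ι] [DecidableEq ι] {w : ι → C}
    (hw : Function.Injective w) (c : C → ZMod p) (v : ι → ZMod p) :
    c + ∑ k, Pi.single (w k) (v k - c (w k)) = Function.extend w v c := by
  funext j
  by_cases hj : ∃ k, w k = j
  · obtain ⟨k, rfl⟩ := hj
    rw [Pi.add_apply, sum_single_apply hw, hw.extend_apply, add_sub_cancel]
  · rw [Pi.add_apply, sum_single_apply_of_ne _ fun k hk => hj ⟨k, hk⟩,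
      Function.extend_apply' _ _ _ hj, add_zero]

/-- Writing a family of classical wires in parallel. -/
theorem Realizes.writeFamily {ι : Type*} [Fintype ι] [DecidableEq ι] {G : Gate p Q C → Prop}
    {d : ℕ} (Z : ι → Zone Q C) {Z' : Zone Q C} {w : ι → C} (hw : Function.Injective w)
    {f : ι → (C → ZMod p) → ZMod p}
    (hf : ∀ k c c', (∀ j, (∀ l, w l ≠ j) → c j = c' j) → f k c = f k c')
    (h : ∀ k, Realizes G (Z k) d (writeClassical (w k) (f k))) (hZ : ∀ k, (Z k).Sub Z')
    (hind : ∀ k l, k ≠ l → (Z k).Indep (Z l)) :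
    Realizes G Z' d (pushClassical fun c => Function.extend w (fun k => f k c) c) := by
  have key := Realizes.family Finset.univ Z Z' (fun k => writeClassical (w k) (f k))
    (fun s => pushClassical fun c => c + ∑ k ∈ s, Pi.single (w k) (f k c - c (w k)))
    (fun k _ => h k) (fun k _ => hZ k) (fun k _ l _ => hind k l) ?_ ?_
  · simpa only [add_sum_single_eq_extend hw] using key
  · intro ρ
    funext c
    simp [pushClassical]
  · intro k _ t _ hk ρ _
    rw [writeClassical_eq_pushClassical, pushClassical_comp]
    congr 1
    funext c
    rw [update_eq_add_single, Finset.sum_insert hk, add_assoc, add_comm (Pi.single _ _)]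
    have h1 : f k (c + ∑ k ∈ t, Pi.single (w k) (f k c - c (w k))) = f k c := by
      refine hf _ _ _ fun j hj => ?_
      rw [Pi.add_apply, Finset.sum_apply, Finset.sum_eq_zero, add_zero]
      exact fun l _ => Pi.single_eq_of_ne (hj l).symm _
    have h2 : (c + ∑ k ∈ t, Pi.single (w k) (f k c - c (w k)) : C → ZMod p) (w k) = c (w k) := by
      rw [Pi.add_apply, Finset.sum_apply, Finset.sum_eq_zero, add_zero]
      intro l hl
      refine Pi.single_eq_of_ne (fun h => ?_) _
      rw [hw h] at hk
      exact hk hl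
    rw [h1, h2]

/-- Clearing classical wires. -/
theorem Realizes.clear {ι : Type*} [Fintype ι] [DecidableEq ι] {G : Gate p Q C → Prop}
    (hG : ∀ a b w f, G (.boundedClassical a b w f)) {Z : Zone Q C} {w : ι → C}
    (hw : Function.Injective w) (hZ : ∀ k, w k ∈ Z.writes) (hd : Disjoint Z.canc Z.writes) :
    Realizes G Z 1 (pushClassical fun c => Function.extend w 0 c) := by
  refine Realizes.writeFamily (f := fun _ _ => 0)
    (fun k => (Gate.boundedClassical (p := p) (w k) (w k) (w k) fun _ _ => 0).ownZone) hw ?_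
    (fun k => Realizes.ownZone (hG _ _ _ _)) ?_ ?_
  · exact fun _ _ _ _ => rfl
  · intro k
    have h1 : w k ∈ Z.outs := Or.inl (hZ k)
    have h2 : w k ∈ Z.ins := Z.outs_subset_ins h1
    have h3 : w k ∉ Z.canc := fun h => Set.disjoint_left.1 hd h (hZ k)
    constructor <;> simp [Gate.ownZone, Zone.qudits, Gate.qwires, Gate.creads, Gate.cwrites, h3]
    · simpa [Zone.ins, Zone.outs] using h2
    · simpa [Zone.outs] using h1
  · intro k l hkl
    refine Gate.Compatible.ownZone_indep ?_
    have : w k ≠ w l := fun h => hkl (hw h)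
    simp [Gate.Compatible, Gate.qwires, Gate.creads, Gate.cwrites, this]

/-- Classical values are added to qudits. -/
theorem Realizes.addClassical {ι : Type*} [Fintype ι] [DecidableEq ι] {G : Gate p Q C → Prop}
    (hG : ∀ c q U, G (.classicalCtrl c q U)) {Z : Zone Q C} {r : ι → Q}
    (hr : Function.Injective r) (i : ι → C) (h : ι → ZMod p → ZMod p)
    (hZ : ∀ k, r k ∈ Z.ext) (hi : ∀ k, i k ∈ Z.ins) (hd : Disjoint Z.anc Z.ext) :
    Realizes G Z 1 (conjBy fun c => addOp fun _ => ∑ k, Pi.single (r k) (h k (c (i k)))) := by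
  have key := Realizes.localLayer (G := G) (Z := Z)
    (fun k => .classicalCtrl (i k) (r k) fun v => shiftU (h k v)) r
    (fun k c _ => shift (h k (c (i k)))) (fun k ρ => rfl) (fun _ _ _ _ _ => rfl) hr
    (fun k => hG _ _ _) ?_ ?_ ?_ ?_
  · simpa only [famOp_shift hr fun k _ => h k _] using key
  · intro k
    refine ⟨?_, ?_, ?_⟩
    · simp [Gate.qwires, Zone.qudits, hZ k]
    · simpa [Gate.creads] using hi k
    · simp [Gate.cwrites]
  · intro k
    have : r k ∉ Z.anc := fun h => Set.disjoint_left.1 hd h (hZ k)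
    simpa [Gate.qwires] using this
  · intro k
    simp [Gate.cwrites]
  · intro k l hkl
    have : r k ≠ r l := fun h => hkl (hr h)
    simp [Gate.Compatible, Gate.qwires, Gate.creads, Gate.cwrites, this]

/-! ### Classical thresholds by quantum threshold gates -/

theorem isQTC_boundedClassical (a b w : C) (f : ZMod p → ZMod p → ZMod p) :
    (Gate.boundedClassical a b w f : Gate p Q C).IsQTC := trivial

theorem isQTC_classicalCtrl (c : C) (q : Q) (U : ZMod p → Matrix.unitaryGroup (ZMod p) ℂ) :
    (Gate.classicalCtrl c q U).IsQTC := trivial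

/-- Feed-forward loads the values `h j` into clean qudits, the quantum threshold gate acts on one
more clean qudit, its measurement writes the result on `w`, and feed-forward with the negated values
resets all qudits. The functions `h j` make it possible to count complemented bits. -/
theorem realizes_classical_threshold {ι : Type} [Fintype ι] [DecidableEq ι] (k : ℕ) (i : ι → C)
    (h : ι → ZMod p → ZMod p) (w : C) (hw : ∀ j, i j ≠ w) (a : Option ι ↪ Q) :
    Realizes Gate.IsQTC ⟨∅, Set.range i, {w}, Set.range a, ∅⟩ 5
      (writeClassical w fun c => if k ≤ ∑ j, (h j (c (i j))).val then 1 else 0) := by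
  let Z : Zone Q C := ⟨Set.range a, Set.range i, {w}, ∅, ∅⟩
  let S : Finset Q := Finset.univ.map (Function.Embedding.some.trans a)
  have hS : a none ∉ S := by simp [S]
  have hr : Function.Injective fun j => a (some j) := fun j l hjl => by simpa using hjl
  have hu : Function.Injective fun _ : Unit => a none := Function.injective_of_subsingleton _
  let f₁ : (C → ZMod p) → Q → ZMod p := fun c => ∑ j, Pi.single (a (some j)) (h j (c (i j)))
  have t₁ := Realizes.addClassical (G := (Gate.IsQTC : Gate p Q C → Prop)) (Z := Z) isQTC_classicalCtrl hr i h (by simp [Z])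
    (by simp [Z, Zone.ins]) (by simp [Z])
  have t₂ := Realizes.gate (G := (Gate.IsQTC : Gate p Q C → Prop)) (Z := Z) (.qThreshold k S (a none) hS) trivial
    ⟨by intro q; simp only [Gate.qwires, Z, S, Zone.qudits]; aesop, by simp [Gate.creads],
      by simp [Gate.cwrites]⟩ (by simp [Z]) (by simp [Z])
  have t₃ := Realizes.gate (G := (Gate.IsQTC : Gate p Q C → Prop)) (Z := Z) (.measure (a none) w) trivial
    ⟨by simp [Gate.qwires, Z, Zone.qudits], by simp [Gate.creads],
      by simp [Gate.cwrites, Z, Zone.outs]⟩ (by simp [Z]) (by simp [Z])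
  have t₄ := Realizes.addClassical (G := (Gate.IsQTC : Gate p Q C → Prop)) (Z := Z) isQTC_classicalCtrl hu (fun _ => w) (fun _ v => -v)
    (by simp [Z]) (by simp [Z, Zone.ins, Zone.outs]) (by simp [Z])
  have t₅ := Realizes.addClassical (G := (Gate.IsQTC : Gate p Q C → Prop)) (Z := Z) isQTC_classicalCtrl hr i (fun j v => - h j v)
    (by simp [Z]) (by simp [Z, Zone.ins]) (by simp [Z])
  refine (t₅.comp (t₄.comp (t₃.comp (t₂.comp t₁)))).restrict ?_ ?_ ?_ ?_ ?_ le_rfl ?_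
  · simp [Z, Zone.qudits]
  · simp [Z, Zone.ins, Zone.outs]
  · simp [Z, Zone.outs]
  · simp [Z]
  · simp [Z]
  intro ρ hρ
  refine ⟨?_, ?_⟩
  · simp only [Function.comp]
    funext c
    ext x y
    -- The loaded values do not depend on `w`, so overwriting `w` in between does not spoil the
    -- unloading.
    have hf₁ : ∀ v, f₁ (Function.update c w v) = f₁ c := fun v => by
      simp only [f₁, Function.update_of_ne (hw _)]
    have s₅ : ∀ z : Q → ZMod p, z - (∑ j, Pi.single (a (some j)) (- h j (c (i j)))) = z + f₁ c := by
      intro z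
      simp only [f₁, Pi.single_neg, Finset.sum_neg_distrib, sub_neg_eq_add]
    have s₄ : ∀ z : Q → ZMod p, z - ∑ _j : Unit, Pi.single (a none) (-c w) =
        z + Pi.single (a none) (c w) := by
      intro z
      simp [Pi.single_neg]
    have e₂ : ∀ τ : CQState p Q C, (Gate.qThreshold k S (a none) hS).apply τ =
        conjBy (fun _ => addOp fun x => Pi.single (a none) (threshold k S x)) τ := by
      intro τ
      rw [Gate.apply, localOp_shift]
    have st₂ : Steady fun x : Q → ZMod p => Pi.single (a none) (threshold k S x) := by
      refine Steady.of_support {a none} (fun x q hq => Pi.single_eq_of_ne hq _) fun x x' hx => ?_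
      simp only [threshold]
      rw [Finset.sum_congr rfl fun q hq => by rw [hx q fun h => hS (h ▸ hq)]]
    have stc : ∀ g : (C → ZMod p) → Q → ZMod p, ∀ c, Steady fun _ => g c := fun g c x z => rfl
    rw [conjBy_addOp_apply (stc _), conjBy_addOp_apply (stc _), apply_measure, s₄, s₄, s₅, s₅]
    have e₁ : ∀ c x y, conjBy (fun c => addOp fun _ => f₁ c) ρ c x y =
        ρ c (x - f₁ c) (y - f₁ c) := fun c x y => conjBy_addOp_apply (stc f₁) ρ c x y
    simp only [f₁] at e₁
    simp only [e₂, conjBy_addOp_apply (fun _ => st₂), e₁]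
    change (if _ ∧ _ then ∑ v, ρ (Function.update c w v) (_ - f₁ (Function.update c w v))
      (_ - f₁ (Function.update c w v)) else 0) = _
    simp only [hf₁]
    have g₀ : f₁ c (a none) = 0 := sum_single_apply_of_ne _ fun j => by simp
    have g₁ : ∀ j, f₁ c (a (some j)) = h j (c (i j)) := sum_single_apply hr _
    set N : ZMod p := if k ≤ ∑ j, (h j (c (i j))).val then 1 else 0 with hN
    have g₂ : ∀ x : Q → ZMod p, (∀ j, x (a (some j)) = 0) →
        threshold k S (x + f₁ c + Pi.single (a none) (c w)) = N := by
      intro x hx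
      simp only [threshold, S, Finset.sum_map, hN]
      refine if_congr (iff_of_eq (congrArg _ (Finset.sum_congr rfl fun j _ => ?_))) rfl rfl
      congr 1
      simp [hx, g₁]
    -- `X` pulls a final basis state back through the five layers. On states with clean inputs it
    -- only changes the target, by the difference of `c w` and the true threshold `N`; cleanness of
    -- `ρ` then forces `c w = N`.
    set X : (Q → ZMod p) → (Q → ZMod p) := fun x => x + f₁ c + Pi.single (a none) (c w) -
      Pi.single (a none) (threshold k S (x + f₁ c + Pi.single (a none) (c w))) - f₁ c with hX
    have X₁ : ∀ x j, X x (a (some j)) = x (a (some j)) := by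
      intro x j
      simp [hX]
    have X₂ : ∀ x, (∀ j, x (a (some j)) = 0) → X x = x + Pi.single (a none) (c w - N) := by
      intro x hx
      simp only [hX]
      rw [g₂ x hx, Pi.single_sub]
      abel
    have hc : ∀ x : Q → ZMod p, (x + f₁ c + Pi.single (a none) (c w) : Q → ZMod p) (a none) = c w ↔
        x (a none) = 0 := by
      intro x
      simp [g₀]
    simp only [hc]
    change (if _ ∧ _ then ∑ v, ρ (Function.update c w v) (X x) (X y) else 0) = _
    rw [writeClassical_apply, Matrix.sum_apply]
    simp only [Function.update_of_ne (hw _), ← hN]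
    have hcl : ∀ c x y, ρ c x y ≠ 0 → ∀ o, x (a o) = 0 ∧ y (a o) = 0 :=
      fun c x y h o => (hρ c x y h).2 (a o) ⟨o, rfl⟩
    by_cases hx : ∀ o, x (a o) = 0 ∧ y (a o) = 0
    · rw [if_pos (hx none), X₂ x fun j => (hx _).1, X₂ y fun j => (hx _).2]
      refine Finset.sum_congr rfl fun v _ => ?_
      split_ifs with hNc
      · simp [hNc]
      · by_contra hne
        have := (hcl _ _ _ hne none).1
        simp [(hx none).1, sub_eq_zero] at this
        exact hNc this.symm
    · have r₀ : ∀ v, ρ (Function.update c w v) x y = 0 := fun v => by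
        by_contra hne
        exact hx (hcl _ _ _ hne)
      have l₀ : x (a none) = 0 ∧ y (a none) = 0 → ∀ v, ρ (Function.update c w v) (X x) (X y) = 0 := by
        intro hn v
        by_contra hne
        refine hx fun o => ?_
        cases o with
        | none => exact hn
        | some j => simpa [X₁] using hcl _ _ _ hne (some j)
      refine Eq.trans (b := 0) ?_ (Finset.sum_eq_zero fun v _ => ?_).symm
      · split_ifs with hn
        · exact Finset.sum_eq_zero fun v _ => l₀ hn v
        · rfl
      · split_ifs
        · exact r₀ v
        · rfl
  · exact (IsAction.write (W := ∅) (R := Set.univ) (V := {w}) w rfl _ fun c c' hc => by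
      rw [show c = c' from funext fun b => hc b trivial]).clean (Set.disjoint_empty _)
        (Set.empty_disjoint _) hρ

/-! ### The classical gate `MOD_p` by threshold gates -/

/-- For each j the bits [pj ≤ N] and 1 - [pj + 1 ≤ N] add up to 1 + [N = pj]. The total is n + 1
plus the number of j ≤ n with pj = N, and `hN` ensures that every multiple that N can equal is in
this range. -/
theorem sum_threshold_multiples {n N : ℕ} (hp : 1 < p) (hN : N < p * (n + 1)) :
    (n + 1 + 1 ≤ ∑ κ : Fin (n + 1) × Bool,
      ((fun v : ZMod p => if κ.2 then 1 - v else v)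
        (if p * κ.1 + κ.2.toNat ≤ N then 1 else 0)).val) ↔ p ∣ N := by
  have : Fact (1 < p) := ⟨hp⟩
  have h : ∀ j : Fin (n + 1), ∑ b : Bool, ((fun v : ZMod p => if b then 1 - v else v)
      (if p * j + b.toNat ≤ N then 1 else 0)).val = 1 + if p * j = N then 1 else 0 := by
    intro j
    have h1 : (1 : ZMod p).val = 1 := ZMod.val_one p
    rcases lt_trichotomy (p * j) N with h | h | h
    · simp [h.le, Nat.succ_le_of_lt h, h.ne, h1]
    · simp [h, h1]
    · simp [h.not_ge, h.ne', h1, (Nat.lt_succ_of_lt h).not_ge]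
  rw [Fintype.sum_prod_type, Finset.sum_congr rfl fun j _ => h j, Finset.sum_add_distrib]
  simp only [Finset.sum_const, Finset.card_univ, Fintype.card_fin, smul_eq_mul, mul_one,
    add_le_add_iff_left]
  rw [Finset.sum_boole, Nat.cast_id, Nat.one_le_iff_ne_zero, Finset.card_ne_zero]
  constructor
  · rintro ⟨j, hj⟩
    exact ⟨j, (Finset.mem_filter.1 hj).2.symm⟩
  · rintro ⟨j, rfl⟩
    exact ⟨⟨j, lt_of_mul_lt_mul_left hN (Nat.zero_le _)⟩, by simp⟩

/-- Two rounds of thresholds: 2(|S| + 1) parallel thresholds of the integer sum of the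
representatives, which is at most p|S|, and one threshold of their suitably complemented outputs.
The depth is 5 + 5, plus one layer to copy the result to `w` and one to clear the bits. -/
theorem realizes_classicalMod (hp : 1 < p) (S : Finset C) (w : C)
    (a : ((Fin (S.card + 1) × Bool) × Option S) ⊕ Option (Fin (S.card + 1) × Bool) ↪ Q)
    (b : Option (Fin (S.card + 1) × Bool) ↪ C) (hb : ∀ o, b o ∉ S ∧ b o ≠ w) :
    Realizes Gate.IsQTC ⟨∅, S, {w}, Set.range a, Set.range b⟩ 12
      (Gate.classicalMod S w : Gate p Q C).apply := by
  -- The intermediate bits `b` are ordinary written wires here; they count as ancillas in the final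
  -- zone because the last layer clears them.
  let T : Zone Q C := ⟨∅, S, insert w (Set.range b), Set.range a, ∅⟩
  have hbs : Function.Injective fun κ => b (some κ) := fun κ l h => by simpa using h
  have c₁ : Realizes Gate.IsQTC T 5 _ := Realizes.writeFamily
    (fun κ : Fin (S.card + 1) × Bool => ⟨∅, Set.range fun j : S => (j : C), {b (some κ)},
      Set.range fun o => a (Sum.inl (κ, o)), ∅⟩) hbs (Z' := T)
    (f := fun κ c => if p * κ.1 + κ.2.toNat ≤ ∑ j : S, (c j).val then 1 else 0) ?_
    (fun κ => realizes_classical_threshold (p := p) (p * κ.1 + κ.2.toNat) (fun j : S => (j : C))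
      (fun _ v => v) (b (some κ)) (fun j h => (hb (some κ)).1 (h ▸ j.2))
      ⟨fun o => a (Sum.inl (κ, o)), fun o o' h => by simpa using h⟩) ?_ ?_
  rotate_left
  · intro κ c c' hc
    rw [Finset.sum_congr rfl fun j _ => by rw [hc j fun l h => (hb (some l)).1 (h ▸ j.2)]]
  · intro κ
    constructor <;> simp [Zone.qudits, Zone.ins, Zone.outs, T, Set.range_subset_iff,
      Set.insert_subset_iff]
    exact fun x hx => Or.inr (Or.inl hx)
  · intro κ l hκ
    constructor <;> simp [Zone.qudits, Zone.ins, Zone.outs, hκ, Ne.symm hκ, Set.disjoint_left, hb]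
  have c₂ : Realizes Gate.IsQTC T 5 _ := (realizes_classical_threshold (p := p) (S.card + 1 + 1)
    (fun κ : Fin (S.card + 1) × Bool => b (some κ)) (fun κ v => if κ.2 then 1 - v else v)
    (b none) (by simp) (Function.Embedding.inr.trans a)).mono (by
    constructor <;> simp [Zone.qudits, Zone.ins, Zone.outs, T, Set.range_subset_iff,
      Set.insert_subset_iff]) le_rfl
  have c₃ := Realizes.gate (G := (Gate.IsQTC : Gate p Q C → Prop)) (Z := T) (.boundedClassical (b none) (b none) w fun v _ => v)
    (isQTC_boundedClassical _ _ _ _) ⟨by simp [Gate.qwires],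
      by simp [Gate.creads, T, Zone.ins, Zone.outs], by simp [Gate.cwrites, T, Zone.outs]⟩
      (by simp [Gate.qwires]) (by simp [T])
  have c₄ := Realizes.clear (G := (Gate.IsQTC : Gate p Q C → Prop)) (Z := T) isQTC_boundedClassical b.injective (by simp [T]) (by simp [T])
  refine (c₄.comp (c₃.comp (c₂.comp c₁))).restrict ?_ ?_ ?_ ?_ ?_ le_rfl ?_
  · simp [T, Zone.qudits]
  · simp [T, Zone.ins, Zone.outs]
  · simp [T, Zone.outs]
  · simp [T]
  · simp [T]
  intro ρ hρ
  refine ⟨?_, ?_⟩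
  · simp only [Function.comp, Gate.apply, writeClassical_eq_pushClassical, pushClassical_comp]
    refine pushClassical_congr_of_clean hρ fun c hc => ?_
    set N := ∑ j : S, (c j).val with hN
    have hNS : N < p * (S.card + 1) := by
      have : N ≤ ∑ j : S, p := Finset.sum_le_sum fun j _ => (ZMod.val_lt _).le
      simp only [Finset.sum_const, Finset.card_univ, Fintype.card_coe, smul_eq_mul] at this
      nlinarith
    have hdvd : p ∣ N ↔ ∑ i ∈ S, c i = 0 := by
      rw [← ZMod.natCast_eq_zero_iff, hN, Nat.cast_sum]
      simp only [ZMod.natCast_val, ZMod.cast_id', id]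
      rw [Finset.sum_coe_sort S c]
    funext j
    by_cases hj : ∃ o, b o = j
    · obtain ⟨o, rfl⟩ := hj
      rw [b.injective.extend_apply, Function.update_of_ne (hb o).2, hc _ ⟨o, rfl⟩]
      rfl
    rw [Function.extend_apply' _ _ _ hj]
    by_cases hjw : j = w
    · subst hjw
      simp only [Function.update_self, hbs.extend_apply, sum_threshold_multiples hp hNS, hdvd]
    · have h1 : ¬∃ κ, b (some κ) = j := fun ⟨κ, h⟩ => hj ⟨_, h⟩
      rw [Function.update_of_ne hjw, Function.update_of_ne hjw,
        Function.update_of_ne fun h => hj ⟨none, h.symm⟩, Function.extend_apply' _ _ _ h1]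
  · refine (IsAction.write (W := ∅) (R := Set.univ) (V := {w}) w rfl _ fun c c' hc => by
      rw [show c = c' from funext fun b => hc b trivial]).clean (Set.disjoint_empty _) ?_ hρ
    simp [hb]

end

section

variable {p : ℕ} [NeZero p] {Q C : Type} [Fintype Q] [DecidableEq Q] [Fintype C] [DecidableEq C]

/-! ### Measurement of a family of qudits -/

theorem pushClassical_apply_of_unique {F : (C → ZMod p) → (C → ZMod p)} {ρ : CQState p Q C}
    {c c₀ : C → ZMod p} {x y : Q → ZMod p} (h : ∀ c', ρ c' x y ≠ 0 → F c' = c → c' = c₀) :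
    pushClassical F ρ c x y = if F c₀ = c then ρ c₀ x y else 0 := by
  have h1 : pushClassical F ρ c x y = ∑ c', if F c' = c then ρ c' x y else 0 := by
    simp only [pushClassical, Matrix.sum_apply]
    refine Finset.sum_congr rfl fun c' _ => ?_
    split_ifs <;> rfl
  rw [h1, Finset.sum_eq_single c₀]
  · intro c' _ hne
    by_contra hc
    split_ifs at hc with h2
    · exact hne (h c' hc h2)
    · exact hc rfl
  · simp

/-- The effect of the measurement of the qudits `q k`, for `k ∈ s`, with outcomes on `w k`. -/
def measureFamily {ι : Type*} [DecidableEq ι] (q : ι → Q) (w : ι → C) (s : Finset ι)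
    (ρ : CQState p Q C) : CQState p Q C :=
  fun c x y => if ∀ k ∈ s, x (q k) = c (w k) ∧ y (q k) = c (w k)
    then ∑ c', if ∀ j, (∀ k ∈ s, w k ≠ j) → c' j = c j then ρ c' x y else 0 else 0

theorem measureFamily_empty {ι : Type*} [DecidableEq ι] (q : ι → Q) (w : ι → C)
    (ρ : CQState p Q C) : measureFamily q w ∅ ρ = ρ := by
  funext c
  ext x y
  simp [measureFamily, ← funext_iff]

theorem apply_measure_measureFamily {ι : Type*} [DecidableEq ι] (q : ι → Q) {w : ι → C}
    (hw : Function.Injective w) {s : Finset ι} {k : ι} (hk : k ∉ s) (ρ : CQState p Q C) :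
    (Gate.measure (q k) (w k)).apply (measureFamily q w s ρ) =
      measureFamily q w (insert k s) ρ := by
  have hne : ∀ l ∈ s, w l ≠ w k := fun l hl h => hk (hw h ▸ hl)
  funext c
  ext x y
  rw [apply_measure]
  have h1 : ∀ v, measureFamily q w s ρ (Function.update c (w k) v) x y =
      if ∀ l ∈ s, x (q l) = c (w l) ∧ y (q l) = c (w l)
      then ∑ c', if ∀ j, (∀ l ∈ s, w l ≠ j) → c' j = Function.update c (w k) v j
        then ρ c' x y else 0 else 0 := by
    intro v
    refine if_congr (forall₂_congr fun l hl => ?_) rfl rfl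
    rw [Function.update_of_ne (hne l hl)]
  simp only [h1]
  have h2 : measureFamily q w (insert k s) ρ c x y =
      if ∀ l ∈ insert k s, x (q l) = c (w l) ∧ y (q l) = c (w l)
      then ∑ c', if ∀ j, (∀ l ∈ insert k s, w l ≠ j) → c' j = c j then ρ c' x y else 0
      else 0 := rfl
  rw [h2]
  simp only [Finset.forall_mem_insert]
  by_cases ha : x (q k) = c (w k) ∧ y (q k) = c (w k)
  · by_cases hb : ∀ l ∈ s, x (q l) = c (w l) ∧ y (q l) = c (w l)
    · rw [if_pos ha, if_pos ⟨ha, hb⟩]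
      simp only [if_pos hb]
      rw [Finset.sum_comm]
      refine Finset.sum_congr rfl fun c' _ => ?_
      rw [Finset.sum_eq_single (c' (w k))]
      · refine if_congr (forall_congr' fun j => ?_) rfl rfl
        by_cases hj : j = w k
        · subst hj; simp
        · simp [hj, Ne.symm hj]
      · intro v _ hv
        rw [if_neg]
        intro H
        exact hv (by simpa using (H (w k) hne).symm)
      · simp
    · rw [if_pos ha, if_neg fun h => hb h.2]
      simp [hb]
  · rw [if_neg ha, if_neg fun h => ha h.1]

theorem measureFamily_apply_of_clean {ι : Type*} [Fintype ι] [DecidableEq ι] (q : ι → Q) {w : ι → C}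
    (hw : Function.Injective w) {ρ : CQState p Q C} {x y : Q → ZMod p}
    (hρ : ∀ c, ρ c x y ≠ 0 → ∀ k, c (w k) = 0) (c : C → ZMod p) :
    measureFamily q w Finset.univ ρ c x y =
      if ∀ k, x (q k) = c (w k) ∧ y (q k) = c (w k)
      then ρ (Function.extend w 0 c) x y else 0 := by
  simp only [measureFamily, Finset.mem_univ, true_imp_iff]
  refine if_congr Iff.rfl ?_ rfl
  rw [Finset.sum_eq_single (Function.extend w (0 : ι → ZMod p) c)]
  · rw [if_pos]
    intro j hj
    exact Function.extend_apply' _ _ _ (by simpa using hj)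
  · intro c' _ hne
    by_contra h
    split_ifs at h with h1
    · refine hne (funext fun j => ?_)
      by_cases hj : ∃ k, w k = j
      · obtain ⟨k, rfl⟩ := hj
        rw [hw.extend_apply, hρ c' h k]
        rfl
      · rw [Function.extend_apply' _ _ _ hj, h1 j fun k hk => hj ⟨k, hk⟩]
    · exact h rfl
  · simp

theorem Realizes.measureFamily {ι : Type*} [Fintype ι] [DecidableEq ι] {G : Gate p Q C → Prop}
    (hG : ∀ q w, G (.measure q w)) {Z : Zone Q C} {q : ι → Q} (hq : Function.Injective q)
    {w : ι → C} (hw : Function.Injective w) (hZq : ∀ k, q k ∈ Z.ext) (hZw : ∀ k, w k ∈ Z.writes)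
    (hA : Disjoint Z.anc Z.ext) (hB : Disjoint Z.canc Z.writes) :
    Realizes G Z 1 (measureFamily q w Finset.univ) := by
  refine Realizes.layer (fun k => .measure (q k) (w k)) (fun k => hG _ _) ?_ ?_ ?_ ?_
    (fun s => QuditCircuit.measureFamily q w s) (measureFamily_empty q w)
    fun k t hk ρ => apply_measure_measureFamily q hw hk ρ
  · intro k
    refine ⟨?_, ?_, ?_⟩
    · simp [Gate.qwires, Zone.qudits, hZq]
    · simp [Gate.creads]
    · simp [Gate.cwrites, Zone.outs, hZw]
  · intro k
    have := Set.disjoint_right.1 hA (hZq k)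
    simpa [Gate.qwires] using this
  · intro k
    have := Set.disjoint_right.1 hB (hZw k)
    simpa [Gate.cwrites] using this
  · intro k l hkl
    have h1 : q k ≠ q l := fun h => hkl (hq h)
    have h2 : w k ≠ w l := fun h => hkl (hw h)
    simp [Gate.Compatible, Gate.qwires, Gate.creads, Gate.cwrites, h1, h2]

/-! ### Classical sums by `MOD_p` gates -/

/-- One round per value v of the list: v is written on `b 0`, the `MOD_p` gate on `S` together with
`b 0` tests whether the sum over `S` is -v, and if so v is subtracted from `w`. -/
theorem exists_realizes_classical_sum_rounds (hp : 1 < p) (S : Finset C) {w : C} (hw : w ∉ S) {b : Fin 2 → C}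
    (hb : Function.Injective b) (hbS : ∀ j, b j ∉ S) (hbw : ∀ j, b j ≠ w) (l : List (ZMod p)) :
    ∃ F : (C → ZMod p) → (C → ZMod p),
      Realizes (p := p) Gate.IsQNCModC (⟨∅, S, insert w (Set.range b), ∅, ∅⟩ : Zone Q C) (3 * l.length)
        (pushClassical F) ∧
      (∀ c j, j ≠ w → (∀ i, b i ≠ j) → F c j = c j) ∧
      ∀ c, F c w = c w - (l.map fun v => if ∑ i ∈ S, c i + v = 0 then v else 0).sum := by
  set Z : Zone Q C := ⟨∅, S, insert w (Set.range b), ∅, ∅⟩ with hZ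
  induction l with
  | nil =>
    refine ⟨id, Realizes.id.congr fun ρ _ => ?_, by simp, by simp⟩
    funext c
    simp [pushClassical]
  | cons v l ih =>
    obtain ⟨F, h1, h2, h3⟩ := ih
    have g₁ := Realizes.gate (G := (Gate.IsQNCModC : Gate p Q C → Prop)) (Z := Z)
      (.boundedClassical (b 0) (b 0) (b 0) fun _ _ => v) trivial
      ⟨by simp [Gate.qwires], by simp [Gate.creads, Z, Zone.ins, Zone.outs],
        by simp [Gate.cwrites, Z, Zone.outs]⟩ (by simp [Gate.qwires]) (by simp [Z])
    have g₂ := Realizes.gate (G := (Gate.IsQNCModC : Gate p Q C → Prop)) (Z := Z)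
      (.classicalMod (insert (b 0) S) (b 1)) trivial
      ⟨by simp [Gate.qwires], by
        simp only [Gate.creads, Z, Zone.ins, Zone.outs, Finset.coe_insert, Set.insert_subset_iff]
        exact ⟨by simp, fun x hx => Or.inl hx⟩,
        by simp [Gate.cwrites, Z, Zone.outs]⟩ (by simp [Gate.qwires]) (by simp [Z])
    have g₃ := Realizes.gate (G := (Gate.IsQNCModC : Gate p Q C → Prop)) (Z := Z)
      (.boundedClassical w (b 1) w fun x y => if y = 1 then x - v else x) trivial
      ⟨by simp [Gate.qwires], by
        simp [Gate.creads, Z, Zone.ins, Zone.outs, Set.insert_subset_iff],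
        by simp [Gate.cwrites, Z, Zone.outs]⟩ (by simp [Gate.qwires]) (by simp [Z])
    have hp1 : (0 : ZMod p) ≠ 1 := by
      have : Fact (1 < p) := ⟨hp⟩
      exact zero_ne_one
    have h01 : b 0 ≠ b 1 := fun h => by simpa using hb h
    have h0S : b 0 ∉ S := hbS 0
    have h1S : b 1 ∉ S := hbS 1
    have hi : ∀ i ∈ S, i ≠ w ∧ i ≠ b 0 ∧ i ≠ b 1 := fun i hi =>
      ⟨fun h => hw (h ▸ hi), fun h => h0S (h ▸ hi), fun h => h1S (h ▸ hi)⟩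
    let H : (C → ZMod p) → (C → ZMod p) := fun c =>
      let c₁ := Function.update c (b 0) v
      let c₂ := Function.update c₁ (b 1) (if ∑ i ∈ insert (b 0) S, c₁ i = 0 then 1 else 0)
      Function.update c₂ w (if c₂ (b 1) = 1 then c₂ w - v else c₂ w)
    have hH : ∀ c j, j ≠ w → (∀ i, b i ≠ j) → H c j = c j := by
      intro c j hj hbj
      simp only [H]
      rw [Function.update_of_ne hj, Function.update_of_ne (hbj 1).symm,
        Function.update_of_ne (hbj 0).symm]
    have hHS : ∀ c, ∑ i ∈ S, H c i = ∑ i ∈ S, c i := fun c =>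
      Finset.sum_congr rfl fun i hiS => hH c i (hi i hiS).1 fun j h => hbS j (h ▸ hiS)
    have hHw : ∀ c, H c w = c w - if ∑ i ∈ S, c i + v = 0 then v else 0 := by
      intro c
      have e : ∑ i ∈ insert (b 0) S, Function.update c (b 0) v i = ∑ i ∈ S, c i + v := by
        rw [Finset.sum_insert h0S, Function.update_self, add_comm]
        congr 1
        exact Finset.sum_congr rfl fun i hiS => Function.update_of_ne (hi i hiS).2.1 _ _
      simp only [H, Function.update_self, e, Function.update_of_ne (hbw 1).symm,
        Function.update_of_ne (hbw 0).symm]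
      by_cases h : ∑ i ∈ S, c i + v = 0 <;> simp [h, hp1]
    refine ⟨fun c => F (H c), ?_, fun c j hj hbj => ?_, fun c => ?_⟩
    · refine (h1.comp (g₃.comp (g₂.comp g₁))).restrict subset_rfl subset_rfl subset_rfl subset_rfl
        subset_rfl (by simp; omega) fun ρ _ => ⟨?_, fun _ _ _ _ => ⟨fun _ hb => hb.elim, fun _ hq => hq.elim⟩⟩
      simp only [Function.comp, Gate.apply, writeClassical_eq_pushClassical, pushClassical_comp]
      rfl
    · beta_reduce
      rw [h2 _ _ hj hbj, hH _ _ hj hbj]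
    · beta_reduce
      rw [h3, hHw, hHS, List.map_cons, List.sum_cons]
      abel

theorem realizes_classical_sum (hp : 1 < p) (S : Finset C) {w : C} (hw : w ∉ S) {b : Fin 2 → C}
    (hb : Function.Injective b) (hbS : ∀ j, b j ∉ S) (hbw : ∀ j, b j ≠ w) :
    Realizes (p := p) Gate.IsQNCModC (⟨∅, S, {w}, ∅, Set.range b⟩ : Zone Q C) (3 * p + 2)
      (writeClassical w fun c => ∑ i ∈ S, c i) := by
  -- All values of `ZMod p` are tried in turn. The only round that fires is the one with v equal to
  -- minus the sum, and it adds the sum to the cleared wire `w`. Clearing `w` before and `b`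
  -- afterwards accounts for the 2 in the depth.
  obtain ⟨F, h1, h2, h3⟩ := exists_realizes_classical_sum_rounds (Q := Q) hp S hw hb hbS hbw
    (Finset.univ : Finset (ZMod p)).toList
  set Z : Zone Q C := ⟨∅, S, insert w (Set.range b), ∅, ∅⟩ with hZ
  have g₁ := Realizes.gate (G := (Gate.IsQNCModC : Gate p Q C → Prop)) (Z := Z)
    (.boundedClassical w w w fun _ _ => 0) trivial
    ⟨by simp [Gate.qwires], by simp [Gate.creads, Z, Zone.ins, Zone.outs],
      by simp [Gate.cwrites, Z, Zone.outs]⟩ (by simp [Gate.qwires]) (by simp [Z])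
  have g₂ := Realizes.clear (G := (Gate.IsQNCModC : Gate p Q C → Prop)) (Z := Z)
    (fun _ _ _ _ => trivial) hb (by simp [Z]) (by simp [Z])
  refine (g₂.comp (h1.comp g₁)).restrict ?_ ?_ ?_ ?_ ?_ ?_ ?_
  · simp [Z, Zone.qudits]
  · simp [Z, Zone.ins, Zone.outs]
  · simp [Z, Zone.outs]
  · simp [Z]
  · simp [Z]
  · simp [ZMod.card]
    omega
  intro ρ hρ
  refine ⟨?_, ?_⟩
  · simp only [Function.comp, Gate.apply, writeClassical_eq_pushClassical, pushClassical_comp]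
    refine pushClassical_congr_of_clean hρ fun c hc => ?_
    funext j
    by_cases hj : ∃ o, b o = j
    · obtain ⟨o, rfl⟩ := hj
      rw [hb.extend_apply, Function.update_of_ne (hbw o), hc _ ⟨o, rfl⟩]
      rfl
    rw [Function.extend_apply' _ _ _ hj]
    by_cases hjw : j = w
    · subst hjw
      have e : ∀ v : ZMod p, ∑ i ∈ S, Function.update c j 0 i = ∑ i ∈ S, c i := fun v =>
        Finset.sum_congr rfl fun i hiS => Function.update_of_ne (ne_of_mem_of_not_mem hiS hw) _ _
      rw [h3, e 0, Function.update_self, Function.update_self, Finset.sum_map_toList,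
        Finset.sum_eq_single (-∑ i ∈ S, c i)]
      · simp
      · intro v _ hv
        rw [if_neg]
        intro h
        exact hv (by rw [add_comm] at h; exact eq_neg_of_add_eq_zero_left h)
      · simp
    · rw [h2 _ _ hjw fun i hi => hj ⟨i, hi⟩, Function.update_of_ne hjw, Function.update_of_ne hjw]
  · refine (IsAction.write (W := ∅) (R := Set.univ) (V := {w}) w rfl _ fun c c' hc => by
      rw [show c = c' from funext fun b => hc b trivial]).clean (Set.disjoint_empty _) ?_ hρ
    simp [hbw]

end

/-! ### Layers of elementary gates, chains, and measurement with reset -/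

section

variable {p : ℕ} [NeZero p] {Q C : Type} [Fintype Q] [DecidableEq Q] [Fintype C] [DecidableEq C]

/-- A layer of controlled one-qudit gates. -/
theorem Realizes.ctrlLayer {ι : Type*} [Fintype ι] [DecidableEq ι] {G : Gate p Q C → Prop}
    (hG : ∀ a t h U, G (.ctrl a t h U)) {Z : Zone Q C} {s r : ι → Q}
    (hs : Function.Injective s) (hr : Function.Injective r) (hsr : ∀ k l, s k ≠ r l)
    (U : ι → ZMod p → Matrix.unitaryGroup (ZMod p) ℂ) (hZs : ∀ k, s k ∈ Z.ext)
    (hZr : ∀ k, r k ∈ Z.ext) (hd : Disjoint Z.anc Z.ext) :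
    Realizes G Z 1 (conjBy fun _ => famOp Finset.univ r fun k x =>
      (U k (x (s k)) : Matrix (ZMod p) (ZMod p) ℂ)) := by
  refine Realizes.localLayer (G := G) (Z := Z) (fun k => .ctrl (s k) (r k) (hsr k k) (U k)) r
    (fun k _ x => (U k (x (s k)) : Matrix (ZMod p) (ZMod p) ℂ)) (fun k ρ => rfl) ?_ hr
    (fun k => hG _ _ _ _) ?_ ?_ ?_ ?_
  · intro k c x x' h
    rw [h (s k) fun l => (hsr k l).symm]
  · intro k
    refine ⟨?_, ?_, ?_⟩
    · simp [Gate.qwires, Zone.qudits, hZs, hZr, Set.insert_subset_iff]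
    · simp [Gate.creads]
    · simp [Gate.cwrites]
  · intro k
    have h1 := Set.disjoint_right.1 hd (hZs k)
    have h2 := Set.disjoint_right.1 hd (hZr k)
    simp [Gate.qwires, h1, h2]
  · intro k
    simp [Gate.cwrites]
  · intro k l hkl
    have h1 : r k ≠ r l := fun h => hkl (hr h)
    have h2 : s k ≠ s l := fun h => hkl (hs h)
    simp [Gate.Compatible, Gate.qwires, Gate.creads, Gate.cwrites, h1.symm, h2.symm, hsr,
      (hsr _ _).symm]

/-- A layer of one-qudit gates. -/
theorem Realizes.oneQuditLayer {ι : Type*} [Fintype ι] [DecidableEq ι] {G : Gate p Q C → Prop}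
    (hG : ∀ q U, G (.oneQudit q U)) {Z : Zone Q C} {r : ι → Q} (hr : Function.Injective r)
    (U : ι → Matrix.unitaryGroup (ZMod p) ℂ) (hZr : ∀ k, r k ∈ Z.ext) (hd : Disjoint Z.anc Z.ext) :
    Realizes G Z 1 (conjBy fun _ => famOp Finset.univ r fun k _ =>
      (U k : Matrix (ZMod p) (ZMod p) ℂ)) := by
  refine Realizes.localLayer (G := G) (Z := Z) (fun k => .oneQudit (r k) (U k)) r
    (fun k _ x => (U k : Matrix (ZMod p) (ZMod p) ℂ)) (fun k ρ => rfl) (fun _ _ _ _ _ => rfl) hr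
    (fun k => hG _ _) ?_ ?_ ?_ ?_
  · intro k
    refine ⟨?_, ?_, ?_⟩
    · simp [Gate.qwires, Zone.qudits, hZr]
    · simp [Gate.creads]
    · simp [Gate.cwrites]
  · intro k
    have h2 := Set.disjoint_right.1 hd (hZr k)
    simp [Gate.qwires, h2]
  · intro k
    simp [Gate.cwrites]
  · intro k l hkl
    have h1 : r k ≠ r l := fun h => hkl (hr h)
    simp [Gate.Compatible, Gate.qwires, Gate.creads, Gate.cwrites, h1]

/-! ### Chains -/

/-- Telescoping: the consecutive differences of a chain determine it from its first member through
their prefix sums. -/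
theorem forall_eq_sub_iff_forall_eq_sum {k : ℕ} (z : Fin (k + 1) → ZMod p) (D : Fin k → ZMod p) :
    (∀ i : Fin k, D i = z i.succ - z i.castSucc) ↔
      ∀ i : Fin k, z i.succ = z 0 + ∑ l ∈ Finset.Iic i, D l := by
  have hI : ∀ (n : ℕ) (h : n + 1 < k), ∑ l ∈ Finset.Iic (⟨n + 1, h⟩ : Fin k), D l =
      ∑ l ∈ Finset.Iic (⟨n, by omega⟩ : Fin k), D l + D ⟨n + 1, h⟩ := by
    intro n h
    have : Finset.Iic (⟨n + 1, h⟩ : Fin k) =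
        insert ⟨n + 1, h⟩ (Finset.Iic (⟨n, by omega⟩ : Fin k)) := by
      ext l
      simp only [Finset.mem_Iic, Finset.mem_insert, Fin.le_def, Fin.ext_iff]
      omega
    rw [this, Finset.sum_insert (by simp), add_comm]
  have h0 : ∀ (h : 0 < k), ∑ l ∈ Finset.Iic (⟨0, h⟩ : Fin k), D l = D ⟨0, h⟩ := by
    intro h
    have : Finset.Iic (⟨0, h⟩ : Fin k) = {⟨0, h⟩} := by
      ext l
      simp only [Finset.mem_Iic, Finset.mem_singleton, Fin.le_def, Fin.ext_iff]
      omega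
    rw [this, Finset.sum_singleton]
  have hc : ∀ (n : ℕ) (h : n + 1 < k),
      (⟨n + 1, h⟩ : Fin k).castSucc = (⟨n, by omega⟩ : Fin k).succ := fun n h => by
    ext; simp
  have hz : ∀ (h : 0 < k), (⟨0, h⟩ : Fin k).castSucc = 0 := fun h => by ext; simp
  constructor
  · rintro H ⟨n, hn⟩
    induction n with
    | zero => rw [h0, H, hz]; abel
    | succ n ih => rw [hI, ← add_assoc, ← ih (by omega), H ⟨n + 1, hn⟩, hc n hn]; abel
  · rintro H ⟨n, hn⟩
    cases n with
    | zero => rw [H, h0, hz]; abel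
    | succ n => rw [hc n hn, H, H, hI]; abel

theorem prod_stdAddChar {ι : Type*} (s : Finset ι) (f : ι → ZMod p) :
    ∏ i ∈ s, (ZMod.stdAddChar (f i) : ℂ) = ZMod.stdAddChar (∑ i ∈ s, f i) := by
  classical
  induction s using Finset.induction_on with
  | empty => simp
  | insert i s hi ih => rw [Finset.prod_insert hi, Finset.sum_insert hi, ih, AddChar.map_add_eq_mul]

/-! ### Measuring and resetting -/

theorem extend_eq_add_sum_single {ι : Type*} [Fintype ι] [DecidableEq ι] {q : ι → Q}
    (hq : Function.Injective q) {x : Q → ZMod p} (hx : ∀ k, x (q k) = 0) (v : ι → ZMod p) :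
    x + ∑ k, Pi.single (q k) (v k) = Function.extend q v x := by
  rw [← add_sum_single_eq_extend hq]
  simp [hx]

/-- After the measurement the outcomes are subtracted, so the qudits `q k` return to `|0⟩` and only
the record on `w` remains. An entry of the new state is thus the old entry with the recorded values
put back on the qudits `q k`. -/
theorem Realizes.measureReset {ι : Type*} [Fintype ι] [DecidableEq ι] {G : Gate p Q C → Prop}
    (hG : ∀ q w, G (.measure q w)) (hG' : ∀ c q U, G (.classicalCtrl c q U)) {Z : Zone Q C}
    {q : ι → Q} (hq : Function.Injective q) {w : ι → C} (hw : Function.Injective w)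
    (hZq : ∀ k, q k ∈ Z.ext) (hZw : ∀ k, w k ∈ Z.writes) (hA : Disjoint Z.anc Z.ext)
    (hB : Disjoint Z.canc Z.writes) :
    ∃ T : CQState p Q C → CQState p Q C, Realizes G Z 2 T ∧
      ∀ ρ, (∀ c x y, ρ c x y ≠ 0 → ∀ k, c (w k) = 0) → ∀ c x y,
        ((∀ k, x (q k) = 0 ∧ y (q k) = 0) → T ρ c x y = ρ (Function.extend w 0 c)
          (Function.extend q (fun k => c (w k)) x) (Function.extend q (fun k => c (w k)) y)) ∧
        (T ρ c x y ≠ 0 → ∀ k, x (q k) = 0 ∧ y (q k) = 0) := by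
  have h1 := Realizes.measureFamily hG hq hw hZq hZw hA hB
  have h2 := Realizes.addClassical hG' (Z := Z) hq w (fun _ v => -v) hZq
    (fun k => Z.outs_subset_ins (Or.inl (hZw k))) hA
  refine ⟨_, h2.comp h1, fun ρ hρ c x y => ?_⟩
  have hs : ∀ c : C → ZMod p, Steady fun _ : Q → ZMod p =>
      ∑ k, (Pi.single (q k) (-c (w k)) : Q → ZMod p) := fun c _ _ => rfl
  have he : ∀ x : Q → ZMod p, x - ∑ k, (Pi.single (q k) (-c (w k)) : Q → ZMod p) =
      x + ∑ k, (Pi.single (q k) (c (w k)) : Q → ZMod p) := fun x => by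
    rw [sub_eq_add_neg, ← Finset.sum_neg_distrib]
    simp only [← Pi.single_neg, neg_neg]
  rw [Function.comp, conjBy_addOp_apply hs, he, he,
    measureFamily_apply_of_clean q hw fun c h => hρ c _ _ h]
  have hv : ∀ (x : Q → ZMod p) k, (x + ∑ k, (Pi.single (q k) (c (w k)) : Q → ZMod p)) (q k) =
      c (w k) ↔ x (q k) = 0 := fun x k => by
    rw [Pi.add_apply, sum_single_apply hq fun k => c (w k)]
    simp
  by_cases h : ∀ k, x (q k) = 0 ∧ y (q k) = 0
  · refine ⟨fun _ => ?_, fun _ => h⟩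
    rw [if_pos fun k => ⟨(hv x k).2 (h k).1, (hv y k).2 (h k).2⟩,
      extend_eq_add_sum_single hq (fun k => (h k).1) fun k => c (w k),
      extend_eq_add_sum_single hq (fun k => (h k).2) fun k => c (w k)]
  · refine ⟨fun h' => absurd h' h, fun h' => absurd (if_neg ?_) h'⟩
    exact fun H => h fun k => ⟨(hv x k).1 (H k).1, (hv y k).1 (H k).2⟩

/-- Forgetting a measurement record sums over all possible records. When each record `V v`
contributes the same amount, the sum is the number of records times this amount; later this number
cancels the normalization of the Fourier gates. -/
theorem pushClassical_clear_apply {ι κ : Type*} [Fintype ι] [DecidableEq ι] [Fintype κ]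
    {w : ι → C} (hw : Function.Injective w) {V : κ → ι → ZMod p} (hV : Function.Injective V)
    {ρ : CQState p Q C} {x y : Q → ZMod p} {A : (C → ZMod p) → ℂ}
    (h₀ : ∀ c, ρ c x y ≠ 0 → ∃ v, (fun i => c (w i)) = V v)
    (h₁ : ∀ c v, (fun i => c (w i)) = V v → ρ c x y = A (Function.extend w (0 : ι → ZMod p) c))
    (c : C → ZMod p) :
    pushClassical (fun c => Function.extend w (0 : ι → ZMod p) c) ρ c x y =
      if ∀ i, c (w i) = 0 then Fintype.card κ * A c else 0 := by
  have e : pushClassical (fun c => Function.extend w (0 : ι → ZMod p) c) ρ c x y =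
      ∑ c', if Function.extend w (0 : ι → ZMod p) c' = c then ρ c' x y else 0 := by
    rw [pushClassical, Matrix.sum_apply]
    refine Finset.sum_congr rfl fun c' _ => ?_
    split_ifs <;> rfl
  rw [e]
  by_cases hc : ∀ i, c (w i) = 0
  · rw [if_pos hc]
    have hx : ∀ v, (fun i => Function.extend w (V v) c (w i)) = V v := fun v =>
      funext fun i => hw.extend_apply _ _ i
    have hcc : ∀ u : ι → ZMod p, Function.extend w (0 : ι → ZMod p) (Function.extend w u c) = c := fun u => by
      funext j
      by_cases hj : ∃ i, w i = j
      · obtain ⟨i, rfl⟩ := hj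
        rw [hw.extend_apply, hc i]; rfl
      · rw [Function.extend_apply' _ _ _ hj, Function.extend_apply' _ _ _ hj]
    rw [← Finset.sum_of_injOn (s := Finset.univ) (f := fun _ : κ => A c)
      (fun v => Function.extend w (V v) c)]
    · simp
    · intro v _ v' _ h
      refine hV ?_
      rw [← hx v, ← hx v']
      exact funext fun i => congrFun h _
    · simp
    · intro c' _ hc'
      split_ifs with h
      · by_contra hne
        obtain ⟨v, hv⟩ := h₀ c' hne
        refine hc' ⟨v, by simp, ?_⟩
        funext j
        by_cases hj : ∃ i, w i = j
        · obtain ⟨i, rfl⟩ := hj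
          beta_reduce
          rw [hw.extend_apply, ← hv]
        · beta_reduce
          rw [Function.extend_apply' _ _ _ hj, ← h, Function.extend_apply' _ _ _ hj]
      · rfl
    · intro v _
      rw [if_pos (hcc _), h₁ _ v (hx v), hcc]
  · rw [if_neg hc]
    refine Finset.sum_eq_zero fun c' _ => if_neg ?_
    rintro rfl
    exact hc fun i => by rw [hw.extend_apply]; rfl

end

/-! ### Uniform superpositions and differences along a chain -/

section

variable {p : ℕ} [NeZero p] {Q C : Type} [Fintype Q] [DecidableEq Q] [Fintype C] [DecidableEq C]

theorem Realizes.of_le {G : Gate p Q C → Prop} {Z : Zone Q C} {d d' : ℕ}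
    {T : CQState p Q C → CQState p Q C} (h : Realizes G Z d T) (hd : d ≤ d') :
    Realizes G Z d' T := by
  obtain ⟨Ls, h1, h2⟩ := h
  exact ⟨Ls, h1.trans hd, h2⟩

/-- Fourier gates create uniform superpositions. -/
theorem conjBy_fourier_apply_of_clean {ι : Type*} [Fintype ι] [DecidableEq ι] {b : ι → Q}
    (hb : Function.Injective b) {ρ : CQState p Q C}
    (hρ : ∀ c x y, ρ c x y ≠ 0 → ∀ i, x (b i) = 0 ∧ y (b i) = 0) (c : C → ZMod p)
    (x y : Q → ZMod p) :
    conjBy (fun _ => famOp Finset.univ b fun _ _ => fourier) ρ c x y =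
      ((p : ℂ)⁻¹) ^ Fintype.card ι * ρ c (Function.extend b 0 x) (Function.extend b 0 y) := by
  have hu : ∀ x x' : Q → ZMod p, (∀ i, x' (b i) = 0) →
      famOp Finset.univ b (fun _ _ => fourier) x x' ≠ 0 → x' = Function.extend b (0 : ι → ZMod p) x := by
    intro x x' h0 h
    rw [famOp_univ_apply] at h
    have h' := (ite_ne_right_iff.1 h).1
    funext j
    by_cases hj : ∃ i, b i = j
    · obtain ⟨i, rfl⟩ := hj
      rw [h0, hb.extend_apply]; rfl
    · rw [Function.extend_apply' _ _ _ hj, h' j fun i hi => hj ⟨i, hi⟩]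
  have hv : ∀ x : Q → ZMod p, famOp Finset.univ b (fun _ _ => fourier) x (Function.extend b 0 x) =
      ((((Real.sqrt p)⁻¹ : ℝ)) : ℂ) ^ Fintype.card ι := by
    intro x
    rw [famOp_univ_apply, if_pos fun j hj => (Function.extend_apply' _ _ _ (by simpa using hj)).symm]
    simp [hb.extend_apply, fourier]
  rw [conjBy_apply_of_unique (x₀ := Function.extend b 0 x) (y₀ := Function.extend b 0 y)
    (fun x' y' h h' => hu x x' (fun i => (hρ c x' y' h i).1) h')
    (fun x' y' h h' => hu y y' (fun i => (hρ c x' y' h i).2) h'), hv, hv, ← sqrt_inv_mul_sqrt_inv,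
    mul_pow]
  simp only [star_pow, RCLike.star_def, Complex.conj_ofReal]
  ring

/-- A layer of controlled shifts. -/
theorem Realizes.ctrlShift {ι : Type*} [Fintype ι] [DecidableEq ι] {G : Gate p Q C → Prop}
    (hG : ∀ a t h U, G (.ctrl a t h U)) {Z : Zone Q C} {s r : ι → Q}
    (hs : Function.Injective s) (hr : Function.Injective r) (hsr : ∀ k l, s k ≠ r l)
    (f : ι → ZMod p → ZMod p) (hZs : ∀ k, s k ∈ Z.ext)
    (hZr : ∀ k, r k ∈ Z.ext) (hd : Disjoint Z.anc Z.ext) :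
    ∃ T : CQState p Q C → CQState p Q C, Realizes G Z 1 T ∧ ∀ ρ c x y, T ρ c x y =
      ρ c (x - ∑ k, Pi.single (r k) (f k (x (s k)))) (y - ∑ k, Pi.single (r k) (f k (y (s k)))) := by
  have h := Realizes.ctrlLayer hG hs hr hsr (fun k v => shiftU (f k v)) hZs hZr hd
  refine ⟨_, h, fun ρ c x y => ?_⟩
  have e := famOp_shift hr fun k (x : Q → ZMod p) => f k (x (s k))
  simp only [shiftU]
  rw [e, conjBy_addOp_apply]
  intro _
  refine Steady.of_support (Set.range r) (fun x j hj => ?_) fun x x' h => ?_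
  · exact sum_single_apply_of_ne _ fun k hk => hj ⟨k, hk⟩
  · refine Finset.sum_congr rfl fun k _ => ?_
    rw [h (s k)]
    rintro ⟨l, hl⟩
    exact hsr k l hl.symm

variable {k : ℕ}

/-- The chain `q, b₀, …, b_{k-1}`. -/
def chain (q : Q) (b : Fin k → Q) : Fin (k + 1) → Q := Fin.cons q b

theorem chain_injective {q : Q} {b : Fin k → Q} (hb : Function.Injective b) (hq : ∀ i, b i ≠ q) :
    Function.Injective (chain q b) :=
  Fin.cons_injective_iff.2 ⟨by rintro ⟨i, hi⟩; exact hq i hi, hb⟩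

/-- The qudits `a (i, 0)` are put in uniform superposition, and `a (i, 1)` receives the difference
of `a (i, 0)` and its predecessor in the chain that starts with `q`. Two layers of controlled shifts
are needed because a member of the chain can control two differences, but a qudit takes part in one
gate per layer. -/
theorem exists_realizes_differences {q : Q} (a : Fin k × Fin 2 ↪ Q) (hq : ∀ i, a i ≠ q)
    {Z : Zone Q C} (hZq : q ∈ Z.ext) (hZa : ∀ i, a i ∈ Z.ext) (hA : Disjoint Z.anc Z.ext) :
    ∃ T : CQState p Q C → CQState p Q C, Realizes Gate.IsQNCModC Z 3 T ∧
      ∀ ρ, Clean (Set.range a) ∅ ρ → ∀ c x y, T ρ c x y =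
        if ∀ i, (x (a (i, 1)) = x (a (i, 0)) - x (chain q (fun i => a (i, 0)) i.castSucc)) ∧
            y (a (i, 1)) = y (a (i, 0)) - y (chain q (fun i => a (i, 0)) i.castSucc)
        then ((p : ℂ)⁻¹) ^ k * ρ c (Function.extend a 0 x) (Function.extend a 0 y) else 0 := by
  have hb : Function.Injective fun i => a (i, (0 : Fin 2)) := fun i j h => by simpa using h
  have he : Function.Injective fun i => a (i, (1 : Fin 2)) := fun i j h => by simpa using h
  have hbe : ∀ i j, a (i, (0 : Fin 2)) ≠ a (j, 1) := fun i j h => by simp at h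
  have hβ := chain_injective hb fun i => hq _
  have hβe : ∀ (i : Fin (k + 1)) j, chain q (fun i => a (i, 0)) i ≠ a (j, 1) := by
    intro i j
    cases i using Fin.cases with
    | zero => exact (hq _).symm
    | succ i => exact hbe i j
  have hZβ : ∀ i : Fin (k + 1), chain q (fun i => a (i, 0)) i ∈ Z.ext := by
    intro i
    cases i using Fin.cases with
    | zero => exact hZq
    | succ i => exact hZa _
  have h1 := Realizes.oneQuditLayer (G := (Gate.IsQNCModC : Gate p Q C → Prop)) (Z := Z)
    (fun _ _ => trivial) hb (fun _ => fourierU) (fun i => hZa _) hA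
  obtain ⟨T₂, h2, e2⟩ := Realizes.ctrlShift (G := (Gate.IsQNCModC : Gate p Q C → Prop)) (Z := Z)
    (fun _ _ _ _ => trivial) hb he hbe (fun _ v => v) (fun i => hZa _) (fun i => hZa _) hA
  obtain ⟨T₃, h3, e3⟩ := Realizes.ctrlShift (G := (Gate.IsQNCModC : Gate p Q C → Prop)) (Z := Z)
    (s := fun i : Fin k => chain q (fun i => a (i, 0)) i.castSucc)
    (fun _ _ _ _ => trivial) (hβ.comp (Fin.castSucc_injective k)) he (fun i j => hβe _ j)
    (fun _ v => -v) (fun i => hZβ _) (fun i => hZa _) hA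
  refine ⟨_, (h3.comp (h2.comp h1)).of_le (by norm_num), fun ρ hρ c x y => ?_⟩
  rw [Function.comp, Function.comp, e3, e2]
  simp only [fourierU]
  rw [conjBy_fourier_apply_of_clean hb fun c x y h i =>
    ⟨((hρ c x y h).2 _ ⟨_, rfl⟩).1, ((hρ c x y h).2 _ ⟨_, rfl⟩).2⟩, Fintype.card_fin]
  -- `z` is the basis state that the two layers of shifts send to `x`. Its entries on `a (i, 1)`
  -- vanish exactly when those of `x` are the differences.
  have hz : ∀ x : Q → ZMod p, ∃ z : Q → ZMod p,
      (x - ∑ i : Fin k, (Pi.single (a (i, 1)) (-x (chain q (fun i => a (i, 0)) i.castSucc)) : Q → ZMod p)) -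
        ∑ i : Fin k, (Pi.single (a (i, 1))
          ((x - ∑ i : Fin k, (Pi.single (a (i, 1)) (-x (chain q (fun i => a (i, 0)) i.castSucc)) : Q → ZMod p))
            (a (i, 0))) : Q → ZMod p) = z ∧
      (∀ i, z (a (i, 1)) = x (a (i, 1)) -
        (x (a (i, 0)) - x (chain q (fun i => a (i, 0)) i.castSucc))) ∧
      ∀ j, (∀ i, a (i, 1) ≠ j) → z j = x j := by
    intro x
    refine ⟨_, rfl, fun i => ?_, fun j hj => ?_⟩
    · rw [Pi.sub_apply, Pi.sub_apply, sum_single_apply he fun i : Fin k => -x _,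
        sum_single_apply he fun i : Fin k => _, Pi.sub_apply,
        sum_single_apply_of_ne _ fun j => (hbe _ j).symm]
      ring
    · rw [Pi.sub_apply, Pi.sub_apply, sum_single_apply_of_ne _ hj, sum_single_apply_of_ne _ hj]
      ring
  obtain ⟨z, hz, hz1, hz2⟩ := hz x
  obtain ⟨z', hz', hz1', hz2'⟩ := ‹∀ x : Q → ZMod p, _› y
  rw [hz, hz']
  have hext : ∀ x z : Q → ZMod p, (∀ j, (∀ i, a (i, 1) ≠ j) → z j = x j) →
      (∀ i, z (a (i, 1)) = 0) →
      Function.extend (fun i => a (i, (0 : Fin 2))) 0 z = Function.extend a 0 x := by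
    intro x z h h'
    funext j
    by_cases hj : ∃ i, a i = j
    · obtain ⟨⟨i, t⟩, rfl⟩ := hj
      rw [a.injective.extend_apply]
      fin_cases t
      · exact hb.extend_apply 0 z i
      · refine (Function.extend_apply' _ _ _ ?_).trans (h' i)
        rintro ⟨l, hl⟩
        exact hbe _ _ hl
    · rw [Function.extend_apply' _ _ _ hj, Function.extend_apply' _ _ _ fun ⟨i, hi⟩ => hj ⟨_, hi⟩,
        h j fun i hi => hj ⟨_, hi⟩]
  have hze : ∀ (x z : Q → ZMod p), (∀ i, z (a (i, 1)) = x (a (i, 1)) -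
        (x (a (i, 0)) - x (chain q (fun i => a (i, 0)) i.castSucc))) → ∀ i,
      (x (a (i, 1)) = x (a (i, 0)) - x (chain q (fun i => a (i, 0)) i.castSucc) ↔
        z (a (i, 1)) = 0) := fun x z h i => by rw [h, sub_eq_zero]
  by_cases hc : ∀ i, z (a (i, 1)) = 0 ∧ z' (a (i, 1)) = 0
  · rw [if_pos fun i => ⟨(hze x z hz1 i).2 (hc i).1, (hze y z' hz1' i).2 (hc i).2⟩,
      hext x z hz2 fun i => (hc i).1, hext y z' hz2' fun i => (hc i).2]
  · rw [if_neg fun H => hc fun i => ⟨(hze x z hz1 i).1 (H i).1, (hze y z' hz1' i).1 (H i).2⟩]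
    refine mul_eq_zero_of_right _ ?_
    by_contra hne
    refine hc fun i => ?_
    have := (hρ c _ _ hne).2 (a (i, 1)) ⟨_, rfl⟩
    rwa [Function.extend_apply' _ _ _ fun ⟨l, hl⟩ => hbe _ _ hl,
      Function.extend_apply' _ _ _ fun ⟨l, hl⟩ => hbe _ _ hl] at this

theorem extend_zero_congr {α β : Type*} {a : α → β} {x x' : β → ZMod p}
    (h : ∀ j, (∀ i, a i ≠ j) → x j = x' j) :
    Function.extend a (0 : α → ZMod p) x = Function.extend a (0 : α → ZMod p) x' := by
  funext j
  by_cases hj : ∃ i, a i = j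
  · simp [Function.extend, hj]
  · rw [Function.extend_apply' _ _ _ hj, Function.extend_apply' _ _ _ hj,
      h j fun i hi => hj ⟨i, hi⟩]

theorem eq_extend_zero {α β : Type*} {a : α → β} (ha : Function.Injective a) {x z : β → ZMod p}
    (h : ∀ i, z (a i) = 0) (h' : ∀ j, (∀ i, a i ≠ j) → z j = x j) :
    z = Function.extend a (0 : α → ZMod p) x := by
  funext j
  by_cases hj : ∃ i, a i = j
  · obtain ⟨i, rfl⟩ := hj
    rw [h, ha.extend_apply]; rfl
  · rw [Function.extend_apply' _ _ _ hj, h' j fun i hi => hj ⟨i, hi⟩]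

end

/-! ### Copying the value of a qudit by measurement -/

section

variable {p : ℕ} [NeZero p] {Q C : Type} [Fintype Q] [DecidableEq Q] [Fintype C] [DecidableEq C]
variable {k : ℕ}

theorem chain_castSucc_zero (q : Q) (b : Fin k → Q) : chain q b 0 = q := rfl

theorem chain_succ (q : Q) (b : Fin k → Q) (i : Fin k) : chain q b i.succ = b i := rfl

/-- Sums of classical wires into several classical wires. -/
theorem exists_realizes_classical_sums (hp : 1 < p) {ι : Type*} [Fintype ι] [DecidableEq ι]
    (S : ι → Finset C) {w : ι → C} (hw : Function.Injective w) (hwS : ∀ i j, w i ∉ S j)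
    (sc : ι × Fin 2 ↪ C) (hscS : ∀ i j, sc i ∉ S j) (hscw : ∀ i j, sc i ≠ w j) {Z : Zone Q C}
    (hZS : ∀ i, (S i : Set C) ⊆ Z.writes) (hZw : ∀ i, w i ∈ Z.writes) (hZsc : ∀ i, sc i ∈ Z.canc)
    (hB : Disjoint Z.canc Z.writes) :
    ∃ T : CQState p Q C → CQState p Q C, Realizes Gate.IsQNCModC Z (3 * p + 2) T ∧
      ∀ ρ, (∀ c x y, ρ c x y ≠ 0 → ∀ i, c (w i) = 0) → ∀ c x y,
        ((∀ i, c (w i) = ∑ j ∈ S i, c j) → T ρ c x y = ρ (Function.extend w 0 c) x y) ∧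
        (T ρ c x y ≠ 0 → ∀ i, c (w i) = ∑ j ∈ S i, c j) := by
  have h := Realizes.writeFamily (G := (Gate.IsQNCModC : Gate p Q C → Prop)) (Z' := Z)
    (fun i => ⟨∅, S i, {w i}, ∅, Set.range fun j => sc (i, j)⟩) hw
    (f := fun i c => ∑ j ∈ S i, c j) ?_
    (fun i => realizes_classical_sum hp (S i) (hwS i i) (b := fun j => sc (i, j))
      (fun j l h => by simpa using h) (fun j => hscS _ _) fun j => hscw _ _) ?_ ?_
  · refine ⟨_, h, fun ρ hρ c x y => ?_⟩
    rw [pushClassical_apply_of_unique (c₀ := Function.extend w 0 c)]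
    · have hS : ∀ i, ∑ j ∈ S i, Function.extend w 0 c j = ∑ j ∈ S i, c j := fun i =>
        Finset.sum_congr rfl fun j hj => Function.extend_apply' _ _ _ fun ⟨l, hl⟩ =>
          hwS l i (hl ▸ hj)
      constructor
      · intro h
        refine if_pos ?_
        funext j
        by_cases hj : ∃ i, w i = j
        · obtain ⟨i, rfl⟩ := hj
          rw [hw.extend_apply, hS, h]
        · rw [Function.extend_apply' _ _ _ hj, Function.extend_apply' _ _ _ hj]
      · intro h i
        rw [← hS, ← congrFun (ite_ne_right_iff.1 h).1 (w i), hw.extend_apply]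
    · intro c' hc' h
      funext j
      by_cases hj : ∃ i, w i = j
      · obtain ⟨i, rfl⟩ := hj
        rw [hw.extend_apply, hρ _ _ _ hc']; rfl
      · rw [Function.extend_apply' _ _ _ hj, ← h, Function.extend_apply' _ _ _ hj]
  · intro i c c' h
    exact Finset.sum_congr rfl fun j hj => h j fun l hl => hwS l i (hl ▸ hj)
  · intro i
    refine ⟨by simp [Zone.qudits], ?_, ?_, by simp, ?_, by simp, ?_⟩
    · rintro x (hx | hx | ⟨j, rfl⟩)
      · exact Or.inr (Or.inl (hZS i hx))
      · rw [hx]; exact Or.inr (Or.inl (hZw i))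
      · exact Or.inr (Or.inr (hZsc _))
    · rintro x (hx | ⟨j, rfl⟩)
      · rw [hx]; exact Or.inl (hZw i)
      · exact Or.inr (hZsc _)
    · rintro _ ⟨j, rfl⟩; exact hZsc _
    · exact Set.disjoint_singleton_right.2 (Set.disjoint_right.1 hB (hZw i))
  · intro i j hij
    have key : ∀ i j, i ≠ j → Disjoint ({w i} ∪ Set.range fun l => sc (i, l))
        ((S j : Set C) ∪ ({w j} ∪ Set.range fun l => sc (j, l))) := by
      intro i j hij
      rw [Set.disjoint_left]
      rintro x (rfl | ⟨l, rfl⟩) (h | h | ⟨l', h⟩)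
      · exact hwS _ _ h
      · exact hij (hw h)
      · exact hscw _ _ h
      · exact hscS _ _ h
      · exact hscw _ _ h
      · exact hij (congrArg Prod.fst (sc.injective h)).symm
    exact ⟨by simp [Zone.qudits], key i j hij, (key j i hij.symm).symm⟩

/-- The value of `q` is copied to the qudits `a (i, 0)`. -/
theorem exists_realizes_copy (hp : 1 < p) {q : Q} (a : Fin k × Fin 2 ↪ Q) (hq : ∀ i, a i ≠ q)
    (m sc : Fin k × Fin 2 ↪ C) (hm : ∀ i j, sc i ≠ m j)
    {Z : Zone Q C} (hZq : q ∈ Z.ext) (hZa : ∀ i, a i ∈ Z.ext) (hA : Disjoint Z.anc Z.ext)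
    (hZm : ∀ i, m i ∈ Z.writes) (hZsc : ∀ i, sc i ∈ Z.canc) (hB : Disjoint Z.canc Z.writes) :
    ∃ T : CQState p Q C → CQState p Q C, Realizes Gate.IsQNCModC Z (3 * p + 9) T ∧
      ∀ ρ, Clean (Set.range a) (Set.range m) ρ → ∀ c x y, T ρ c x y =
        if ∀ i, c (m i) = 0 then
          if ∀ i, (x (a (i, 0)) = x q ∧ y (a (i, 0)) = y q) ∧ x (a (i, 1)) = 0 ∧ y (a (i, 1)) = 0
          then ρ c (Function.extend a 0 x) (Function.extend a 0 y) else 0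
        else 0 := by
  have hb : Function.Injective fun i => a (i, (0 : Fin 2)) := fun i j h => by simpa using h
  have he : Function.Injective fun i => a (i, (1 : Fin 2)) := fun i j h => by simpa using h
  have hbe : ∀ i j, a (i, (0 : Fin 2)) ≠ a (j, 1) := fun i j h => by simp at h
  have hD : Function.Injective fun i => m (i, (0 : Fin 2)) := fun i j h => by simpa using h
  have hP : Function.Injective fun i => m (i, (1 : Fin 2)) := fun i j h => by simpa using h
  have hDP : ∀ i j, m (i, (0 : Fin 2)) ≠ m (j, 1) := fun i j h => by simp at h
  obtain ⟨T₁, h1, e1⟩ := exists_realizes_differences (p := p) a hq hZq hZa hA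
  -- The differences are measured into `m (i, 0)`; on the support of the state, `a (i, 0)` then
  -- exceeds `q` by the sum of the outcomes up to `i`.
  obtain ⟨T₂, h2, e2⟩ := Realizes.measureReset (G := (Gate.IsQNCModC : Gate p Q C → Prop)) (Z := Z)
    (fun _ _ => trivial) (fun _ _ _ => trivial) he hD (fun _ => hZa _) (fun _ => hZm _) hA hB
  -- All prefix sums are computed in parallel into `m (i, 1)`; they may share inputs because
  -- classical wires can be read by many gates. The next layer subtracts them and makes every `a (i,
  -- 0)` equal to `q`.
  obtain ⟨T₃, h3, e3⟩ := exists_realizes_classical_sums (Q := Q) (Z := Z) hp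
    (fun i : Fin k => (Finset.Iic i).map ⟨fun i => m (i, (0 : Fin 2)), hD⟩) hP
    (fun i j => by simp) sc (fun i j => by
      rw [Finset.mem_map]; rintro ⟨l, -, hl⟩; exact hm i _ hl.symm) (fun i j => hm _ _)
    (fun i => by
      intro j hj
      obtain ⟨l, -, rfl⟩ := Finset.mem_map.1 hj
      exact hZm _) (fun i => hZm _) hZsc hB
  have h4 := Realizes.addClassical (G := (Gate.IsQNCModC : Gate p Q C → Prop)) (Z := Z)
    (fun _ _ _ => trivial) hb (fun i => m (i, 1)) (fun _ v => -v) (fun _ => hZa _)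
    (fun i => Z.outs_subset_ins (Or.inl (hZm _))) hA
  have h5 := Realizes.clear (G := (Gate.IsQNCModC : Gate p Q C → Prop)) (Z := Z)
    (fun _ _ _ _ => trivial) m.injective hZm hB
  refine ⟨_, (h5.comp (h4.comp (h3.comp (h2.comp h1)))).of_le (by omega), fun ρ hρ c x y => ?_⟩
  simp only [Function.comp]
  have c1 : ∀ c x y, T₁ ρ c x y ≠ 0 → ∀ i, c (m i) = 0 := by
    intro c x y h i
    rw [e1 ρ (hρ.mono subset_rfl (by simp))] at h
    exact (hρ _ _ _ (right_ne_zero_of_mul (ite_ne_right_iff.1 h).2)).1 _ ⟨i, rfl⟩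
  have g2 := e2 (T₁ ρ) fun c x y h i => c1 c x y h _
  have c2 : ∀ c x y, T₂ (T₁ ρ) c x y ≠ 0 → ∀ i, c (m (i, 1)) = 0 := by
    intro c x y h i
    rw [(g2 c x y).1 ((g2 c x y).2 h)] at h
    have := c1 _ _ _ h (i, 1)
    rwa [Function.extend_apply' _ _ _ fun ⟨l, hl⟩ => hDP _ _ hl] at this
  have g3 := e3 _ c2
  simp only [Finset.sum_map, Function.Embedding.coeFn_mk] at g3
  have hs : ∀ c : C → ZMod p, Steady fun _ : Q → ZMod p =>
      ∑ k : Fin k, (Pi.single (a (k, 0)) (-c (m (k, 1))) : Q → ZMod p) := fun c _ _ => rfl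
  -- the state before clearing
  have key : ∀ c, conjBy (fun c => addOp fun _ =>
      ∑ k : Fin k, (Pi.single (a (k, 0)) (-c (m (k, 1))) : Q → ZMod p)) (T₃ (T₂ (T₁ ρ))) c x y =
      if (∀ i : Fin k, c (m (i, 1)) = ∑ l ∈ Finset.Iic i, c (m (l, 0))) then
        if ∀ i, (x (a (i, 0)) = x q ∧ y (a (i, 0)) = y q) ∧ x (a (i, 1)) = 0 ∧ y (a (i, 1)) = 0
        then ((p : ℂ)⁻¹) ^ k * ρ (Function.extend m 0 c) (Function.extend a 0 x)
          (Function.extend a 0 y) else 0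
      else 0 := by
    intro c
    rw [conjBy_addOp_apply hs]
    have hz : ∀ x : Q → ZMod p, ∃ z : Q → ZMod p,
        x - ∑ i : Fin k, (Pi.single (a (i, 0)) (-c (m (i, 1))) : Q → ZMod p) = z ∧
        (∀ i, z (a (i, 0)) = x (a (i, 0)) + c (m (i, 1))) ∧
        ∀ j, (∀ i, a (i, 0) ≠ j) → z j = x j := by
      intro x
      refine ⟨_, rfl, fun i => ?_, fun j hj => ?_⟩
      · rw [Pi.sub_apply, sum_single_apply hb fun i : Fin k => -c _]
        ring
      · rw [Pi.sub_apply, sum_single_apply_of_ne _ hj]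
        ring
    obtain ⟨z, hz1, hz2, hz3⟩ := hz x
    obtain ⟨z', hz1', hz2', hz3'⟩ := hz y
    rw [hz1, hz1']
    by_cases h : ∀ i : Fin k, c (m (i, 1)) = ∑ l ∈ Finset.Iic i, c (m (l, 0))
    swap
    · rw [if_neg h]
      by_contra hne
      exact h ((g3 _ _ _).2 hne)
    rw [if_pos h, (g3 _ _ _).1 h]
    by_cases hze : ∀ i, z (a (i, 1)) = 0 ∧ z' (a (i, 1)) = 0
    swap
    · rw [if_neg]
      · by_contra hne
        exact hze ((g2 _ _ _).2 hne)
      · intro H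
        refine hze fun i => ?_
        rw [hz3 _ fun l => hbe _ _, hz3' _ fun l => hbe _ _]
        exact (H i).2
    rw [(g2 _ _ _).1 hze, e1 ρ (hρ.mono subset_rfl (by simp))]
    have hcD : (fun i => Function.extend (fun i => m (i, (1 : Fin 2))) 0 c (m (i, 0))) =
        fun i => c (m (i, 0)) := funext fun i =>
      Function.extend_apply' _ _ _ fun ⟨l, hl⟩ => hDP _ _ hl.symm
    have hcc : Function.extend (fun i => m (i, (0 : Fin 2))) 0
        (Function.extend (fun i => m (i, (1 : Fin 2))) 0 c) = Function.extend m 0 c := by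
      refine eq_extend_zero m.injective ?_ ?_
      · rintro ⟨i, t⟩
        fin_cases t
        · exact hD.extend_apply _ _ _
        · exact (Function.extend_apply' _ _ _ fun ⟨l, hl⟩ => hDP _ _ hl).trans
            (hP.extend_apply _ _ _)
      · intro j hj
        rw [Function.extend_apply' _ _ _ fun ⟨l, hl⟩ => hj _ hl,
          Function.extend_apply' _ _ _ fun ⟨l, hl⟩ => hj _ hl]
    have hxx : ∀ x z : Q → ZMod p, (∀ j, (∀ i, a (i, 0) ≠ j) → z j = x j) →
        Function.extend a 0 (Function.extend (fun i => a (i, (1 : Fin 2)))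
          (fun i => c (m (i, 0))) z) = Function.extend a 0 x := by
      intro x z h
      refine extend_zero_congr fun j hj => ?_
      rw [Function.extend_apply' _ _ _ fun ⟨l, hl⟩ => hj _ hl, h _ fun i => hj _]
    -- By telescoping, the recorded differences fit the state before the correction exactly when
    -- every `a (i, 0)` equals `q` after it.
    have hchain : ∀ x z : Q → ZMod p, (∀ j, (∀ i, a (i, 0) ≠ j) → z j = x j) →
        (∀ i, z (a (i, 0)) = x (a (i, 0)) + c (m (i, 1))) →
        ((∀ i, Function.extend (fun i => a (i, (1 : Fin 2))) (fun i => c (m (i, 0))) z (a (i, 1)) =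
          Function.extend (fun i => a (i, (1 : Fin 2))) (fun i => c (m (i, 0))) z (a (i, 0)) -
          Function.extend (fun i => a (i, (1 : Fin 2))) (fun i => c (m (i, 0))) z
            (chain q (fun i => a (i, 0)) i.castSucc)) ↔ ∀ i, x (a (i, 0)) = x q) := by
      intro x z h3 h2
      have hu : ∀ i : Fin (k + 1), Function.extend (fun i => a (i, (1 : Fin 2)))
          (fun i => c (m (i, 0))) z (chain q (fun i => a (i, 0)) i) =
          z (chain q (fun i => a (i, 0)) i) := by
        intro i
        refine Function.extend_apply' _ _ _ ?_
        cases i using Fin.cases with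
        | zero => exact fun ⟨l, hl⟩ => hq _ hl
        | succ i => exact fun ⟨l, hl⟩ => hbe _ _ hl.symm
      have hu' : ∀ i, Function.extend (fun i => a (i, (1 : Fin 2)))
          (fun i => c (m (i, 0))) z (a (i, 0)) = z (chain q (fun i => a (i, 0)) i.succ) :=
        fun i => hu i.succ
      simp only [hu, hu', he.extend_apply]
      rw [forall_eq_sub_iff_forall_eq_sum fun i => z (chain q (fun i => a (i, 0)) i)]
      refine forall_congr' fun i => ?_
      rw [chain_castSucc_zero, chain_succ, h2, h3 q fun i => hq _, h i, add_left_inj]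
    rw [hcD, hcc, hxx x z hz3, hxx y z' hz3']
    refine if_congr ?_ rfl rfl
    rw [forall_and, hchain x z hz3 hz2, hchain y z' hz3' hz2', ← forall_and]
    refine forall_congr' fun i => ?_
    have := hze i
    rw [hz3 _ fun l => hbe _ _, hz3' _ fun l => hbe _ _] at this
    simp only [this, and_self, and_true]
  -- A record consists of arbitrary differences `D` and their prefix sums. All p^k records lead to
  -- the same state, so clearing them gives the factor p^k that cancels (1/p)^k.
  rw [pushClassical_clear_apply m.injective
    (V := fun (D : Fin k → ZMod p) (i : Fin k × Fin 2) =>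
      if i.2 = 0 then D i.1 else ∑ l ∈ Finset.Iic i.1, D l) (A := fun c =>
        if ∀ i, (x (a (i, 0)) = x q ∧ y (a (i, 0)) = y q) ∧ x (a (i, 1)) = 0 ∧ y (a (i, 1)) = 0
        then ((p : ℂ)⁻¹) ^ k * ρ c (Function.extend a 0 x) (Function.extend a 0 y) else 0)]
  · refine if_congr Iff.rfl ?_ rfl
    rw [mul_ite, mul_zero]
    refine if_congr Iff.rfl ?_ rfl
    rw [← mul_assoc, Fintype.card_fun, ZMod.card, Fintype.card_fin, Nat.cast_pow, ← mul_pow,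
      mul_inv_cancel₀ (by exact_mod_cast (NeZero.ne p)), one_pow, one_mul]
  · intro D D' h
    funext i
    simpa using congrFun h (i, 0)
  · intro c hne
    rw [key] at hne
    refine ⟨fun i => c (m (i, 0)), funext fun ⟨i, t⟩ => ?_⟩
    have := (ite_ne_right_iff.1 hne).1 i
    fin_cases t
    · simp
    · simpa using this
  · intro c D h
    rw [key, if_pos]
    intro i
    have h1 := congrFun h (i, 1)
    have h0 := fun i => congrFun h (i, 0)
    simp only [one_ne_zero, if_false, if_true] at h0 h1
    simp only [h0, h1]

end

/-! ### Erasing copies by measurement in the Fourier basis -/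

section

variable {p : ℕ} [NeZero p] {Q C : Type} [Fintype Q] [DecidableEq Q] [Fintype C] [DecidableEq C]

/-- Each Fourier gate on a copy of `q` contributes the character of (new value of the copy) · (value
of `q`), so the total phase depends on the new values only through their sum. -/
theorem conjBy_fourier_apply_of_copies {ι : Type*} [Fintype ι] [DecidableEq ι] {q : Q} {b : ι → Q}
    (hb : Function.Injective b) (hq : ∀ i, b i ≠ q) {ρ : CQState p Q C}
    (hρ : ∀ c x y, ρ c x y ≠ 0 → ∀ i, x (b i) = x q ∧ y (b i) = y q) (c : C → ZMod p)
    (x y : Q → ZMod p) :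
    conjBy (fun _ => famOp Finset.univ b fun _ _ => fourier) ρ c x y =
      ((p : ℂ)⁻¹) ^ Fintype.card ι * (ZMod.stdAddChar ((∑ i, x (b i)) * x q) *
        ZMod.stdAddChar (-((∑ i, y (b i)) * y q))) *
        ρ c (Function.extend b (fun _ => x q) x) (Function.extend b (fun _ => y q) y) := by
  have hu : ∀ x x' : Q → ZMod p, (∀ i, x' (b i) = x' q) →
      famOp Finset.univ b (fun _ _ => fourier) x x' ≠ 0 →
      x' = Function.extend b (fun _ => x q) x := by
    intro x x' h0 h
    rw [famOp_univ_apply] at h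
    have h' := (ite_ne_right_iff.1 h).1
    funext j
    by_cases hj : ∃ i, b i = j
    · obtain ⟨i, rfl⟩ := hj
      rw [h0, hb.extend_apply, h' q hq]
    · rw [Function.extend_apply' _ _ _ hj, h' j fun i hi => hj ⟨i, hi⟩]
  have hv : ∀ x : Q → ZMod p, famOp Finset.univ b (fun _ _ => fourier) x
      (Function.extend b (fun _ => x q) x) = ((((Real.sqrt p)⁻¹ : ℝ)) : ℂ) ^ Fintype.card ι *
        ZMod.stdAddChar ((∑ i, x (b i)) * x q) := by
    intro x
    rw [famOp_univ_apply, if_pos fun j hj => (Function.extend_apply' _ _ _ (by simpa using hj)).symm]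
    simp only [hb.extend_apply, fourier]
    rw [Finset.prod_mul_distrib, prod_stdAddChar, Finset.sum_mul]
    simp
  rw [conjBy_apply_of_unique (x₀ := Function.extend b (fun _ => x q) x)
    (y₀ := Function.extend b (fun _ => y q) y)
    (fun x' y' h h' => hu x x' (fun i => (hρ c x' y' h i).1) h')
    (fun x' y' h h' => hu y y' (fun i => (hρ c x' y' h i).2) h'), hv, hv, ← sqrt_inv_mul_sqrt_inv,
    mul_pow, star_mul, star_stdAddChar]
  simp only [star_pow, RCLike.star_def, Complex.conj_ofReal]
  ring

theorem extend_extend {α β γ : Type*} {a : α → β} (ha : Function.Injective a) (v w : α → γ)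
    (x : β → γ) : Function.extend a v (Function.extend a w x) = Function.extend a v x := by
  funext j
  by_cases hj : ∃ i, a i = j
  · obtain ⟨i, rfl⟩ := hj
    rw [ha.extend_apply, ha.extend_apply]
  · rw [Function.extend_apply' _ _ _ hj, Function.extend_apply' _ _ _ hj,
      Function.extend_apply' _ _ _ hj]

/-- The copies `b i` of the value of `q` are erased. -/
theorem exists_realizes_uncopy (hp : 1 < p) {ι : Type*} [Fintype ι] [DecidableEq ι] {q : Q}
    {b : ι → Q} (hb : Function.Injective b) (hq : ∀ i, b i ≠ q) (m : Option ι ↪ C)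
    (sc : Unit × Fin 2 ↪ C) (hm : ∀ i j, sc i ≠ m j)
    {Z : Zone Q C} (hZq : q ∈ Z.ext) (hZb : ∀ i, b i ∈ Z.ext) (hA : Disjoint Z.anc Z.ext)
    (hZm : ∀ i, m i ∈ Z.writes) (hZsc : ∀ i, sc i ∈ Z.canc) (hB : Disjoint Z.canc Z.writes) :
    ∃ T : CQState p Q C → CQState p Q C, Realizes Gate.IsQNCModC Z (3 * p + 7) T ∧
      ∀ ρ, (∀ c x y, ρ c x y ≠ 0 → (∀ j, c (m j) = 0) ∧ ∀ i, x (b i) = x q ∧ y (b i) = y q) →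
        ∀ c x y, T ρ c x y = if ∀ j, c (m j) = 0 then
          if ∀ i, x (b i) = 0 ∧ y (b i) = 0
          then ρ c (Function.extend b (fun _ => x q) x) (Function.extend b (fun _ => y q) y) else 0
          else 0 := by
  have hD : Function.Injective fun i => m (some i) := fun i j h => by simpa using h
  have hM : Function.Injective fun _ : Unit => m none := fun _ _ _ => rfl
  have hDM : ∀ i, m (some i) ≠ m none := fun i h => by simp at h
  have h1 := Realizes.oneQuditLayer (G := (Gate.IsQNCModC : Gate p Q C → Prop)) (Z := Z)
    (fun _ _ => trivial) hb (fun _ => fourierU) hZb hA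
  obtain ⟨T₂, h2, e2⟩ := Realizes.measureReset (G := (Gate.IsQNCModC : Gate p Q C → Prop)) (Z := Z)
    (fun _ _ => trivial) (fun _ _ _ => trivial) hb hD hZb (fun _ => hZm _) hA hB
  obtain ⟨T₃, h3, e3⟩ := exists_realizes_classical_sums (Q := Q) (Z := Z) hp
    (fun _ : Unit => (Finset.univ : Finset ι).map ⟨fun i => m (some i), hD⟩) hM
    (fun i j => by simp) sc (fun i j => by
      rw [Finset.mem_map]; rintro ⟨l, -, hl⟩; exact hm i _ hl.symm) (fun i j => hm _ _)
    (fun i => by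
      intro j hj
      obtain ⟨l, -, rfl⟩ := Finset.mem_map.1 hj
      exact hZm _) (fun i => hZm _) hZsc hB
  -- The measured copies leave the phase ω^(v x) on `q`, where v is the sum of the outcomes. This
  -- diagonal gate, chosen by the wire that holds v, removes it.
  have h4 := Realizes.gate (G := (Gate.IsQNCModC : Gate p Q C → Prop)) (Z := Z)
    (.classicalCtrl (m none) q fun v => diagU fun x => ZMod.toCircle (-(v * x))) trivial
    ⟨by simp [Gate.qwires, Zone.qudits, hZq], by
      simpa [Gate.creads] using Z.outs_subset_ins (Or.inl (hZm _)), by simp [Gate.cwrites]⟩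
    (by simpa [Gate.qwires] using Set.disjoint_right.1 hA hZq) (by simp [Gate.cwrites])
  have h5 := Realizes.clear (G := (Gate.IsQNCModC : Gate p Q C → Prop)) (Z := Z)
    (fun _ _ _ _ => trivial) m.injective hZm hB
  refine ⟨_, (h5.comp (h4.comp (h3.comp (h2.comp h1)))).of_le (by omega), fun ρ hρ c x y => ?_⟩
  simp only [Function.comp]
  simp only [fourierU]
  set σ := conjBy (fun _ => famOp Finset.univ b fun _ _ => fourier) ρ with hσ
  have e1 : ∀ c x y, σ c x y = _ := fun c x y =>
    conjBy_fourier_apply_of_copies hb hq (fun c x y h => (hρ c x y h).2) c x y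
  have c1 : ∀ c x y, σ c x y ≠ 0 → ∀ i, c (m i) = 0 := by
    intro c x y h i
    rw [e1] at h
    exact (hρ _ _ _ (right_ne_zero_of_mul h)).1 i
  have g2 := e2 σ fun c x y h i => c1 c x y h _
  have c2 : ∀ c x y, T₂ σ c x y ≠ 0 → ∀ _ : Unit, c (m none) = 0 := by
    intro c x y h _
    rw [(g2 c x y).1 ((g2 c x y).2 h)] at h
    have := c1 _ _ _ h none
    rwa [Function.extend_apply' _ _ _ fun ⟨l, hl⟩ => hDM _ hl] at this
  have g3 := e3 _ c2
  simp only [Finset.sum_map, Function.Embedding.coeFn_mk, forall_const] at g3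
  have key : ∀ c, Gate.apply (.classicalCtrl (m none) q fun v => diagU fun x =>
      ZMod.toCircle (-(v * x))) (T₃ (T₂ σ)) c x y =
      if c (m none) = ∑ i, c (m (some i)) then
        if ∀ i, x (b i) = 0 ∧ y (b i) = 0
        then ((p : ℂ)⁻¹) ^ Fintype.card ι * ρ (Function.extend m (0 : Option ι → ZMod p) c)
          (Function.extend b (fun _ => x q) x) (Function.extend b (fun _ => y q) y) else 0
      else 0 := by
    intro c
    simp only [Gate.apply, diagU, localOp_diagonal]
    rw [conjBy_diagonal_apply fun (c : C → ZMod p) (x : Q → ZMod p) =>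
      ((ZMod.toCircle (-(c (m none) * x q)) : Circle) : ℂ)]
    by_cases h : c (m none) = ∑ i, c (m (some i))
    swap
    · rw [if_neg h]
      refine mul_eq_zero_of_left (mul_eq_zero_of_right _ ?_) _
      by_contra hne
      exact h ((g3 _ _ _).2 hne)
    rw [if_pos h, (g3 _ _ _).1 h]
    by_cases hz : ∀ i, x (b i) = 0 ∧ y (b i) = 0
    swap
    · rw [if_neg hz]
      refine mul_eq_zero_of_left (mul_eq_zero_of_right _ ?_) _
      by_contra hne
      exact hz ((g2 _ _ _).2 hne)
    rw [if_pos hz, (g2 _ _ _).1 hz, e1]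
    have hcD : ∀ i, Function.extend (fun _ : Unit => m none) 0 c (m (some i)) =
        c (m (some i)) := fun i => Function.extend_apply' _ _ _ fun ⟨l, hl⟩ => hDM _ hl.symm
    have hcc : Function.extend (fun i => m (some i)) (0 : ι → ZMod p)
        (Function.extend (fun _ : Unit => m none) 0 c) = Function.extend m (0 : Option ι → ZMod p) c := by
      refine eq_extend_zero m.injective ?_ ?_
      · rintro (_ | i)
        · exact (Function.extend_apply' _ _ _ fun ⟨l, hl⟩ => hDM _ hl).trans
            (hM.extend_apply _ _ ())
        · exact hD.extend_apply _ _ _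
      · intro j hj
        rw [Function.extend_apply' _ _ _ fun ⟨l, hl⟩ => hj _ hl,
          Function.extend_apply' _ _ _ fun ⟨l, hl⟩ => hj _ hl]
    have hxq : ∀ (x : Q → ZMod p) v, Function.extend b v x q = x q := fun x v =>
      Function.extend_apply' _ _ _ fun ⟨l, hl⟩ => hq _ hl
    simp only [hb.extend_apply, hcD, hcc, hxq, extend_extend hb, ← h, ← ZMod.stdAddChar_apply]
    rw [star_stdAddChar, neg_neg]
    have hω : ∀ a : ZMod p, (ZMod.stdAddChar (-a) : ℂ) * ZMod.stdAddChar a = 1 := fun a => by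
      rw [← AddChar.map_add_eq_mul, neg_add_cancel, AddChar.map_zero_eq_one]
    -- The correction and the Fourier phase cancel separately on the row index and, conjugated, on
    -- the column index.
    linear_combination (((p : ℂ)⁻¹) ^ Fintype.card ι * ρ (Function.extend m (0 : Option ι → ZMod p) c)
          (Function.extend b (fun _ => x q) x) (Function.extend b (fun _ => y q) y)) *
      (ZMod.stdAddChar (-(c (m none) * y q)) * ZMod.stdAddChar (c (m none) * y q) *
        hω (c (m none) * x q) + hω (c (m none) * y q))
  -- The records are the outcomes and their sum. After the phase correction they all contribute
  -- equally, and their number p^|ι| cancels the normalization.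
  rw [pushClassical_clear_apply m.injective
    (V := fun (D : ι → ZMod p) (i : Option ι) => i.elim (∑ i, D i) D) (A := fun c =>
        if ∀ i, x (b i) = 0 ∧ y (b i) = 0
        then ((p : ℂ)⁻¹) ^ Fintype.card ι * ρ c
          (Function.extend b (fun _ => x q) x) (Function.extend b (fun _ => y q) y) else 0)]
  · refine if_congr Iff.rfl ?_ rfl
    rw [mul_ite, mul_zero]
    refine if_congr Iff.rfl ?_ rfl
    rw [← mul_assoc, Fintype.card_fun, ZMod.card, Nat.cast_pow, ← mul_pow,
      mul_inv_cancel₀ (by exact_mod_cast (NeZero.ne p)), one_pow, one_mul]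
  · intro D D' h
    funext i
    simpa using congrFun h (some i)
  · intro c hne
    rw [key] at hne
    refine ⟨fun i => c (m (some i)), funext fun i => ?_⟩
    cases i with
    | none => exact (ite_ne_right_iff.1 hne).1
    | some i => rfl
  · intro c D h
    rw [key, if_pos]
    have h1 := congrFun h none
    have h0 := fun i => congrFun h (some i)
    simp only [Option.elim] at h0 h1
    simp only [h0, h1]

end

/-! ### Stars: many gates controlled by one qudit -/

section

variable {p : ℕ} [NeZero p] {Q C : Type} [Fintype Q] [DecidableEq Q] [Fintype C] [DecidableEq C]

theorem exists_of_conjBy_ne_zero {K : (C → ZMod p) → Matrix (Q → ZMod p) (Q → ZMod p) ℂ}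
    {ρ : CQState p Q C} {c : C → ZMod p} {x y : Q → ZMod p} (h : conjBy K ρ c x y ≠ 0) :
    ∃ x' y', K c x x' ≠ 0 ∧ ρ c x' y' ≠ 0 ∧ K c y y' ≠ 0 := by
  rw [conjBy_apply] at h
  obtain ⟨y', -, h⟩ := Finset.exists_ne_zero_of_sum_ne_zero h
  obtain ⟨x', -, h'⟩ := Finset.exists_ne_zero_of_sum_ne_zero (left_ne_zero_of_mul h)
  exact ⟨x', y', left_ne_zero_of_mul h', right_ne_zero_of_mul h',
    fun h0 => right_ne_zero_of_mul h (by rw [h0, star_zero])⟩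

theorem eq_of_famOp_ne_zero {ι : Type*} [Fintype ι] [DecidableEq ι] {r : ι → Q}
    {M : ι → (Q → ZMod p) → Matrix (ZMod p) (ZMod p) ℂ} {y x : Q → ZMod p}
    (h : famOp Finset.univ r M y x ≠ 0) {j : Q} (hj : ∀ i, r i ≠ j) : y j = x j := by
  rw [famOp_univ_apply] at h
  exact (ite_ne_right_iff.1 h).1 j hj

theorem famOp_univ_apply_congr {ι : Type*} [Fintype ι] [DecidableEq ι] {r : ι → Q}
    {M M' : ι → (Q → ZMod p) → Matrix (ZMod p) (ZMod p) ℂ} {y x y' x' : Q → ZMod p}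
    (h : (∀ j, (∀ i, r i ≠ j) → y j = x j) ↔ ∀ j, (∀ i, r i ≠ j) → y' j = x' j)
    (h' : ∀ i, M i x (y (r i)) (x (r i)) = M' i x' (y' (r i)) (x' (r i))) :
    famOp Finset.univ r M y x = famOp Finset.univ r M' y' x' := by
  rw [famOp_univ_apply, famOp_univ_apply]
  exact if_congr h (Finset.prod_congr rfl fun i _ => h' i) rfl

/-- The value of `q` is added to the qudits `b i`. -/
def copies {ι : Type*} [Fintype ι] (q : Q) (b : ι → Q) (x : Q → ZMod p) : Q → ZMod p :=
  ∑ i, Pi.single (b i) (x q)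

section copies

variable {ι : Type*} [Fintype ι] [DecidableEq ι] {q : Q} {b : ι → Q}

theorem copies_apply (hb : Function.Injective b) (x : Q → ZMod p) (i : ι) :
    copies q b x (b i) = x q := sum_single_apply hb (fun _ => x q) i

theorem copies_apply_of_ne (x : Q → ZMod p) {j : Q} (hj : ∀ i, b i ≠ j) : copies q b x j = 0 :=
  sum_single_apply_of_ne _ hj

theorem steady_copies (hq : ∀ i, b i ≠ q) : Steady (copies (p := p) q b) := by
  refine Steady.of_support (Set.range b) (fun x j hj => ?_) fun x x' h => ?_
  · exact sum_single_apply_of_ne _ fun k hk => hj ⟨k, hk⟩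
  · rw [copies, copies, h q fun ⟨i, hi⟩ => hq i hi]

theorem steady_neg_copies (hq : ∀ i, b i ≠ q) : Steady (fun x => - copies (p := p) q b x) := by
  intro x z
  beta_reduce
  rw [← sub_eq_add_neg, (steady_copies hq).sub]

end copies

section

variable {k : ℕ}

/-- On clean targets the measurement-based copying agrees with conjugation by a unitary addition, a
form that can be multiplied with other operators. -/
theorem exists_realizes_add_copies (hp : 1 < p) {q : Q} (a : Fin k × Fin 2 ↪ Q)
    (hq : ∀ i, a i ≠ q) (m sc : Fin k × Fin 2 ↪ C) (hm : ∀ i j, sc i ≠ m j)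
    {Z : Zone Q C} (hZq : q ∈ Z.ext) (hZa : ∀ i, a i ∈ Z.ext) (hA : Disjoint Z.anc Z.ext)
    (hZm : ∀ i, m i ∈ Z.writes) (hZsc : ∀ i, sc i ∈ Z.canc) (hB : Disjoint Z.canc Z.writes) :
    ∃ T : CQState p Q C → CQState p Q C, Realizes Gate.IsQNCModC Z (3 * p + 9) T ∧
      ∀ ρ, Clean (Set.range a) (Set.range m) ρ →
        T ρ = conjBy (fun _ => addOp (copies q fun i => a (i, 0))) ρ := by
  obtain ⟨T, h1, h2⟩ := exists_realizes_copy hp a hq m sc hm hZq hZa hA hZm hZsc hB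
  have hb : Function.Injective fun i => a (i, (0 : Fin 2)) := fun i j h => by simpa using h
  have hbe : ∀ i j, a (i, (0 : Fin 2)) ≠ a (j, 1) := fun i j h => by simp at h
  refine ⟨T, h1, fun ρ hρ => ?_⟩
  funext c x y
  rw [h2 ρ hρ, conjBy_addOp_apply fun _ => steady_copies fun i => hq _]
  have hx : ∀ x : Q → ZMod p, (∀ i, x (a (i, 0)) = x q ∧ x (a (i, 1)) = 0) →
      x - copies q (fun i => a (i, 0)) x = Function.extend a 0 x := by
    intro x h
    refine eq_extend_zero a.injective ?_ ?_
    · rintro ⟨i, t⟩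
      fin_cases t
      · exact (congrArg (x (a (i, 0)) - ·) (copies_apply hb x i)).trans (by simp [h i])
      · exact (congrArg (x (a (i, 1)) - ·) (copies_apply_of_ne x fun l => hbe l i)).trans
          (by simp [h i])
    · intro j hj
      rw [Pi.sub_apply, copies_apply_of_ne x fun i => hj _, sub_zero]
  have hx' : ∀ x : Q → ZMod p, (∀ i, (x - copies q (fun i => a (i, 0)) x) (a i) = 0) →
      (∀ i, x (a (i, 0)) = x q ∧ x (a (i, 1)) = 0) := by
    intro x h i
    have e0 := h (i, 0)
    have e1 := h (i, 1)
    rw [Pi.sub_apply, copies_apply hb x i, sub_eq_zero] at e0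
    rw [Pi.sub_apply, copies_apply_of_ne x fun l => hbe l i, sub_zero] at e1
    exact ⟨e0, e1⟩
  by_cases hne : ρ c (x - copies q (fun i => a (i, 0)) x) (y - copies q (fun i => a (i, 0)) y) = 0
  · rw [hne]
    split_ifs with h3 h4
    · rw [← hx x fun i => ⟨(h4 i).1.1, (h4 i).2.1⟩, ← hx y fun i => ⟨(h4 i).1.2, (h4 i).2.2⟩, hne]
    · rfl
    · rfl
  · have hc := hρ _ _ _ hne
    have h3 := hx' x fun i => (hc.2 _ ⟨i, rfl⟩).1
    have h4 := hx' y fun i => (hc.2 _ ⟨i, rfl⟩).2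
    rw [if_pos fun i => hc.1 _ ⟨i, rfl⟩,
      if_pos fun i => ⟨⟨(h3 i).1, (h4 i).1⟩, (h3 i).2, (h4 i).2⟩, hx x h3, hx y h4]

/-- The counterpart for erasing: on states whose `b i` hold copies of `q`, it agrees with the
subtraction of these copies. -/
theorem exists_realizes_sub_copies (hp : 1 < p) {ι : Type*} [Fintype ι] [DecidableEq ι] {q : Q}
    {b : ι → Q} (hb : Function.Injective b) (hq : ∀ i, b i ≠ q) (m : Option ι ↪ C)
    (sc : Unit × Fin 2 ↪ C) (hm : ∀ i j, sc i ≠ m j)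
    {Z : Zone Q C} (hZq : q ∈ Z.ext) (hZb : ∀ i, b i ∈ Z.ext) (hA : Disjoint Z.anc Z.ext)
    (hZm : ∀ i, m i ∈ Z.writes) (hZsc : ∀ i, sc i ∈ Z.canc) (hB : Disjoint Z.canc Z.writes) :
    ∃ T : CQState p Q C → CQState p Q C, Realizes Gate.IsQNCModC Z (3 * p + 7) T ∧
      ∀ ρ, (∀ c x y, ρ c x y ≠ 0 → (∀ j, c (m j) = 0) ∧ ∀ i, x (b i) = x q ∧ y (b i) = y q) →
        T ρ = conjBy (fun _ => addOp fun x => - copies q b x) ρ := by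
  obtain ⟨T, h1, h2⟩ := exists_realizes_uncopy hp hb hq m sc hm hZq hZb hA hZm hZsc hB
  refine ⟨T, h1, fun ρ hρ => ?_⟩
  funext c x y
  rw [h2 ρ hρ, conjBy_addOp_apply fun _ => steady_neg_copies hq, sub_neg_eq_add, sub_neg_eq_add]
  have hx : ∀ x : Q → ZMod p, (∀ i, x (b i) = 0) →
      x + copies q b x = Function.extend b (fun _ => x q) x := fun x h =>
    extend_eq_add_sum_single hb h _
  have hx' : ∀ x : Q → ZMod p, (∀ i, (x + copies q b x) (b i) = (x + copies q b x) q) →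
      ∀ i, x (b i) = 0 := by
    intro x h i
    have := h i
    rwa [Pi.add_apply, Pi.add_apply, copies_apply hb, copies_apply_of_ne x hq, add_zero,
      add_eq_right] at this
  by_cases hne : ρ c (x + copies q b x) (y + copies q b y) = 0
  · rw [hne]
    split_ifs with h3 h4
    · rw [← hx x fun i => (h4 i).1, ← hx y fun i => (h4 i).2, hne]
    · rfl
    · rfl
  · have hc := hρ _ _ _ hne
    have h3 := hx' x fun i => (hc.2 i).1
    have h4 := hx' y fun i => (hc.2 i).2
    rw [if_pos hc.1, if_pos fun i => ⟨h3 i, h4 i⟩, hx x h3, hx y h4]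

/-- The classical ancillas of a star of controlled gates. -/
abbrev StarWires (K : Type) : Type := (K × Fin 2 ⊕ Option K) ⊕ (K × Fin 2 ⊕ Unit × Fin 2)

/-- A star of controlled gates with a common control qudit `q`. -/
theorem realizes_star_fin (hp : 1 < p) {q : Q} {r : Fin k → Q} (hr : Function.Injective r)
    (hrq : ∀ i, r i ≠ q) (U : Fin k → ZMod p → Matrix.unitaryGroup (ZMod p) ℂ)
    (a : Fin k × Fin 2 ↪ Q) (ha : ∀ i, a i ≠ q) (har : ∀ i j, a i ≠ r j)
    (w : StarWires (Fin k) ↪ C) :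
    Realizes Gate.IsQNCModC ⟨insert q (Set.range r), ∅, ∅, Set.range a, Set.range w⟩ (6 * p + 17)
      (conjBy fun _ => famOp Finset.univ r fun i x =>
        (U i (x q) : Matrix (ZMod p) (ZMod p) ℂ)) := by
  have hb : Function.Injective fun i => a (i, (0 : Fin 2)) := fun i j h => by simpa using h
  let Z : Zone Q C := ⟨insert q (Set.range r ∪ Set.range a), ∅, Set.range fun i => w (.inl i), ∅,
    Set.range fun i => w (.inr i)⟩
  have hB : Disjoint Z.canc Z.writes := by
    rw [Set.disjoint_left]
    rintro _ ⟨i, rfl⟩ ⟨j, hj⟩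
    simp at hj
  obtain ⟨T₁, h1, e1⟩ := exists_realizes_add_copies (Z := Z) hp a ha
    ((Function.Embedding.inl.trans Function.Embedding.inl).trans w)
    ((Function.Embedding.inl.trans Function.Embedding.inr).trans w)
    (fun i j h => by simp at h) (by simp [Z]) (by simp [Z]) (by simp [Z]) (by simp [Z])
    (by simp [Z]) hB
  -- Each copy `a (i, 0)` controls its own target, so all the gates fit in one layer. The whole star
  -- takes (3p + 9) + 1 + (3p + 7) layers.
  have h2 := Realizes.ctrlLayer (G := (Gate.IsQNCModC : Gate p Q C → Prop)) (Z := Z)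
    (fun _ _ _ _ => trivial) hb hr (fun i j => har _ _) U (by simp [Z]) (by simp [Z]) (by simp [Z])
  obtain ⟨T₃, h3, e3⟩ := exists_realizes_sub_copies (Z := Z) hp hb (fun i => ha _)
    ((Function.Embedding.inr.trans Function.Embedding.inl).trans w)
    ((Function.Embedding.inr.trans Function.Embedding.inr).trans w)
    (fun i j h => by simp at h) (by simp [Z]) (by simp [Z]) (by simp [Z]) (by simp [Z])
    (by simp [Z]) hB
  refine (h3.comp (h2.comp h1)).restrict ?_ ?_ ?_ ?_ ?_ ?_ ?_
  · simp [Z, Zone.qudits, Set.insert_union]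
  · simp [Z, Zone.ins, Zone.outs, Set.range_subset_iff]
  · simp [Z, Zone.outs, Set.range_subset_iff]
  · simp [Z]
  · simp [Z, Set.range_subset_iff]
  · omega
  intro ρ hρ
  have ex : T₁ ρ = conjBy (fun _ => addOp (copies q fun i => a (i, 0))) ρ :=
    e1 ρ (hρ.mono subset_rfl (by
      rintro _ ⟨i, rfl⟩; exact ⟨_, rfl⟩))
  refine ⟨?_, hρ.conjBy ?_⟩
  · simp only [Function.comp]
    rw [ex, e3, conjBy_comp, conjBy_comp]
    · refine conjBy_congr_of_clean hρ fun c x y _ hx => ?_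
      rw [Matrix.mul_assoc, addOp_mul_apply (steady_neg_copies fun i => ha _), mul_addOp_apply,
        sub_neg_eq_add]
      have e : ∀ i, (x + copies q (fun i => a (i, 0)) x) (a (i, 0)) = x q := fun i => by
        rw [Pi.add_apply, copies_apply hb x i, hx _ ⟨_, rfl⟩, zero_add]
      have er : ∀ (x : Q → ZMod p) i, (x + copies q (fun i => a (i, 0)) x) (r i) = x (r i) :=
        fun x i => by rw [Pi.add_apply, copies_apply_of_ne x fun j => har _ _, add_zero]
      -- The qudit `q` is not a target, so either condition gives `y q = x q`, and then the added
      -- copies agree.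
      have hcond : (∀ j, (∀ i, r i ≠ j) → (y + copies q (fun i => a (i, 0)) y) j =
          (x + copies q (fun i => a (i, 0)) x) j) ↔ ∀ j, (∀ i, r i ≠ j) → y j = x j := by
        constructor
        · intro h j hj
          have hq := h q hrq
          rw [Pi.add_apply, Pi.add_apply, copies_apply_of_ne _ fun i => ha _,
            copies_apply_of_ne _ fun i => ha _, add_zero, add_zero] at hq
          have := h j hj
          rwa [Pi.add_apply, Pi.add_apply, copies, copies, hq, add_left_inj] at this
        · intro h j hj
          rw [Pi.add_apply, Pi.add_apply, copies, copies, h q hrq, h j hj]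
      refine famOp_univ_apply_congr hcond fun i => ?_
      rw [e, er, er]
    · intro c x y h
      rw [conjBy_comp] at h
      obtain ⟨x', y', hx, hxy, hy⟩ := exists_of_conjBy_ne_zero h
      have hc := hρ _ _ _ hxy
      rw [mul_addOp_apply] at hx hy
      have hz : ∀ x x' : Q → ZMod p, (∀ i, x' (a i) = 0) → (∀ j, (∀ i, r i ≠ j) → x j =
          (x' + copies q (fun i => a (i, 0)) x') j) → ∀ i, x (a (i, 0)) = x q := by
        intro x x' h0 h i
        rw [h q hrq, h _ fun i => (har _ _).symm, Pi.add_apply, Pi.add_apply, copies_apply hb x' i,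
          copies_apply_of_ne x' fun i => ha _, h0, zero_add, add_zero]
      refine ⟨fun j => hc.1 _ ⟨_, rfl⟩, fun i => ⟨?_, ?_⟩⟩
      · exact hz x x' (fun i => (hc.2 _ ⟨i, rfl⟩).1) (fun j => eq_of_famOp_ne_zero hx) i
      · exact hz y y' (fun i => (hc.2 _ ⟨i, rfl⟩).2) (fun j => eq_of_famOp_ne_zero hy) i
  · rintro c x y hx h _ ⟨i, rfl⟩
    rw [eq_of_famOp_ne_zero h fun j => (har _ _).symm]
    exact hx _ ⟨i, rfl⟩

end

theorem famOp_comp_equiv {ι κ : Type*} [Fintype ι] [DecidableEq ι] [Fintype κ] [DecidableEq κ]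
    (e : κ ≃ ι) (r : ι → Q) (M : ι → (Q → ZMod p) → Matrix (ZMod p) (ZMod p) ℂ) :
    famOp Finset.univ (r ∘ e) (fun i => M (e i)) = famOp Finset.univ r M := by
  ext y x
  rw [famOp_univ_apply, famOp_univ_apply]
  refine if_congr (forall_congr' fun j => imp_congr_left ?_) ?_ rfl
  · exact e.forall_congr_left.trans (by simp)
  · exact e.prod_comp fun i => M i x (y (r i)) (x (r i))

/-- A star of controlled gates with a common control qudit `q`. -/
theorem realizes_star (hp : 1 < p) {K : Type} [Fintype K] [DecidableEq K] {q : Q} {r : K → Q}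
    (hr : Function.Injective r) (hrq : ∀ i, r i ≠ q)
    (U : K → ZMod p → Matrix.unitaryGroup (ZMod p) ℂ)
    (a : K × Fin 2 ↪ Q) (ha : ∀ i, a i ≠ q) (har : ∀ i j, a i ≠ r j) (w : StarWires K ↪ C) :
    Realizes Gate.IsQNCModC ⟨insert q (Set.range r), ∅, ∅, Set.range a, Set.range w⟩ (6 * p + 17)
      (conjBy fun _ => famOp Finset.univ r fun i x =>
        (U i (x q) : Matrix (ZMod p) (ZMod p) ℂ)) := by
  let e : Fin (Fintype.card K) ≃ K := (Fintype.equivFin K).symm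
  have h := realizes_star_fin hp (hr.comp e.injective) (fun i => hrq (e i)) (fun i => U (e i))
    ((e.prodCongr (Equiv.refl _)).toEmbedding.trans a) (fun i => ha _) (fun i j => har _ _)
    ((Equiv.sumCongr (Equiv.sumCongr (e.prodCongr (Equiv.refl _)) (Equiv.optionCongr e))
      (Equiv.sumCongr (e.prodCongr (Equiv.refl _)) (Equiv.refl _))).toEmbedding.trans w)
  rw [famOp_comp_equiv e r fun i x => (U i (x q) : Matrix (ZMod p) (ZMod p) ℂ)] at h
  simpa only [Function.Embedding.coe_trans, Equiv.coe_toEmbedding, EquivLike.range_comp] using h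

end

/-! ### Fan-out, modular sums, and phases depending on sums -/

section

variable {p : ℕ} [NeZero p] {Q C : Type} [Fintype Q] [DecidableEq Q] [Fintype C] [DecidableEq C]

/-- Functions of one qudit are added to other qudits. -/
theorem realizes_fanout (hp : 1 < p) {K : Type} [Fintype K] [DecidableEq K] {q : Q} {r : K → Q}
    (hr : Function.Injective r) (hrq : ∀ i, r i ≠ q) (g : K → ZMod p → ZMod p)
    (a : K × Fin 2 ↪ Q) (ha : ∀ i, a i ≠ q) (har : ∀ i j, a i ≠ r j) (w : StarWires K ↪ C) :
    Realizes Gate.IsQNCModC ⟨insert q (Set.range r), ∅, ∅, Set.range a, Set.range w⟩ (6 * p + 19)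
      (conjBy fun _ => addOp fun x => ∑ i, Pi.single (r i) (g i (x q))) := by
  have h := realizes_star hp hr hrq (fun i v => shiftU (g i v)) a ha har w
  have e := famOp_shift hr fun i (x : Q → ZMod p) => g i (x q)
  simp only [shiftU] at h
  rw [e] at h
  exact h.of_le (by omega)

/-- Phases conjugated by Fourier gates are shifts. -/
theorem Realizes.shift_of_phase {Z : Zone Q C} {d : ℕ} {q : Q} {b : (Q → ZMod p) → ZMod p}
    (hb : ∀ x v, b (Function.update x q v) = b x)
    (h : Realizes Gate.IsQNCModC Z d
      (conjBy fun _ => Matrix.diagonal fun x => (ZMod.stdAddChar (b x * x q) : ℂ)))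
    (hq : q ∈ Z.ext) (hA : Disjoint Z.anc Z.ext) :
    Realizes Gate.IsQNCModC Z (d + 2) (conjBy fun _ => localOp q fun x => shift (b x)) := by
  have hqa : Disjoint Z.anc ({q} : Set Q) := hA.mono_right (Set.singleton_subset_iff.2 hq)
  have hg : ∀ U, Realizes (G := (Gate.IsQNCModC : Gate p Q C → Prop)) Z 1
      (Gate.oneQudit q U).apply := fun U => Realizes.gate _ trivial
    ⟨by simp [Gate.qwires, Zone.qudits, hq], by simp [Gate.creads], by simp [Gate.cwrites]⟩
    (by simpa [Gate.qwires] using hqa) (by simp [Gate.cwrites])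
  refine (((hg (star fourierU)).comp (h.comp (hg fourierU))).of_le (d' := d + 2) (by omega)).congr
    fun ρ _ => ?_
  have e' : localOp q (fun _ => ((star fourierU : Matrix.unitaryGroup (ZMod p) ℂ) :
      Matrix (ZMod p) (ZMod p) ℂ)) * ((localOp q fun x : Q → ZMod p => Matrix.diagonal fun v =>
        (ZMod.stdAddChar (b x * v) : ℂ)) * localOp q fun _ =>
          ((fourierU : Matrix.unitaryGroup (ZMod p) ℂ) : Matrix (ZMod p) (ZMod p) ℂ)) =
      localOp q fun x => shift (b x) := by
    rw [localOp_mul_localOp, localOp_mul_localOp]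
    · congr 1
      funext x
      rw [← fourier_conj_diagonal, Matrix.mul_assoc]
      rfl
    · exact fun _ _ => rfl
    · intro x v
      rw [hb]
  rw [localOp_diagonal] at e'
  simp only [Function.comp, Gate.apply, conjBy_comp]
  rw [← e']

/-- Sums of functions of several qudits are added to one qudit. -/
theorem realizes_sum (hp : 1 < p) {K : Type} [Fintype K] [DecidableEq K] {q : Q} {r : K → Q}
    (hr : Function.Injective r) (hrq : ∀ i, r i ≠ q) (g : K → ZMod p → ZMod p)
    (a : K × Fin 2 ↪ Q) (ha : ∀ i, a i ≠ q) (har : ∀ i j, a i ≠ r j) (w : StarWires K ↪ C) :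
    Realizes Gate.IsQNCModC ⟨insert q (Set.range r), ∅, ∅, Set.range a, Set.range w⟩ (6 * p + 19)
      (conjBy fun _ => addOp fun x => Pi.single q (∑ i, g i (x (r i)))) := by
  -- A diagonal controlled gate is symmetric in control and target. The star with control `q`
  -- therefore puts the phase ω^(g(x_i) x_q) on every pair, and their product is the phase of (sum
  -- of the g(x_i)) · x_q, which Fourier gates on `q` turn into an addition.
  have h := realizes_star hp hr hrq
    (fun i v => diagU fun x => ZMod.toCircle (g i x * v)) a ha har w
  simp only [diagU] at h
  rw [famOp_diagonal fun i (x : Q → ZMod p) a => ((ZMod.toCircle (g i a * x q) : Circle) : ℂ)] at h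
  simp only [← ZMod.stdAddChar_apply] at h
  have e : ∀ x : Q → ZMod p, ∏ i, (ZMod.stdAddChar (g i (x (r i)) * x q) : ℂ) =
      ZMod.stdAddChar ((∑ i, g i (x (r i))) * x q) := fun x => by
    rw [prod_stdAddChar, Finset.sum_mul]
  simp only [e] at h
  rw [← localOp_shift]
  refine Realizes.shift_of_phase (fun x v => ?_) h (Or.inl rfl) ?_
  · have : ∀ i, Function.update x q v (r i) = x (r i) := fun i => Function.update_of_ne (hrq i) _ _
    simp only [this]
  · rw [Set.disjoint_left]
    rintro _ ⟨i, rfl⟩ (h | ⟨j, h⟩)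
    · exact ha _ h
    · exact har _ _ h.symm

/-- Parallel additions. -/
theorem Realizes.addFamily {ι : Type*} [Fintype ι] [DecidableEq ι] {G : Gate p Q C → Prop} {d : ℕ}
    (Z : ι → Zone Q C) {Z' : Zone Q C} {f : ι → (Q → ZMod p) → (Q → ZMod p)} (T : Set Q)
    (h₁ : ∀ i x, ∀ j ∉ T, f i x j = 0)
    (h₂ : ∀ i x x', (∀ j ∉ T, x j = x' j) → f i x = f i x')
    (h : ∀ i, Realizes G (Z i) d (conjBy fun _ => addOp (f i))) (hZ : ∀ i, (Z i).Sub Z')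
    (hind : ∀ i j, i ≠ j → (Z i).Indep (Z j)) :
    Realizes G Z' d (conjBy fun _ => addOp fun x => ∑ i, f i x) := by
  refine Realizes.family Finset.univ Z Z' _ (fun s => conjBy fun _ => addOp fun x => ∑ i ∈ s, f i x)
    (fun i _ => h i) (fun i _ => hZ i) (fun i _ j _ => hind i j) (fun ρ => ?_)
    fun i _ t _ hi ρ _ => ?_
  · simp only [Finset.sum_empty]
    rw [addOp_zero, conjBy_one]
  · rw [conjBy_comp]
    simp only [addOp_mul_addOp]
    congr 1
    funext _
    congr 1
    funext x
    rw [Finset.sum_insert hi, add_comm]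
    congr 1
    refine h₂ _ _ _ fun j hj => ?_
    rw [Pi.add_apply, Finset.sum_apply, Finset.sum_eq_zero fun i _ => h₁ i x j hj, add_zero]

/-- Compute, apply a phase, uncompute: the result is the diagonal operator with the phase evaluated
on the computed state. -/
theorem addOp_neg_mul_diagonal_mul_addOp {f : (Q → ZMod p) → (Q → ZMod p)} (hf : Steady f)
    (d : (Q → ZMod p) → ℂ) :
    addOp (fun x => - f x) * (Matrix.diagonal d * addOp f) =
      Matrix.diagonal fun x => d (x + f x) := by
  have hf' : Steady fun x => - f x := fun x z => by
    beta_reduce; rw [← sub_eq_add_neg, hf.sub]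
  ext y x
  rw [addOp_mul_apply hf', mul_addOp_apply, sub_neg_eq_add, Matrix.diagonal_apply,
    Matrix.diagonal_apply]
  by_cases h : y = x
  · rw [h, if_pos rfl, if_pos rfl]
  · rw [if_neg h, if_neg]
    intro H
    have := hf.eq_add_iff.1 H
    rw [hf y y, add_sub_cancel_right] at this
    exact h this.symm

theorem disjoint_range_of_ne {α β γ : Type*} {f : α → γ} {g : β → γ} (h : ∀ i j, f i ≠ g j) :
    Disjoint (Set.range f) (Set.range g) := by
  rw [Set.disjoint_left]
  rintro _ ⟨i, rfl⟩ ⟨j, hj⟩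
  exact h i j hj.symm

theorem Zone.indep_of_disjoint {E E' A A' : Set Q} {B B' : Set C}
    (h : Disjoint (E ∪ A) (E' ∪ A')) (hB : Disjoint B B') :
    Zone.Indep (⟨E, ∅, ∅, A, B⟩ : Zone Q C) ⟨E', ∅, ∅, A', B'⟩ :=
  ⟨h, by simpa [Zone.ins, Zone.outs] using hB, by simpa [Zone.ins, Zone.outs] using hB⟩

theorem Zone.sub_of_subset {E E' A A' : Set Q} {R R' W W' B B' : Set C} (hE : E ⊆ E' ∪ A')
    (hA : A ⊆ A') (hR : R ⊆ R') (hW : W ⊆ W') (hB : B ⊆ B') (hd : Disjoint A' E)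
    (hd' : Disjoint B' W) : Zone.Sub (⟨E, R, W, A, B⟩ : Zone Q C) ⟨E', R', W', A', B'⟩ :=
  ⟨Set.union_subset hE (hA.trans Set.subset_union_right),
    Set.union_subset_union hR (Set.union_subset_union hW hB), Set.union_subset_union hW hB, hA, hB,
    hd, hd'⟩

/-- The auxiliary qudits of a phase gate with inputs `I` and intermediate values `O`. -/
abbrev PhaseWires (I O : Type) : Type := ((O × I) ⊕ O) ⊕ ((I × (O × Fin 2)) ⊕ (O × (I × Fin 2)))

/-- The auxiliary classical wires of a phase gate. -/
abbrev PhaseClassicalWires (I O : Type) : Type := (I × StarWires O) ⊕ (O × StarWires I)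

section phases

variable {I O R : Type} [Fintype I] [DecidableEq I] [Fintype O] [DecidableEq O] [Fintype R]
  [DecidableEq R]

/-- The zone of the working wires of a phase gate. -/
def phaseZone (inp : I ↪ Q) (a : PhaseWires I O ↪ Q) (w : PhaseClassicalWires I O ↪ C) :
    Zone Q C :=
  ⟨Set.range inp ∪ Set.range fun i => a (.inl i), ∅, ∅, Set.range fun i => a (.inr i), Set.range w⟩

/-- One star for each input, with targets and ancillas of its own, so all inputs are fanned out in
parallel. -/
theorem realizes_fanouts (hp : 1 < p) (inp : I ↪ Q) (a : PhaseWires I O ↪ Q)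
    (ha : ∀ i j, a i ≠ inp j) (w : PhaseClassicalWires I O ↪ C) (g : ZMod p → ZMod p) :
    Realizes Gate.IsQNCModC (phaseZone inp a w) (6 * p + 19) (conjBy fun _ => addOp fun x =>
      ∑ i, ∑ o, Pi.single (a (.inl (.inl (o, i)))) (g (x (inp i)))) := by
  refine Realizes.addFamily (fun i => ⟨insert (inp i) (Set.range fun o => a (.inl (.inl (o, i)))),
    ∅, ∅, Set.range fun l => a (.inr (.inl (i, l))), Set.range fun l => w (.inl (i, l))⟩)
    (Set.range fun l => a (.inl (.inl l)))
    (f := fun i x => ∑ o, Pi.single (a (.inl (.inl (o, i)))) (g (x (inp i)))) ?_ ?_ (fun i => ?_) ?_ ?_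
  · exact fun i x j hj => sum_single_apply_of_ne _ fun o ho => hj ⟨_, ho⟩
  · intro i x x' h
    rw [h (inp i) fun ⟨l, hl⟩ => ha _ _ hl]
  · exact realizes_fanout (r := fun o => a (.inl (.inl (o, i)))) hp (fun o o' h => by simpa using h)
      (fun o => ha _ _) (fun _ v => g v)
      ⟨fun l => a (.inr (.inl (i, l))), fun l l' h => by simpa using h⟩ (fun l => ha _ _)
      (fun l o => a.injective.ne Sum.inr_ne_inl) ⟨fun l => w (.inl (i, l)), fun l l' h => by simpa using h⟩
  · intro i
    refine Zone.sub_of_subset ?_ ?_ subset_rfl subset_rfl ?_ ?_ (by simp)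
    · rintro _ (rfl | ⟨o, rfl⟩)
      · exact Or.inl (Or.inl ⟨i, rfl⟩)
      · exact Or.inl (Or.inr ⟨_, rfl⟩)
    · rintro _ ⟨l, rfl⟩; exact ⟨_, rfl⟩
    · rintro _ ⟨l, rfl⟩; exact ⟨_, rfl⟩
    · rw [Set.disjoint_left]
      rintro _ ⟨l, rfl⟩ (h | ⟨o, h⟩)
      · exact ha _ _ h
      · simp at h
  · intro i j hij
    refine Zone.indep_of_disjoint ?_ (disjoint_range_of_ne fun l l' h =>
      hij (congrArg Prod.fst (Sum.inl_injective (w.injective h))))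
    rw [Set.disjoint_left]
    rintro _ ((rfl | ⟨o, rfl⟩) | ⟨l, rfl⟩) ((h | ⟨o', h⟩) | ⟨l', h⟩)
    · exact hij (inp.injective h)
    · exact ha _ _ h
    · exact ha _ _ h
    · exact ha _ _ h
    · exact hij (congrArg Prod.snd (Sum.inl_injective (Sum.inl_injective (a.injective h)))).symm
    · simp at h
    · exact ha _ _ h
    · simp at h
    · exact hij (congrArg Prod.fst (Sum.inl_injective (Sum.inr_injective (a.injective h)))).symm

/-- Each sum `o` has a private copy of every input, so the stars of different sums are disjoint and
all sums are formed in parallel. -/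
theorem realizes_sums (hp : 1 < p) (inp : I ↪ Q) (a : PhaseWires I O ↪ Q) (w : PhaseClassicalWires I O ↪ C) (L : O → I → ZMod p → ZMod p) :
    Realizes Gate.IsQNCModC (phaseZone inp a w) (6 * p + 19) (conjBy fun _ => addOp fun x =>
      ∑ o, Pi.single (a (.inl (.inr o))) (∑ i, L o i (x (a (.inl (.inl (o, i))))))) := by
  refine Realizes.addFamily (fun o => ⟨insert (a (.inl (.inr o)))
      (Set.range fun i => a (.inl (.inl (o, i)))),
    ∅, ∅, Set.range fun l => a (.inr (.inr (o, l))), Set.range fun l => w (.inr (o, l))⟩)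
    (Set.range fun l => a (.inl (.inr l)))
    (f := fun o x => Pi.single (a (.inl (.inr o))) (∑ i, L o i (x (a (.inl (.inl (o, i))))))) ?_ ?_
    (fun i => ?_) ?_ ?_
  · exact fun i x j hj => Pi.single_eq_of_ne (fun h => hj ⟨_, h.symm⟩) _
  · intro o x x' h
    congr 1
    refine Finset.sum_congr rfl fun i _ => ?_
    rw [h (a (.inl (.inl (o, i)))) fun ⟨l, hl⟩ => by simp at hl]
  · exact realizes_sum (r := fun i' => a (.inl (.inl (i, i')))) hp (fun o o' h => by simpa using h)
      (fun o => a.injective.ne (Sum.inl_injective.ne Sum.inl_ne_inr)) (L i)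
      ⟨fun l => a (.inr (.inr (i, l))), fun l l' h => by simpa using h⟩
      (fun l => a.injective.ne Sum.inr_ne_inl)
      (fun l o => a.injective.ne Sum.inr_ne_inl) ⟨fun l => w (.inr (i, l)), fun l l' h => by simpa using h⟩
  · intro i
    refine Zone.sub_of_subset ?_ ?_ subset_rfl subset_rfl ?_ ?_ (by simp)
    · rintro _ (rfl | ⟨o, rfl⟩)
      · exact Or.inl (Or.inr ⟨_, rfl⟩)
      · exact Or.inl (Or.inr ⟨_, rfl⟩)
    · rintro _ ⟨l, rfl⟩; exact ⟨_, rfl⟩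
    · rintro _ ⟨l, rfl⟩; exact ⟨_, rfl⟩
    · rw [Set.disjoint_left]
      rintro _ ⟨l, rfl⟩ (h | ⟨o, h⟩) <;> simp at h
  · intro i j hij
    refine Zone.indep_of_disjoint ?_ (disjoint_range_of_ne fun l l' h =>
      hij (congrArg Prod.fst (Sum.inr_injective (w.injective h))))
    rw [Set.disjoint_left]
    rintro _ ((rfl | ⟨o, rfl⟩) | ⟨l, rfl⟩) ((h | ⟨o', h⟩) | ⟨l', h⟩)
    · exact hij (by simpa using h)
    · simp at h
    · simp at h
    · simp at h
    · exact hij (congrArg Prod.fst (Sum.inl_injective (Sum.inl_injective (a.injective h)))).symm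
    · simp at h
    · simp at h
    · simp at h
    · exact hij (congrArg Prod.fst (Sum.inr_injective (Sum.inr_injective (a.injective h)))).symm

/-- Phases that depend on pairs of sums of functions of the inputs. -/
theorem realizes_phases (hp : 1 < p) (inp : I ↪ Q) (L : R ⊕ R → I → ZMod p → ZMod p)
    (g : R → ZMod p → ZMod p → Circle) (a : PhaseWires I (R ⊕ R) ↪ Q)
    (ha : ∀ i j, a i ≠ inp j) (w : PhaseClassicalWires I (R ⊕ R) ↪ C) :
    Realizes Gate.IsQNCModC ⟨Set.range inp, ∅, ∅, Set.range a, Set.range w⟩ (24 * p + 77)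
      (conjBy fun _ => Matrix.diagonal fun x => ∏ r, (g r (∑ i, L (.inl r) i (x (inp i)))
        (∑ i, L (.inr r) i (x (inp i))) : ℂ)) := by
  -- `f₁` makes one copy of each input for each sum, and `f₂` forms the sums from these copies. Both
  -- are undone by the same circuits with negated functions.
  let f₁ : (Q → ZMod p) → (Q → ZMod p) := fun x =>
    ∑ i, ∑ o, Pi.single (a (.inl (.inl (o, i)))) (x (inp i))
  let f₂ : (Q → ZMod p) → (Q → ZMod p) := fun x =>
    ∑ o, Pi.single (a (.inl (.inr o))) (∑ i, L o i (x (a (.inl (.inl (o, i))))))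
  have s₁ : Steady f₁ := by
    refine Steady.of_support (Set.range fun l => a (.inl (.inl l))) (fun x j hj => ?_)
      fun x x' h => ?_
    · simp only [f₁, Finset.sum_apply]
      refine Finset.sum_eq_zero fun i _ => Finset.sum_eq_zero fun o _ => ?_
      exact Pi.single_eq_of_ne (fun h => hj ⟨_, h.symm⟩) _
    · simp only [f₁]
      refine Finset.sum_congr rfl fun i _ => ?_
      rw [h (inp i) fun ⟨l, hl⟩ => ha _ _ hl]
  have s₂ : Steady f₂ := by
    refine Steady.of_support (Set.range fun l => a (.inl (.inr l))) (fun x j hj => ?_)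
      fun x x' h => ?_
    · exact sum_single_apply_of_ne _ fun o ho => hj ⟨_, ho⟩
    · simp only [f₂]
      refine Finset.sum_congr rfl fun o _ => ?_
      congr 1
      refine Finset.sum_congr rfl fun i _ => ?_
      rw [h (a (.inl (.inl (o, i)))) fun ⟨l, hl⟩ => by simp at hl]
  have hd : Disjoint (phaseZone inp a w).anc (phaseZone inp a w).ext :=
    Set.disjoint_union_right.2 ⟨disjoint_range_of_ne fun _ _ => ha _ _,
      disjoint_range_of_ne fun i j h => by simp at h⟩
  have h1 := realizes_fanouts hp inp a ha w id
  have h2 := realizes_sums hp inp a w L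
  have h4 := realizes_sums hp inp a w fun o i v => - L o i v
  have h5 := realizes_fanouts hp inp a ha w fun v => - v
  -- For each `r` the phase is one controlled diagonal gate between its two private sums, so this is
  -- a single layer.
  have h3 := Realizes.ctrlLayer (G := (Gate.IsQNCModC : Gate p Q C → Prop))
    (Z := phaseZone inp a w) (s := fun r : R => a (.inl (.inr (.inl r))))
    (r := fun r : R => a (.inl (.inr (.inr r))))
    (fun _ _ _ _ => trivial) (fun o o' h => by simpa using h) (fun o o' h => by simpa using h)
    (fun o o' h => by simp at h) (fun r v => diagU fun v' => g r v v')
    (fun _ => Or.inr ⟨_, rfl⟩) (fun _ => Or.inr ⟨_, rfl⟩) hd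
  have e5 : (fun x : Q → ZMod p => ∑ i, ∑ o, Pi.single (a (.inl (.inl (o, i)))) (-(x (inp i)))) =
      fun x => - f₁ x := by
    funext x
    simp only [f₁, Pi.single_neg, Finset.sum_neg_distrib]
  have e4 : (fun x : Q → ZMod p => ∑ o, (Pi.single (a (.inl (.inr o)))
      (∑ i, -L o i (x (a (.inl (.inl (o, i)))))) : Q → ZMod p)) = fun x => - f₂ x := by
    funext x
    simp only [f₂, Pi.single_neg, Finset.sum_neg_distrib]
  rw [e5] at h5
  rw [e4] at h4
  simp only [diagU] at h3
  rw [famOp_diagonal fun r (x : Q → ZMod p) v' =>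
    (g r (x (a (.inl (.inr (.inl r))))) v' : ℂ)] at h3
  refine (h5.comp (h4.comp (h3.comp (h2.comp h1)))).restrict ?_ ?_ ?_ ?_ ?_ ?_ ?_
  · simp [phaseZone, Zone.qudits, Set.range_subset_iff]
  · simp [phaseZone, Zone.ins, Zone.outs]
  · simp [phaseZone, Zone.outs]
  · simp [phaseZone, Set.range_subset_iff]
  · simp [phaseZone]
  · omega
  intro ρ hρ
  refine ⟨?_, hρ.conjBy ?_⟩
  · simp only [Function.comp, conjBy_comp]
    refine conjBy_congr_of_clean hρ fun c x y _ hx => ?_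
    change (addOp (fun x => - f₁ x) * (addOp (fun x => - f₂ x) * (Matrix.diagonal _ *
      (addOp f₂ * addOp f₁))) : Matrix (Q → ZMod p) (Q → ZMod p) ℂ) y x = _
    rw [← Matrix.mul_assoc (Matrix.diagonal _), ← Matrix.mul_assoc (addOp fun x => - f₂ x),
      addOp_neg_mul_diagonal_mul_addOp s₂, addOp_neg_mul_diagonal_mul_addOp s₁,
      Matrix.diagonal_apply, Matrix.diagonal_apply]
    by_cases hyx : y = x
    swap
    · rw [if_neg hyx, if_neg hyx]
    subst hyx
    rw [if_pos rfl, if_pos rfl]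
    have e1 : ∀ o i, (y + f₁ y) (a (.inl (.inl (o, i)))) = y (inp i) := by
      intro o i
      rw [Pi.add_apply, hx _ ⟨_, rfl⟩, zero_add]
      simp only [f₁, Finset.sum_apply]
      rw [Finset.sum_eq_single i, Finset.sum_eq_single o, Pi.single_eq_same]
      · intro o' _ ho
        exact Pi.single_eq_of_ne (fun h => ho (by simpa using h.symm)) _
      · simp
      · intro i' _ hi
        exact Finset.sum_eq_zero fun o' _ =>
          Pi.single_eq_of_ne (fun h => hi (by simpa using (And.right (by simpa using h) : i = i').symm)) _
      · simp
    have e2 : ∀ o, (y + f₁ y + f₂ (y + f₁ y)) (a (.inl (.inr o))) =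
        ∑ i, L o i (y (inp i)) := by
      intro o
      have h0 : f₁ y (a (.inl (.inr o))) = 0 := by
        simp only [f₁, Finset.sum_apply]
        exact Finset.sum_eq_zero fun i _ => Finset.sum_eq_zero fun o _ =>
          Pi.single_eq_of_ne (fun h => by simp at h) _
      rw [Pi.add_apply, Pi.add_apply, h0, hx _ ⟨_, rfl⟩, zero_add, zero_add]
      refine (sum_single_apply (r := fun o => a (.inl (.inr o))) (fun o o' h => by simpa using h)
        (fun o => ∑ i, L o i ((y + f₁ y) (a (.inl (.inl (o, i)))))) o).trans ?_
      simp only [e1]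
    simp only [e2]
  · intro c x y hx h
    rw [Matrix.diagonal_apply] at h
    rw [(ite_ne_right_iff.1 h).1]
    exact hx

end phases

end

section

variable {p : ℕ} [NeZero p] {Q C : Type} [Fintype Q] [DecidableEq Q] [Fintype C] [DecidableEq C]

/-! ### Counting by phases -/

/-- The phase `exp (2π i x)`. -/
def turn (x : ℝ) : Circle := Circle.exp (2 * Real.pi * x)

theorem turn_add (x y : ℝ) : turn (x + y) = turn x * turn y := by
  rw [turn, turn, turn, mul_add, Circle.exp_add]

theorem turn_zero : turn 0 = 1 := by rw [turn, mul_zero, Circle.exp_zero]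

theorem turn_neg (x : ℝ) : turn (-x) = (turn x)⁻¹ := by
  rw [turn, turn, mul_neg, Circle.exp_neg]

theorem turn_sum {ι : Type*} (s : Finset ι) (f : ι → ℝ) : turn (∑ i ∈ s, f i) = ∏ i ∈ s, turn (f i) := by
  classical
  induction s using Finset.induction_on with
  | empty => simp [turn_zero]
  | insert i s hi ih => rw [Finset.sum_insert hi, Finset.prod_insert hi, turn_add, ih]

theorem turn_val_div (a : ZMod p) : turn ((a.val : ℝ) / p) = ZMod.toCircle a := by
  ext
  rw [ZMod.toCircle_apply, turn, Circle.coe_exp]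
  congr 1
  push_cast
  ring

theorem turn_int_div (n : ℤ) : turn ((n : ℝ) / p) = ZMod.toCircle (n : ZMod p) := by
  ext
  rw [ZMod.toCircle_intCast, turn, Circle.coe_exp]
  congr 1
  push_cast
  ring

/-- The phases on the `a`-th digit that compare a number with `0`. -/
def digitPhase (p a : ℕ) (n : ℤ) (b : ZMod p) : Circle := turn (b.val * n / (p : ℝ) ^ (a + 1))

theorem digitPhase_add (a : ℕ) (n m : ℤ) (b : ZMod p) :
    digitPhase p a (n + m) b = digitPhase p a n b * digitPhase p a m b := by
  rw [digitPhase, digitPhase, digitPhase, ← turn_add]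
  congr 1
  push_cast
  ring

theorem digitPhase_neg (a : ℕ) (n : ℤ) (b : ZMod p) :
    digitPhase p a (-n) b = (digitPhase p a n b)⁻¹ := by
  rw [digitPhase, digitPhase, ← turn_neg]
  congr 1
  push_cast
  ring

theorem digitPhase_zero (a : ℕ) (b : ZMod p) : digitPhase p a 0 b = 1 := by
  rw [digitPhase, ← turn_zero]
  simp

theorem digitPhase_sum {ι : Type*} (a : ℕ) (s : Finset ι) (f : ι → ℤ) (b : ZMod p) :
    digitPhase p a (∑ i ∈ s, f i) b = ∏ i ∈ s, digitPhase p a (f i) b := by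
  classical
  induction s using Finset.induction_on with
  | empty => simp [digitPhase_zero]
  | insert i s hi ih => rw [Finset.sum_insert hi, Finset.prod_insert hi, digitPhase_add, ih]

theorem digitPhase_pow_mul (a : ℕ) (m : ℤ) (b : ZMod p) :
    digitPhase p a ((p : ℤ) ^ a * m) b = ZMod.toCircle (b * (m : ZMod p)) := by
  have : digitPhase p a ((p : ℤ) ^ a * m) b = turn ((((b.val : ℤ) * m : ℤ) : ℝ) / p) := by
    rw [digitPhase]
    congr 1
    have : (p : ℝ) ≠ 0 := by exact_mod_cast NeZero.ne p
    push_cast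
    field_simp
    ring
  rw [this, turn_int_div]
  congr 1
  simp

/-- The one-qudit gate that tests the `a`-th digit. -/
def digitTest (p : ℕ) [NeZero p] (a : ℕ) (n : ℤ) : Matrix (ZMod p) (ZMod p) ℂ :=
  fourier.conjTranspose * Matrix.diagonal (fun b => (digitPhase p a n b : ℂ)) * fourier

/-- For a multiple of p^a the digit phase is a character of `ZMod p`, so the test is an honest
shift. For other numbers the tested qudit may end in a superposition. -/
theorem digitTest_pow_mul (a : ℕ) (m : ℤ) :
    digitTest p a ((p : ℤ) ^ a * m) = shift (m : ZMod p) := by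
  rw [digitTest, ← fourier_conj_diagonal]
  congr 3
  funext b
  rw [digitPhase_pow_mul, mul_comm]
  rfl

theorem digitTest_zero (a : ℕ) : digitTest p a 0 = 1 := by
  have := digitTest_pow_mul (p := p) a 0
  rwa [mul_zero, Int.cast_zero, shift_zero] at this

theorem fourier_mul_conjTranspose_self : fourier * (fourier (p := p)).conjTranspose = 1 :=
  mul_eq_one_comm.1 fourier_conjTranspose_mul_self

theorem digitTest_neg_mul (a : ℕ) (n : ℤ) : digitTest p a (-n) * digitTest p a n = 1 := by
  have h : Matrix.diagonal (fun b => (digitPhase p a (-n) b : ℂ)) *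
      Matrix.diagonal (fun b => (digitPhase p a n b : ℂ)) = 1 := by
    rw [Matrix.diagonal_mul_diagonal, ← Matrix.diagonal_one]
    congr 1
    funext b
    rw [digitPhase_neg, ← Circle.coe_mul, inv_mul_cancel, Circle.coe_one]
  rw [digitTest, digitTest]
  calc _ = fourier.conjTranspose * Matrix.diagonal (fun b => (digitPhase p a (-n) b : ℂ)) *
        (fourier * fourier.conjTranspose) * Matrix.diagonal (fun b => (digitPhase p a n b : ℂ)) *
        fourier := by simp only [Matrix.mul_assoc]
    _ = fourier.conjTranspose * (Matrix.diagonal (fun b => (digitPhase p a (-n) b : ℂ)) *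
        Matrix.diagonal (fun b => (digitPhase p a n b : ℂ))) * fourier := by
      rw [fourier_mul_conjTranspose_self, Matrix.mul_one]
      simp only [Matrix.mul_assoc]
    _ = 1 := by rw [h, Matrix.mul_one, fourier_conjTranspose_mul_self]

/-- The largest power of p that divides n is at most |n|, so its exponent is below A. -/
theorem exists_pow_dvd_not_pow_succ_dvd (hp : 1 < p) {A : ℕ} {n : ℤ} (hn : n ≠ 0)
    (hA : |n| < (p : ℤ) ^ A) : ∃ a < A, ∃ m : ℤ, n = (p : ℤ) ^ a * m ∧ (m : ZMod p) ≠ 0 := by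
  obtain ⟨a, m, hm, h⟩ := Nat.exists_eq_pow_mul_and_not_dvd (Int.natAbs_ne_zero.2 hn) p (by omega)
  have hm' : ((m : ℤ) : ZMod p) ≠ 0 := by
    rw [Int.cast_natCast]
    exact fun h0 => hm ((ZMod.natCast_eq_zero_iff _ _).1 h0)
  have haA : a < A := by
    by_contra hle
    have h1 : p ^ A ≤ p ^ a := Nat.pow_le_pow_right (by omega) (by omega)
    have h2 : 0 < m := Nat.pos_of_ne_zero fun h0 => hm (h0 ▸ dvd_zero p)
    have h3 : n.natAbs < p ^ A := by
      rw [Int.abs_eq_natAbs] at hA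
      exact_mod_cast hA
    have h4 : p ^ a ≤ p ^ a * m := Nat.le_mul_of_pos_right _ h2
    omega
  refine ⟨a, haA, ?_⟩
  rcases Int.natAbs_eq n with h' | h'
  · exact ⟨m, by rw [h', h]; push_cast; ring, hm'⟩
  · exact ⟨-m, by rw [h', h]; push_cast; ring, by rwa [Int.cast_neg, neg_ne_zero]⟩

/-- If all the digit tests may yield `y`, then `y` is zero if and only if the number is. -/
theorem forall_eq_zero_iff_of_digitTest (hp : 1 < p) {A : ℕ} {n : ℤ} (hA : |n| < (p : ℤ) ^ A)
    {y : Fin A → ZMod p} (h : ∀ a : Fin A, digitTest p a n (y a) 0 ≠ 0) : (∀ a, y a = 0) ↔ n = 0 := by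
  constructor
  · intro hy
    by_contra hn
    -- The digit at the exact power of p is shifted from 0 by `m ≠ 0` with certainty, so its
    -- amplitude at 0 vanishes.
    obtain ⟨a, ha, m, rfl, hm⟩ := exists_pow_dvd_not_pow_succ_dvd hp hn hA
    refine h ⟨a, ha⟩ ?_
    rw [hy, digitTest_pow_mul, shift, if_neg]
    rw [zero_add]
    exact hm.symm
  · rintro rfl a
    by_contra hy
    refine h a ?_
    rw [digitTest_zero, Matrix.one_apply_ne hy]

/-! ### A phase that detects zero -/

/-- Orthogonality of characters, factored over the digits. Real parts are taken so that the terms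
can serve as exponents of phases. -/
theorem sum_cos_eq {A : ℕ} (y : Fin A → ZMod p) :
    ∑ s : Fin A → ZMod p, (ZMod.stdAddChar (∑ a, s a * y a) : ℂ).re =
      if ∀ a, y a = 0 then (p : ℝ) ^ A else 0 := by
  have h : ∑ s : Fin A → ZMod p, (ZMod.stdAddChar (∑ a, s a * y a) : ℂ) =
      if ∀ a, y a = 0 then (p : ℂ) ^ A else 0 := by
    simp only [← prod_stdAddChar]
    rw [← Fintype.piFinset_univ, ← Finset.prod_univ_sum (fun _ => Finset.univ)
      fun a v => (ZMod.stdAddChar (v * y a) : ℂ)]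
    simp only [sum_stdAddChar_mul]
    split_ifs with h
    · simp [h]
    · push Not at h
      obtain ⟨a, ha⟩ := h
      exact Finset.prod_eq_zero (Finset.mem_univ a) (if_neg ha)
  rw [← Complex.re_sum, h]
  split_ifs
  · rw [← Complex.ofReal_natCast, ← Complex.ofReal_pow, Complex.ofReal_re]
  · rfl

/-- The phase on the pairs of `τ` and a linear combination of the digits. -/
def zeroPhase (p : ℕ) [NeZero p] (A : ℕ) (g τ u : ZMod p) : Circle :=
  turn ((g * τ).val / p * ((ZMod.stdAddChar u : ℂ).re / (p : ℝ) ^ A))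

/-- The numbers Re ω^(s·y) / p^A sum to the indicator of y = 0. Used as exponents, they split a
phase conditioned on all digits into phases that involve only τ and one linear form s·y each. -/
theorem prod_zeroPhase {A : ℕ} (g τ : ZMod p) (y : Fin A → ZMod p) :
    ∏ s : Fin A → ZMod p, zeroPhase p A g τ (∑ a, s a * y a) =
      if ∀ a, y a = 0 then ZMod.toCircle (g * τ) else 1 := by
  simp only [zeroPhase]
  rw [← turn_sum, ← Finset.mul_sum, ← Finset.sum_div, sum_cos_eq]
  split_ifs
  · have : (p : ℝ) ^ A ≠ 0 := pow_ne_zero _ (by exact_mod_cast NeZero.ne p)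
    rw [div_self this, mul_one, turn_val_div]
  · rw [zero_div, mul_zero, turn_zero]

end

/-! ### Adding a function of a count -/

section

variable {p : ℕ} [NeZero p] {Q C : Type} [Fintype Q] [DecidableEq Q] [Fintype C] [DecidableEq C]

theorem circle_coe_prod {ι : Type*} (s : Finset ι) (f : ι → Circle) :
    ((∏ i ∈ s, f i : Circle) : ℂ) = ∏ i ∈ s, (f i : ℂ) :=
  map_prod Circle.coeHom f s

/-- Phases that depend on pairs of inputs. -/
theorem realizes_pair_phases (hp : 1 < p) {I R : Type} [Fintype I] [DecidableEq I] [Fintype R]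
    [DecidableEq R] (inp : I ↪ Q) (α β : R → I) (g : R → ZMod p → ZMod p → Circle)
    (a : PhaseWires I (R ⊕ R) ↪ Q) (ha : ∀ i j, a i ≠ inp j)
    (w : PhaseClassicalWires I (R ⊕ R) ↪ C) :
    Realizes Gate.IsQNCModC ⟨Set.range inp, ∅, ∅, Set.range a, Set.range w⟩ (24 * p + 77)
      (conjBy fun _ => Matrix.diagonal fun x =>
        ∏ r, (g r (x (inp (α r))) (x (inp (β r))) : ℂ)) := by
  have e : ∀ (x : Q → ZMod p) (k : I), ∑ i, (if i = k then x (inp i) else 0) = x (inp k) :=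
    fun x k => by rw [Finset.sum_ite_eq' Finset.univ k fun i => x (inp i), if_pos (Finset.mem_univ k)]
  have h := realizes_phases (C := C) hp inp
    (fun (o : R ⊕ R) i v => if i = Sum.elim α β o then v else 0) g a ha w
  have key : (fun x : Q → ZMod p => ∏ r, (g r (x (inp (α r))) (x (inp (β r))) : ℂ)) =
      fun x => ∏ r, (g r (∑ i, if i = Sum.elim α β (.inl r) then x (inp i) else 0)
        (∑ i, if i = Sum.elim α β (.inr r) then x (inp i) else 0) : ℂ) := by
    funext x
    exact Finset.prod_congr rfl fun r _ => by rw [e, e]; rfl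
  rw [key]
  exact h

/-- The auxiliary qudits for functions of a sum over `ι`, with `A` digits and `J` values. -/
abbrev CountWires (p : ℕ) [NeZero p] (ι : Type) (A J : ℕ) : Type :=
  (Fin A × Fin J) ⊕
    (PhaseWires (ι ⊕ (Fin A × Fin J)) ((ι × (Fin A × Fin J)) ⊕ (ι × (Fin A × Fin J))) ⊕
      PhaseWires (Option (Fin A × Fin J))
        ((Fin J × (Fin A → ZMod p)) ⊕ (Fin J × (Fin A → ZMod p))))

/-- The auxiliary classical wires for functions of a sum. -/
abbrev CountClassicalWires (p : ℕ) [NeZero p] (ι : Type) (A J : ℕ) : Type :=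
  PhaseClassicalWires (ι ⊕ (Fin A × Fin J)) ((ι × (Fin A × Fin J)) ⊕ (ι × (Fin A × Fin J))) ⊕
    PhaseClassicalWires (Option (Fin A × Fin J))
      ((Fin J × (Fin A → ZMod p)) ⊕ (Fin J × (Fin A → ZMod p)))

/-- The inputs of a symmetric function, its target, and the number of digits and of values. -/
structure CountData (p : ℕ) [NeZero p] (Q : Type) (ι : Type) [Fintype ι] where
  /-- The target. -/
  t : Q
  /-- The inputs. -/
  r : ι ↪ Q
  /-- The target is not an input. -/
  ne : ∀ i, r i ≠ t
  /-- The summands. -/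
  φ : ι → ZMod p → ℕ
  /-- The number of digits. -/
  A : ℕ
  /-- The number of values. -/
  J : ℕ
  /-- The counts are bounded. -/
  lt : ∀ v : ι → ZMod p, ∑ i, φ i (v i) < J
  /-- There are sufficiently many digits. -/
  le : J ≤ p ^ A

namespace CountData

variable {ι : Type} [Fintype ι] [DecidableEq ι] (D : CountData p Q ι)

/-- The digits for all values. -/
abbrev H : Type := Fin D.A × Fin D.J

/-- The auxiliary qudits. -/
abbrev Wires : Type := CountWires p ι D.A D.J

/-- The auxiliary classical wires. -/
abbrev ClassicalWires : Type := CountClassicalWires p ι D.A D.J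

/-- The value of the sum. -/
def count (x : Q → ZMod p) : ℕ := ∑ i, D.φ i (x (D.r i))

theorem count_lt (x : Q → ZMod p) : D.count x < D.J := D.lt fun i => x (D.r i)

variable (a : D.Wires ↪ Q) (w : D.ClassicalWires ↪ C)

/-- The zone of the working wires. -/
def zone : Zone Q C :=
  ⟨insert D.t (Set.range D.r) ∪ Set.range fun h => a (.inl h), ∅, ∅,
    Set.range fun i => a (.inr i), Set.range w⟩

/-- The comparison of the count with all values. -/
def compare (ε : ℤ) : Matrix (Q → ZMod p) (Q → ZMod p) ℂ :=
  famOp Finset.univ (fun h => a (.inl h)) fun h x =>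
    digitTest p h.1 (ε * ((D.count x : ℤ) - (h.2 : ℕ)))

variable {a} (hr : ∀ i j, a i ≠ D.r j) (ht : ∀ i, a i ≠ D.t)

include hr in
theorem count_congr {x x' : Q → ZMod p} (h : ∀ j, (∀ k, a (.inl k) ≠ j) → x j = x' j) :
    D.count x = D.count x' :=
  Finset.sum_congr rfl fun i _ => by rw [h _ fun k => hr _ _]

include hr ht in
-- Digit phases are additive in the count, so they split into phases on pairs of one input and one
-- digit qudit, between Fourier gates. The constant -j is absorbed into the last layer of one-qudit
-- gates.
theorem realizes_compare (hp : 1 < p) (ε : ℤ) :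
    Realizes Gate.IsQNCModC (D.zone a w) (24 * p + 79) (conjBy fun _ => D.compare a ε) := by
  have hinj : Function.Injective fun h => a (.inl h) := a.injective.comp Sum.inl_injective
  have hd : Disjoint (D.zone a w).anc (D.zone a w).ext := by
    rw [Set.disjoint_left]
    rintro _ ⟨l, rfl⟩ ((h | ⟨i, h⟩) | ⟨i, h⟩)
    · exact ht _ h
    · exact hr _ _ h.symm
    · simp at h
  have h1 := Realizes.oneQuditLayer (G := (Gate.IsQNCModC : Gate p Q C → Prop)) (Z := D.zone a w)
    (fun _ _ => trivial) hinj (fun _ => fourierU) (fun h => Or.inr ⟨h, rfl⟩) hd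
  have h2 := realizes_pair_phases (Q := Q) (C := C) hp
    (⟨Sum.elim D.r fun h => a (.inl h), D.r.injective.sumElim hinj fun i h => (hr _ _).symm⟩ :
      ι ⊕ D.H ↪ Q) (fun r : ι × D.H => .inl r.1) (fun r => .inr r.2)
    (fun r v b => digitPhase p r.2.1 (ε * D.φ r.1 v) b)
    ((Function.Embedding.inl.trans Function.Embedding.inr).trans a)
    (by rintro l (i | h)
        · exact hr _ _
        · exact a.injective.ne Sum.inr_ne_inl) (Function.Embedding.inl.trans w)
  have h3 := Realizes.oneQuditLayer (G := (Gate.IsQNCModC : Gate p Q C → Prop)) (Z := D.zone a w)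
    (fun _ _ => trivial) hinj
    (fun h => star fourierU * diagU (digitPhase p h.1 (ε * -(h.2 : ℕ))))
    (fun h => Or.inr ⟨h, rfl⟩) hd
  have h2' := h2.mono (Z' := D.zone a w) (d' := 24 * p + 77) (by
    refine Zone.sub_of_subset ?_ ?_ subset_rfl subset_rfl ?_ ?_ (by simp)
    · rintro _ ⟨i | h, rfl⟩
      · exact Or.inl (Or.inl (Or.inr ⟨i, rfl⟩))
      · exact Or.inl (Or.inr ⟨h, rfl⟩)
    · rintro _ ⟨l, rfl⟩; exact ⟨_, rfl⟩
    · rintro _ ⟨l, rfl⟩; exact ⟨_, rfl⟩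
    · refine disjoint_range_of_ne ?_
      rintro l (i | h)
      · exact hr _ _
      · exact a.injective.ne Sum.inr_ne_inl) le_rfl
  refine ((h3.comp (h2'.comp h1)).of_le (d' := 24 * p + 79) (by omega)).congr fun ρ _ => ?_
  simp only [Function.comp, conjBy_comp]
  congr 1
  funext _
  have e2 : (Matrix.diagonal fun x : Q → ZMod p => ∏ r : ι × D.H,
      (digitPhase p r.2.1 (ε * D.φ r.1 (x (D.r r.1))) (x (a (.inl r.2))) : ℂ)) =
      famOp Finset.univ (fun h => a (.inl h)) fun h x => Matrix.diagonal fun b =>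
        (digitPhase p h.1 (ε * D.count x) b : ℂ) := by
    rw [famOp_diagonal fun (h : D.H) (x : Q → ZMod p) b => (digitPhase p h.1 (ε * D.count x) b : ℂ)]
    congr 1
    funext x
    rw [Fintype.prod_prod_type, Finset.prod_comm]
    refine Finset.prod_congr rfl fun h _ => ?_
    have : ε * (D.count x : ℤ) = ∑ i, ε * (D.φ i (x (D.r i)) : ℤ) := by
      rw [count, Nat.cast_sum, Finset.mul_sum]
    rw [this, digitPhase_sum, circle_coe_prod]
  refine (congrArg (fun M => _ * (M * _)) e2).trans ?_
  rw [famOp_mul_famOp hinj fun k x x' h => by rw [D.count_congr hr h],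
    famOp_mul_famOp hinj fun _ _ _ _ => rfl, compare]
  congr 1
  funext h x
  have e3 : Matrix.diagonal (fun b => (digitPhase p h.1 (ε * -(h.2 : ℕ)) b : ℂ)) *
      Matrix.diagonal (fun b => (digitPhase p h.1 (ε * D.count x) b : ℂ)) =
      Matrix.diagonal fun b => (digitPhase p h.1 (ε * ((D.count x : ℤ) - (h.2 : ℕ))) b : ℂ) := by
    rw [Matrix.diagonal_mul_diagonal]
    congr 1
    funext b
    rw [← Circle.coe_mul, ← digitPhase_add]
    congr 2
    ring
  rw [digitTest, ← e3]
  change fourier.conjTranspose * _ * _ = _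
  simp only [Matrix.mul_assoc]
  rfl

include hr ht in
theorem realizes_zero_phases (hp : 1 < p) (g : ℕ → ZMod p) :
    Realizes Gate.IsQNCModC (D.zone a w) (24 * p + 77) (conjBy fun _ => Matrix.diagonal fun x =>
      ((∏ j : Fin D.J, if ∀ k, x (a (.inl (k, j))) = 0 then ZMod.toCircle (g j * x D.t) else 1 :
        Circle) : ℂ)) := by
  have hinj : Function.Injective fun h => a (.inl h) := a.injective.comp Sum.inl_injective
  have h2 := realizes_phases (Q := Q) (C := C) hp
    (⟨fun o => o.elim D.t fun h => a (.inl h), by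
      rintro (_ | h) (_ | h') hh
      · rfl
      · exact absurd hh.symm (ht _)
      · exact absurd hh (ht _)
      · exact congrArg some (hinj hh)⟩ : Option D.H ↪ Q)
    (R := Fin D.J × (Fin D.A → ZMod p))
    -- The first sum of a pair is the target itself; the second is the linear form `s` of the digits
    -- that belong to the value `j`.
    (fun o i v => o.elim (fun _ => i.elim v fun _ => 0)
      fun r => i.elim 0 fun h => if h.2 = r.1 then r.2 h.1 * v else 0)
    (fun r τ u => zeroPhase p D.A (g r.1) τ u)
    ((Function.Embedding.inr.trans Function.Embedding.inr).trans a)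
    (by rintro l (_ | h)
        · exact ht _
        · exact a.injective.ne Sum.inr_ne_inl) (Function.Embedding.inr.trans w)
  have h2' := h2.mono (Z' := D.zone a w) (d' := 24 * p + 77) (by
    refine Zone.sub_of_subset ?_ ?_ subset_rfl subset_rfl ?_ ?_ (by simp)
    · rintro _ ⟨_ | h, rfl⟩
      · exact Or.inl (Or.inl (Or.inl rfl))
      · exact Or.inl (Or.inr ⟨h, rfl⟩)
    · rintro _ ⟨l, rfl⟩; exact ⟨_, rfl⟩
    · rintro _ ⟨l, rfl⟩; exact ⟨_, rfl⟩
    · refine disjoint_range_of_ne ?_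
      rintro l (_ | h)
      · exact ht _
      · exact a.injective.ne Sum.inr_ne_inl) le_rfl
  convert h2' using 3 with _
  congr 1
  funext x
  rw [← circle_coe_prod, Fintype.prod_prod_type]
  congr 1
  refine Finset.prod_congr rfl fun j _ => ?_
  rw [← prod_zeroPhase]
  refine Finset.prod_congr rfl fun s _ => ?_
  have e₁ : ∑ i : Option D.H, (i.elim (x D.t) fun _ => 0) = x D.t := by
    rw [Fintype.sum_option]
    simp
  have e₂ : ∑ i : Option D.H, (i.elim 0 fun h => if h.2 = j then s h.1 * x (a (.inl h)) else 0) =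
      ∑ k, s k * x (a (.inl (k, j))) := by
    rw [Fintype.sum_option, Fintype.sum_prod_type]
    simp
  refine congrArg₂ (zeroPhase p D.A (g j)) (e₁.symm.trans ?_) (e₂.symm.trans ?_)
  · refine Finset.sum_congr rfl fun i _ => ?_
    cases i <;> rfl
  · refine Finset.sum_congr rfl fun i _ => ?_
    cases i <;> rfl

include hr ht in
-- Compare, phase, uncompare. The comparison may create superpositions of digits, but on every
-- branch the digits of `j` all vanish exactly when the count is `j`. The phase is therefore
-- constant over the branches and factors out, so the inverse comparison restores the clean digits.
theorem realizes_phase (hp : 1 < p) (g : ℕ → ZMod p) :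
    Realizes Gate.IsQNCModC ⟨insert D.t (Set.range D.r), ∅, ∅, Set.range a, Set.range w⟩
      (72 * p + 235) (conjBy fun _ => Matrix.diagonal fun x =>
        (ZMod.stdAddChar (g (D.count x) * x D.t) : ℂ)) := by
  have hinj : Function.Injective fun h => a (.inl h) := a.injective.comp Sum.inl_injective
  refine ((D.realizes_compare w hr ht hp (-1)).comp ((D.realizes_zero_phases w hr ht hp g).comp
    (D.realizes_compare w hr ht hp 1))).restrict ?_ ?_ ?_ ?_ ?_ ?_ ?_
  · simp only [zone, Zone.qudits]
    rintro x ((hx | ⟨h, rfl⟩) | ⟨h, rfl⟩)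
    · exact Or.inl hx
    · exact Or.inr ⟨_, rfl⟩
    · exact Or.inr ⟨_, rfl⟩
  · simp [zone, Zone.ins, Zone.outs]
  · simp [zone, Zone.outs]
  · rintro _ ⟨h, rfl⟩; exact ⟨_, rfl⟩
  · simp [zone]
  · omega
  intro ρ hρ
  refine ⟨?_, hρ.conjBy ?_⟩
  swap
  · intro c x y hx h
    rw [Matrix.diagonal_apply] at h
    rw [(ite_ne_right_iff.1 h).1]
    exact hx
  simp only [Function.comp, conjBy_comp]
  refine conjBy_congr_of_clean hρ fun c x y _ hx => ?_
  have hone : D.compare a (-1) * D.compare a 1 = 1 := by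
    rw [compare, compare, famOp_mul_famOp hinj fun k x x' h => by rw [D.count_congr hr h],
      ← famOp_one (r := fun h => a (.inl h))]
    congr 1
    funext h x
    rw [one_mul, neg_one_mul, digitTest_neg_mul]
  -- `z` ranges over the branches of nonzero amplitude. In the product over `j` only the factor at
  -- the count survives; the digit bound holds because both the count and `j` are below J ≤ p^A.
  have hval : ∀ z : Q → ZMod p, D.compare a 1 z x ≠ 0 →
      (∏ j : Fin D.J, if ∀ k, z (a (.inl (k, j))) = 0 then ZMod.toCircle (g j * z D.t) else 1) =
        ZMod.toCircle (g (D.count x) * x D.t) := by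
    intro z hz
    have ez := fun j => eq_of_famOp_ne_zero (j := j) hz
    rw [compare, famOp_univ_apply] at hz
    have hz' := Finset.prod_ne_zero_iff.1 (ite_ne_right_iff.1 hz).2
    have hiff : ∀ j : Fin D.J, (∀ k, z (a (.inl (k, j))) = 0) ↔ D.count x = j := by
      intro j
      have hlt := D.count_lt x
      have hle : (D.J : ℤ) ≤ (p : ℤ) ^ D.A := by exact_mod_cast D.le
      rw [forall_eq_zero_iff_of_digitTest hp (n := (D.count x : ℤ) - (j : ℕ)) (A := D.A)]
      · omega
      · rw [abs_lt]
        have := j.2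
        constructor <;> omega
      · intro k
        have := hz' (k, j) (Finset.mem_univ _)
        rwa [hx _ ⟨_, rfl⟩, one_mul] at this
    rw [Finset.prod_eq_single (⟨D.count x, D.count_lt x⟩ : Fin D.J), if_pos ((hiff _).2 rfl),
      ez D.t fun k => ht _]
    · intro j _ hj
      rw [if_neg]
      exact fun h => hj (Fin.ext ((hiff j).1 h).symm)
    · simp
  rw [Matrix.mul_apply]
  have : ∀ z, D.compare a (-1) y z * (Matrix.diagonal (fun x : Q → ZMod p =>
      ((∏ j : Fin D.J, if ∀ k, x (a (.inl (k, j))) = 0 then ZMod.toCircle (g j * x D.t) else 1 :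
        Circle) : ℂ)) * D.compare a 1) z x =
      (ZMod.stdAddChar (g (D.count x) * x D.t) : ℂ) * (D.compare a (-1) y z * D.compare a 1 z x) := by
    intro z
    rw [Matrix.diagonal_mul]
    by_cases hz : D.compare a 1 z x = 0
    · rw [hz]; ring
    · rw [hval z hz, ZMod.stdAddChar_apply]; ring
  rw [Finset.sum_congr rfl fun z _ => this z, ← Finset.mul_sum, ← Matrix.mul_apply, hone,
    Matrix.one_apply, Matrix.diagonal_apply]
  by_cases h : y = x
  · rw [if_pos h, if_pos h, mul_one, h]
  · rw [if_neg h, if_neg h, mul_zero]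

include hr ht in
/-- A function of the sum of functions of the inputs is added to the target. -/
theorem realizes_shift (hp : 1 < p) (g : ℕ → ZMod p) :
    Realizes Gate.IsQNCModC ⟨insert D.t (Set.range D.r), ∅, ∅, Set.range a, Set.range w⟩
      (72 * p + 237) (conjBy fun _ => localOp D.t fun x => shift (g (D.count x))) := by
  refine Realizes.shift_of_phase (b := fun x => g (D.count x)) (fun x v => ?_)
    (D.realizes_phase w hr ht hp g) (Or.inl rfl) ?_
  · have : D.count (Function.update x D.t v) = D.count x :=
      Finset.sum_congr rfl fun i _ => by rw [Function.update_of_ne (D.ne i)]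
    rw [this]
  · rw [Set.disjoint_left]
    rintro _ ⟨i, rfl⟩ (h | ⟨j, h⟩)
    · exact ht _ h
    · exact hr _ _ h.symm

end CountData

end

/-! ### Threshold and generalized Toffoli gates -/

section

variable {p : ℕ} [NeZero p] {Q C : Type} [Fintype Q] [DecidableEq Q] [Fintype C] [DecidableEq C]

/-- Quantum threshold gates by gates of `i-QNC_p[p]_c`. -/
theorem realizes_qThreshold (hp : 1 < p) (k : ℕ) (S : Finset Q) (t : Q) (ht : t ∉ S) {A J : ℕ}
    (hS : p * S.card < J) (hJ : J ≤ p ^ A) (a : CountWires p S A J ↪ Q)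
    (ha : ∀ i, a i ∉ insert t S) (w : CountClassicalWires p S A J ↪ C) :
    Realizes Gate.IsQNCModC ⟨insert t S, ∅, ∅, Set.range a, Set.range w⟩ (72 * p + 237)
      (Gate.qThreshold k S t ht : Gate p Q C).apply := by
  let D : CountData p Q S :=
    { t := t
      r := Function.Embedding.subtype _
      ne := fun i h => ht (by rw [← h]; exact i.2)
      φ := fun _ v => v.val
      A := A
      J := J
      lt := fun v => lt_of_le_of_lt (Finset.sum_le_card_nsmul _ _ p fun i _ => (ZMod.val_lt _).le)
        (by simpa [mul_comm] using hS)
      le := hJ }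
  have h := D.realizes_shift (a := a) w (fun i j h => ha i (by rw [h]; exact Finset.mem_insert_of_mem j.2))
    (fun i h => ha i (by rw [h]; exact Finset.mem_insert_self _ _)) hp fun n => if k ≤ n then 1 else 0
  have e : ∀ x : Q → ZMod p, (if k ≤ D.count x then (1 : ZMod p) else 0) = threshold k S x := by
    intro x
    rw [threshold, ← Finset.sum_coe_sort S fun i => (x i).val]
    rfl
  simp only [e] at h
  refine h.mono (Zone.sub_of_subset ?_ subset_rfl subset_rfl subset_rfl subset_rfl ?_ (by simp)) le_rfl
  · rintro _ (rfl | ⟨i, rfl⟩)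
    · exact Or.inl (Or.inl rfl)
    · exact Or.inl (Or.inr i.2)
  · rw [Set.disjoint_left]
    rintro _ ⟨l, rfl⟩ (h | ⟨i, h⟩)
    · exact ha l (by rw [h]; exact Finset.mem_insert_self _ _)
    · exact ha l (by rw [← h]; exact Finset.mem_insert_of_mem i.2)

/-- Generalized Toffoli gates by gates of `i-QNC_p[p]_c`. -/
theorem realizes_multiCtrl (hp : 1 < p) (S : Finset Q) (v : Q → ZMod p) (t : Q) (ht : t ∉ S)
    (U : Matrix.unitaryGroup (ZMod p) ℂ) {A J : ℕ}
    (hS : S.card < J) (hJ : J ≤ p ^ A) (a : Option (CountWires p S A J) ↪ Q)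
    (ha : ∀ i, a i ∉ insert t S) (w : CountClassicalWires p S A J ↪ C) :
    Realizes Gate.IsQNCModC ⟨insert t S, ∅, ∅, Set.range a, Set.range w⟩ (144 * p + 475)
      (Gate.multiCtrl S v t ht U : Gate p Q C).apply := by
  have : Fact (1 < p) := ⟨hp⟩
  have haS : ∀ i, a i ∉ S := fun i h => ha i (Finset.mem_insert_of_mem h)
  have hat : ∀ i, a i ≠ t := fun i h => ha i (by rw [h]; exact Finset.mem_insert_self _ _)
  -- The count is the number of controls in their prescribed states, and the flag qudit `a none` is
  -- the target.
  let D : CountData p Q S :=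
    { t := a none
      r := Function.Embedding.subtype _
      ne := fun i h => haS none (by rw [← h]; exact i.2)
      φ := fun i z => if z = v i then 1 else 0
      A := A
      J := J
      lt := fun z => lt_of_le_of_lt (Finset.sum_le_card_nsmul _ _ 1 fun i _ => by
        split_ifs <;> omega) (by simpa using hS)
      le := hJ }
  let Z : Zone Q C := ⟨insert (a none) (insert t S), ∅, ∅, Set.range fun i => a (some i), Set.range w⟩
  have h : ∀ g, Realizes Gate.IsQNCModC Z (72 * p + 237) _ := fun g =>
    (D.realizes_shift (a := Function.Embedding.some.trans a) w
      (fun i j h => haS (some i) (h.symm ▸ j.2)) (fun i => a.injective.ne (by simp)) hp g).mono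
      (Z' := Z) (d' := 72 * p + 237) (by
        refine Zone.sub_of_subset ?_ subset_rfl subset_rfl subset_rfl subset_rfl ?_ (by simp)
        · rintro _ (rfl | ⟨i, rfl⟩)
          · exact Or.inl (Or.inl rfl)
          · exact Or.inl (Or.inr (Or.inr i.2))
        · rw [Set.disjoint_left]
          rintro _ ⟨l, rfl⟩ (h | ⟨i, h⟩)
          · exact Option.some_ne_none _ (a.injective h)
          · exact haS (some l) (by
              have h' : D.r i = a (some l) := h
              rw [← h']; exact i.2)) le_rfl
  have h2 := Realizes.gate (G := (Gate.IsQNCModC : Gate p Q C → Prop)) (Z := Z)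
    (.ctrl (a none) t (hat none) fun z => if z = 1 then U else 1) trivial
    ⟨by simp [Gate.qwires, Zone.qudits, Z, Set.insert_subset_iff], by simp [Gate.creads],
      by simp [Gate.cwrites]⟩
    (by
      rw [Set.disjoint_left]
      rintro _ ⟨i, rfl⟩ hi
      rcases Finset.mem_insert.1 (Finset.mem_coe.1 hi) with hi | hi
      · exact Option.some_ne_none _ (a.injective hi)
      · exact hat _ (Finset.mem_singleton.1 hi)) (by simp [Gate.cwrites])
  -- The flag is 1 exactly when all |S| controls match. It controls `U` on `t` and is then
  -- uncomputed by the shift with `-g`, which is possible because `t` is not among the counted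
  -- qudits.
  let g : ℕ → ZMod p := fun n => if n = S.card then 1 else 0
  have hcount : ∀ x : Q → ZMod p, D.count x = S.card ↔ ∀ i ∈ S, x i = v i := by
    intro x
    have : D.count x = (S.filter fun i => x i = v i).card := by
      rw [Finset.card_filter, ← Finset.sum_coe_sort S fun i => if x i = v i then 1 else 0]
      rfl
    rw [this, Finset.card_filter_eq_iff]
  refine ((h fun n => - g n).comp (h2.comp (h g))).restrict ?_ ?_ ?_ ?_ ?_ (by omega) ?_
  · rintro x ((rfl | hx) | ⟨i, rfl⟩)
    · exact Or.inr ⟨_, rfl⟩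
    · exact Or.inl hx
    · exact Or.inr ⟨_, rfl⟩
  · simp [Z, Zone.ins, Zone.outs]
  · simp [Z, Zone.outs]
  · rintro _ ⟨i, rfl⟩; exact ⟨_, rfl⟩
  · simp [Z]
  intro ρ hρ
  refine ⟨?_, hρ.conjBy ?_⟩
  swap
  · rintro c x y hx h _ ⟨i, rfl⟩
    rw [(ite_ne_right_iff.1 h).1 _ (hat _)]
    exact hx _ ⟨i, rfl⟩
  simp only [Function.comp, Gate.apply, conjBy_comp]
  refine conjBy_congr_of_clean hρ fun c x y _ hx => ?_
  let f : (Q → ZMod p) → (Q → ZMod p) := fun x => Pi.single (a none) (g (D.count x))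
  have hcongr : ∀ x x' : Q → ZMod p, (∀ i ∈ S, x i = x' i) → f x = f x' := by
    intro x x' h
    have : D.count x = D.count x' := Finset.sum_congr rfl fun i _ => by
      rw [show x (D.r i) = x' (D.r i) from h _ i.2]
    simp only [f, this]
  have hf : Steady f := by
    refine Steady.of_support {a none} (fun x j hj => Pi.single_eq_of_ne hj _) fun x x' h => ?_
    exact hcongr x x' fun i hi => h i fun h' => haS none (by rw [← show i = a none from h']; exact hi)
  have hf' : Steady fun x => - f x := fun x z => by
    beta_reduce; rw [← sub_eq_add_neg, hf.sub]
  have e1 : localOp D.t (fun x => shift (g (D.count x))) = addOp f := localOp_shift _ _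
  have e2 : localOp D.t (fun x => shift (- g (D.count x))) = addOp fun x => - f x := by
    rw [localOp_shift]
    congr 1
    funext x
    exact Pi.single_neg _ _
  rw [e1, e2, addOp_mul_apply hf', mul_addOp_apply, sub_neg_eq_add]
  have hfne : ∀ (x : Q → ZMod p) j, j ≠ a none → f x j = 0 := fun x j hj => Pi.single_eq_of_ne hj _
  have hcond : (∀ i, i ≠ t → (y + f y) i = (x + f x) i) ↔ ∀ i, i ≠ t → y i = x i := by
    constructor
    · intro H
      have : f y = f x := hcongr y x fun i hi => by
        have := H i fun h => ht (h ▸ hi)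
        rwa [Pi.add_apply, Pi.add_apply, hfne y i fun h => haS none (h ▸ hi),
          hfne x i fun h => haS none (h ▸ hi), add_zero, add_zero] at this
      intro i hi
      have := H i hi
      rwa [Pi.add_apply, Pi.add_apply, ‹f y = f x›, add_left_inj] at this
    · intro H i hi
      have : f y = f x := hcongr y x fun i hi => H i fun h => ht (h ▸ hi)
      rw [Pi.add_apply, Pi.add_apply, this, H i hi]
  refine if_congr hcond ?_ rfl
  have hu : (x + f x) (a none) = g (D.count x) := by
    rw [Pi.add_apply, hx _ ⟨_, rfl⟩, zero_add]
    exact Pi.single_eq_same _ _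
  have ht0 : ∀ x : Q → ZMod p, (x + f x) t = x t := fun x => by
    rw [Pi.add_apply, hfne x t (hat none).symm, add_zero]
  beta_reduce
  rw [hu, ht0, ht0]
  by_cases hc : ∀ i ∈ S, x i = v i
  · rw [if_pos hc, if_pos]
    exact if_pos ((hcount x).2 hc)
  · rw [if_neg hc, if_neg]
    · rfl
    · simp only [g, if_neg fun h => hc ((hcount x).1 h)]
      exact zero_ne_one

end

section

variable {p : ℕ} [NeZero p] {Q C : Type} [Fintype Q] [DecidableEq Q] [Fintype C] [DecidableEq C]

/-! ### Inclusions of circuit classes -/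

/-- If every gate can be replaced by a circuit of constant depth and polynomial size, then there is
an inclusion of classes. -/
theorem constDepthClass_subset {G G' : ∀ Q C : Type, Gate p Q C → Prop} (d : ℕ)
    (X Y : Polynomial ℕ)
    (h : ∀ (Q C : Type) [Fintype Q] [DecidableEq Q] [Fintype C] [DecidableEq C] (m : ℕ)
      (g : Gate p Q C), G Q C g → Fintype.card Q ≤ m → Fintype.card C ≤ m →
      Realizes (G' _ _) (g.zone (Fin (X.eval m)) (Fin (Y.eval m))) d
        (g.map Function.Embedding.inl Function.Embedding.inl).apply) :
    constDepthClass p G ⊆ constDepthClass p G' := by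
  rintro F ⟨D, P, hF⟩
  -- `P` bounds the numbers of wires, so the ancilla blocks are chosen for m = P(n); the last factor
  -- bounds the number of layers plus one.
  refine ⟨d * D, P * (1 + X.comp P + Y.comp P) * Polynomial.C (d * D + 1), fun n => ?_⟩
  obtain ⟨Q, C, _, _, _, _, K, hG, hd, hs, hK⟩ := hF n
  have hQC : Fintype.card Q + Fintype.card C ≤ P.eval n := (Nat.le_add_right _ _).trans hs
  obtain ⟨K', h1, h2, h3, h4⟩ := exists_circuit_of_realizes_gates (G := G' _ _) K fun L hL g hg =>
    h Q C (P.eval n) g (hG L hL g hg) (by omega) (by omega)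
  refine ⟨_, _, _, _, _, _, K', h1, h2.trans (Nat.mul_le_mul_left _ hd), h3.trans ?_,
    fun σ => (h4 σ).trans (hK σ)⟩
  simp only [Fintype.card_fin, Polynomial.eval_mul, Polynomial.eval_add, Polynomial.eval_comp,
    Polynomial.eval_one, Polynomial.eval_C]
  gcongr

theorem Realizes.map_gate {X Y : Type} [Fintype X] [DecidableEq X] [Fintype Y] [DecidableEq Y]
    {G : Gate p (Q ⊕ (Q ⊕ C) × X) (C ⊕ (Q ⊕ C) × Y) → Prop} (g : Gate p Q C)
    (hG : G (g.map Function.Embedding.inl Function.Embedding.inl)) :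
    Realizes G (g.zone X Y) 1 (g.map Function.Embedding.inl Function.Embedding.inl).apply := by
  have hq : (((g.map Function.Embedding.inl Function.Embedding.inl :
      Gate p (Q ⊕ (Q ⊕ C) × X) (C ⊕ (Q ⊕ C) × Y)).qwires : Finset (Q ⊕ (Q ⊕ C) × X)) : Set (Q ⊕ (Q ⊕ C) × X)) = Sum.inl '' (g.qwires : Set Q) := by
    cases g <;> simp [Gate.map, Gate.qwires, Set.image_insert_eq]
  have hr : (((g.map Function.Embedding.inl Function.Embedding.inl :
      Gate p (Q ⊕ (Q ⊕ C) × X) (C ⊕ (Q ⊕ C) × Y)).creads : Finset (C ⊕ (Q ⊕ C) × Y)) : Set (C ⊕ (Q ⊕ C) × Y)) = Sum.inl '' (g.creads : Set C) := by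
    cases g <;> simp [Gate.map, Gate.creads, Set.image_insert_eq]
  have hw : (((g.map Function.Embedding.inl Function.Embedding.inl :
      Gate p (Q ⊕ (Q ⊕ C) × X) (C ⊕ (Q ⊕ C) × Y)).cwrites : Finset (C ⊕ (Q ⊕ C) × Y)) : Set (C ⊕ (Q ⊕ C) × Y)) = Sum.inl '' (g.cwrites : Set C) := by
    cases g <;> simp [Gate.map, Gate.cwrites]
  refine Realizes.gate _ hG ⟨?_, ?_, ?_⟩ ?_ ?_
  · rw [hq]; exact Set.subset_union_left
  · rw [hr]; exact Set.subset_union_left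
  · rw [hw]; exact Set.subset_union_left
  · rw [hq, Set.disjoint_left]
    rintro _ ⟨x, rfl⟩ ⟨y, -, h⟩
    exact Sum.inl_ne_inr h
  · rw [hw, Set.disjoint_left]
    rintro _ ⟨x, rfl⟩ ⟨y, -, h⟩
    exact Sum.inl_ne_inr h

/-- The ancillas that belong to a gate. -/
def ancilla {A B W X : Type} (l : B) (e : W ↪ X) : W ↪ A ⊕ B × X :=
  ⟨fun x => .inr (l, e x), fun x y h => e.injective (by simpa using h)⟩

theorem exists_ancilla {A B W : Type} [Fintype W] {N : ℕ} (l : B) (h : Fintype.card W ≤ N) :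
    ∃ a : W ↪ A ⊕ B × Fin N, (∀ i j, a i ≠ .inl j) ∧
      Set.range a ⊆ Set.range fun x => Sum.inr (l, x) := by
  obtain ⟨e⟩ := Function.Embedding.nonempty_of_card_le (α := W) (β := Fin N) (by simpa using h)
  exact ⟨ancilla l e, fun i j h => Sum.inr_ne_inl h, by rintro _ ⟨i, rfl⟩; exact ⟨_, rfl⟩⟩

theorem Gate.sub_zone {X Y : Type} [Fintype X] [DecidableEq X] [Fintype Y] [DecidableEq Y]
    {g : Gate p Q C} {E A : Set (Q ⊕ (Q ⊕ C) × X)}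
    {R W B : Set (C ⊕ (Q ⊕ C) × Y)} (hE : E ⊆ Sum.inl '' (g.qwires : Set Q))
    (hR : R ⊆ Sum.inl '' (g.creads : Set C)) (hW : W ⊆ Sum.inl '' (g.cwrites : Set C))
    (hA : A ⊆ Set.range fun x => Sum.inr (g.label, x))
    (hB : B ⊆ Set.range fun x => Sum.inr (g.label, x)) :
    Zone.Sub ⟨E, R, W, A, B⟩ (g.zone X Y) := by
  refine Zone.sub_of_subset (hE.trans Set.subset_union_left) hA hR hW hB ?_ ?_
  · rw [Set.disjoint_left]
    rintro _ ⟨x, rfl⟩ h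
    obtain ⟨y, -, hy⟩ := hE h
    exact Sum.inl_ne_inr hy
  · rw [Set.disjoint_left]
    rintro _ ⟨x, rfl⟩ h
    obtain ⟨y, -, hy⟩ := hW h
    exact Sum.inl_ne_inr hy

theorem Realizes.map_classicalMod (hp : 1 < p) (S : Finset C) (w : C) {N M : ℕ}
    (hN : (S.card + 1) * 2 * (S.card + 1) + ((S.card + 1) * 2 + 1) ≤ N)
    (hM : (S.card + 1) * 2 + 1 ≤ M) :
    Realizes Gate.IsQTC ((Gate.classicalMod S w : Gate p Q C).zone (Fin N) (Fin M)) 12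
      ((Gate.classicalMod S w : Gate p Q C).map Function.Embedding.inl
        Function.Embedding.inl).apply := by
  simp only [Gate.map]
  have hS' : (S.map Function.Embedding.inl : Finset (C ⊕ (Q ⊕ C) × Fin M)).card = S.card :=
    Finset.card_map _
  generalize hS : (S.map Function.Embedding.inl : Finset (C ⊕ (Q ⊕ C) × Fin M)) = S' at hS' ⊢
  obtain ⟨a, ha, ha'⟩ := exists_ancilla (A := Q) (N := N)
    (W := ((Fin (S'.card + 1) × Bool) × Option S') ⊕ Option (Fin (S'.card + 1) × Bool))
    (Gate.classicalMod S w : Gate p Q C).label (by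
      simpa only [hS', Fintype.card_sum, Fintype.card_prod, Fintype.card_fin,
        Fintype.card_bool, Fintype.card_option, Fintype.card_coe] using hN)
  obtain ⟨b, hb, hb'⟩ := exists_ancilla (A := C) (N := M)
    (W := Option (Fin (S'.card + 1) × Bool)) (Gate.classicalMod S w : Gate p Q C).label (by
      simpa only [hS', Fintype.card_prod, Fintype.card_fin, Fintype.card_bool,
        Fintype.card_option] using hM)
  refine (realizes_classicalMod hp S' (Sum.inl w) a b fun o => ⟨fun h => ?_, hb _ _⟩).mono
    (Gate.sub_zone ?_ ?_ ?_ ha' hb') le_rfl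
  · obtain ⟨j, -, hj⟩ := Finset.mem_map.1 ((Finset.ext_iff.1 hS _).2 h)
    exact hb _ _ hj.symm
  · simp
  · simp [Gate.creads, ← hS]
  · simp [Gate.cwrites]

theorem iQNCModC_subset_iQTC (hp : 1 < p) : iQNCModC p ⊆ iQTC p := by
  refine constDepthClass_subset 12 ((Polynomial.X + 1) * 2 * (Polynomial.X + 1) +
    ((Polynomial.X + 1) * 2 + 1)) ((Polynomial.X + 1) * 2 + 1) ?_
  intro Q C _ _ _ _ m g hg hQ hC
  have e1 : ((Polynomial.X + 1) * 2 * (Polynomial.X + 1) +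
    ((Polynomial.X + 1) * 2 + 1) : Polynomial ℕ).eval m =
      (m + 1) * 2 * (m + 1) + ((m + 1) * 2 + 1) := by simp
  have e2 : ((Polynomial.X + 1) * 2 + 1 : Polynomial ℕ).eval m = (m + 1) * 2 + 1 := by simp
  rw [e1, e2]
  cases g with
  | oneQudit q U => exact (Realizes.map_gate _ trivial).of_le (by norm_num)
  | ctrl a t h U => exact (Realizes.map_gate _ trivial).of_le (by norm_num)
  | classicalCtrl c q U => exact (Realizes.map_gate _ trivial).of_le (by norm_num)
  | measure q w => exact (Realizes.map_gate _ trivial).of_le (by norm_num)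
  | boundedClassical a b w f => exact (Realizes.map_gate _ trivial).of_le (by norm_num)
  | multiCtrl S v t h U => exact hg.elim
  | qThreshold k S t h => exact hg.elim
  | classicalMod S w =>
    have hS : S.card ≤ m := (Finset.card_le_univ S).trans hC
    exact Realizes.map_classicalMod hp S w (by gcongr) (by gcongr)

/-- The number of auxiliary qudits of a phase gate. -/
def phaseCount {R : Type*} [Semiring R] (I O : R) : R :=
  O * I + O + (I * (O * 2) + O * (I * 2))

/-- The number of auxiliary classical wires of a phase gate. -/
def phaseClassicalCount {R : Type*} [Semiring R] (I O : R) : R :=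
  I * (O * 2 + (O + 1) + (O * 2 + 2)) + O * (I * 2 + (I + 1) + (I * 2 + 2))

/-- A bound for the number of auxiliary qudits for functions of a sum. -/
def countBound {R : Type*} [Semiring R] (B : R) : R :=
  B * B + (phaseCount (B + B * B) (B * (B * B) + B * (B * B)) +
    phaseCount (B * B + 1) (B * B + B * B))

/-- A bound for the number of auxiliary classical wires for functions of a sum. -/
def countClassicalBound {R : Type*} [Semiring R] (B : R) : R :=
  phaseClassicalCount (B + B * B) (B * (B * B) + B * (B * B)) +
    phaseClassicalCount (B * B + 1) (B * B + B * B)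

set_option synthInstance.maxSize 2000 in
theorem card_countWires_le {ι : Type} [Fintype ι] {A J B : ℕ} (hι : Fintype.card ι ≤ B)
    (hA : A ≤ B) (hJ : J ≤ B) (hB : p ^ A ≤ B) :
    Fintype.card (CountWires p ι A J) ≤ countBound B := by
  simp only [CountWires, PhaseWires, countBound, phaseCount, Fintype.card_sum, Fintype.card_prod,
    Fintype.card_fin, Fintype.card_option, Fintype.card_fun, ZMod.card]
  gcongr

set_option synthInstance.maxSize 2000 in
theorem card_countClassicalWires_le {ι : Type} [Fintype ι] {A J B : ℕ} (hι : Fintype.card ι ≤ B)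
    (hA : A ≤ B) (hJ : J ≤ B) (hB : p ^ A ≤ B) :
    Fintype.card (CountClassicalWires p ι A J) ≤ countClassicalBound B := by
  simp only [CountClassicalWires, PhaseClassicalWires, StarWires, countClassicalBound,
    phaseClassicalCount, Fintype.card_sum, Fintype.card_prod, Fintype.card_fin,
    Fintype.card_option, Fintype.card_fun, ZMod.card, Fintype.card_unit, one_mul]
  gcongr

/-- A is the upper logarithm of pm + 1 to base p, so the previous power of p is still smaller than
pm + 1 (unless A = 0). Hence p^A, the number of linear forms in a zero test, is linear in m. -/
theorem exists_digits (hp : 1 < p) (m : ℕ) : ∃ A, p * m + 1 ≤ p ^ A ∧ A ≤ p * (p * m + 1) ∧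
    p ^ A ≤ p * (p * m + 1) := by
  have h : p ^ Nat.clog p (p * m + 1) ≤ p * (p * m + 1) := by
    by_cases h1 : 1 < p * m + 1
    · have h2 := Nat.pow_pred_clog_lt_self hp h1
      have h3 : 0 < Nat.clog p (p * m + 1) := Nat.clog_pos hp h1
      rw [← Nat.succ_pred_eq_of_pos h3, pow_succ, mul_comm]
      exact Nat.mul_le_mul_left _ h2.le
    · rw [Nat.clog_of_right_le_one (by omega), pow_zero]
      exact Nat.mul_pos (by omega) (by omega)
  exact ⟨Nat.clog p (p * m + 1), Nat.le_pow_clog hp _, (Nat.lt_pow_self hp).le.trans h, h⟩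

set_option synthInstance.maxSize 2000 in
theorem Realizes.map_multiCtrl (hp : 1 < p) (S : Finset Q) (v : Q → ZMod p) (t : Q) (h : t ∉ S)
    (U : Matrix.unitaryGroup (ZMod p) ℂ) {A J B N M : ℕ}
    (hS : S.card < J) (hA : J ≤ p ^ A) (hSB : S.card ≤ B) (hAB : A ≤ B) (hJB : J ≤ B)
    (hB : p ^ A ≤ B) (hN : countBound B + 1 ≤ N) (hM : countClassicalBound B ≤ M) :
    Realizes Gate.IsQNCModC ((Gate.multiCtrl S v t h U : Gate p Q C).zone (Fin N) (Fin M))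
      (144 * p + 475) ((Gate.multiCtrl S v t h U : Gate p Q C).map Function.Embedding.inl
        Function.Embedding.inl).apply := by
  simp only [Gate.map]
  have hS' : (S.map Function.Embedding.inl : Finset (Q ⊕ (Q ⊕ C) × Fin N)).card = S.card :=
    Finset.card_map _
  have hι : Fintype.card (S.map Function.Embedding.inl : Finset (Q ⊕ (Q ⊕ C) × Fin N)) ≤ B := by
    rw [Fintype.card_coe, hS']
    exact hSB
  obtain ⟨a, ha, ha'⟩ := exists_ancilla (A := Q) (N := N)
    (W := Option (CountWires p (S.map Function.Embedding.inl : Finset (Q ⊕ (Q ⊕ C) × Fin N)) A J))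
    (Gate.multiCtrl S v t h U : Gate p Q C).label (by
      rw [Fintype.card_option]
      exact (Nat.succ_le_succ (card_countWires_le hι hAB hJB hB)).trans hN)
  obtain ⟨b, hb, hb'⟩ := exists_ancilla (A := C) (N := M)
    (W := CountClassicalWires p
      (S.map Function.Embedding.inl : Finset (Q ⊕ (Q ⊕ C) × Fin N)) A J)
    (Gate.multiCtrl S v t h U : Gate p Q C).label
    ((card_countClassicalWires_le hι hAB hJB hB).trans hM)
  refine (realizes_multiCtrl hp _ _ _ _ U (by rwa [hS']) hA a (fun i hi => ?_) b).mono
    (Gate.sub_zone ?_ ?_ ?_ ha' hb') le_rfl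
  · rcases Finset.mem_insert.1 hi with hi | hi
    · exact ha _ _ hi
    · obtain ⟨j, -, hj⟩ := Finset.mem_map.1 hi
      exact ha _ _ hj.symm
  · simp [Gate.qwires, Set.image_insert_eq]
  · simp
  · simp

set_option synthInstance.maxSize 2000 in
theorem Realizes.map_qThreshold (hp : 1 < p) (k : ℕ) (S : Finset Q) (t : Q) (h : t ∉ S) {A J B N M : ℕ}
    (hS : p * S.card < J) (hA : J ≤ p ^ A) (hSB : S.card ≤ B) (hAB : A ≤ B) (hJB : J ≤ B)
    (hB : p ^ A ≤ B) (hN : countBound B ≤ N) (hM : countClassicalBound B ≤ M) :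
    Realizes Gate.IsQNCModC ((Gate.qThreshold k S t h : Gate p Q C).zone (Fin N) (Fin M))
      (72 * p + 237) ((Gate.qThreshold k S t h : Gate p Q C).map Function.Embedding.inl
        Function.Embedding.inl).apply := by
  simp only [Gate.map]
  have hS' : (S.map Function.Embedding.inl : Finset (Q ⊕ (Q ⊕ C) × Fin N)).card = S.card :=
    Finset.card_map _
  have hι : Fintype.card (S.map Function.Embedding.inl : Finset (Q ⊕ (Q ⊕ C) × Fin N)) ≤ B := by
    rw [Fintype.card_coe, hS']
    exact hSB
  obtain ⟨a, ha, ha'⟩ := exists_ancilla (A := Q) (N := N)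
    (W := CountWires p (S.map Function.Embedding.inl : Finset (Q ⊕ (Q ⊕ C) × Fin N)) A J)
    (Gate.qThreshold k S t h : Gate p Q C).label ((card_countWires_le hι hAB hJB hB).trans hN)
  obtain ⟨b, hb, hb'⟩ := exists_ancilla (A := C) (N := M)
    (W := CountClassicalWires p
      (S.map Function.Embedding.inl : Finset (Q ⊕ (Q ⊕ C) × Fin N)) A J)
    (Gate.qThreshold k S t h : Gate p Q C).label
    ((card_countClassicalWires_le hι hAB hJB hB).trans hM)
  refine (realizes_qThreshold hp k _ _ _ (by rwa [hS']) hA a (fun i hi => ?_) b).mono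
    (Gate.sub_zone ?_ ?_ ?_ ha' hb') le_rfl
  · rcases Finset.mem_insert.1 hi with hi | hi
    · exact ha _ _ hi
    · obtain ⟨j, -, hj⟩ := Finset.mem_map.1 hi
      exact ha _ _ hj.symm
  · simp [Gate.qwires, Set.image_insert_eq]
  · simp
  · simp

theorem iQTC_subset_iQNCModC (hp : 1 < p) : iQTC p ⊆ iQNCModC p := by
  refine constDepthClass_subset (144 * p + 475)
    (countBound (Polynomial.C p * (Polynomial.C p * Polynomial.X + 1)) + 1)
    (countClassicalBound (Polynomial.C p * (Polynomial.C p * Polynomial.X + 1))) ?_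
  intro Q C _ _ _ _ m g hg hQ hC
  obtain ⟨A, hA1, hA2, hA3⟩ := exists_digits hp m
  have hJ : p * m + 1 ≤ p * (p * m + 1) := Nat.le_mul_of_pos_left _ (by omega)
  have e1 : (countBound (Polynomial.C p * (Polynomial.C p * Polynomial.X + 1)) + 1).eval m =
      countBound (p * (p * m + 1)) + 1 := by
    simp [countBound, phaseCount]
  have e2 : (countClassicalBound (Polynomial.C p * (Polynomial.C p * Polynomial.X + 1))).eval m =
      countClassicalBound (p * (p * m + 1)) := by
    simp [countClassicalBound, phaseClassicalCount]
  rw [e1, e2]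
  -- With at most m controls, J = pm + 1 exceeds both the integer sums of p-valued inputs and the
  -- numbers of matching controls. The bound p(pm + 1) serves for all the parameters.
  have hcard : ∀ S : Finset Q, S.card ≤ m := fun S => (Finset.card_le_univ S).trans hQ
  have hcard' : m ≤ p * (p * m + 1) := by nlinarith
  cases g with
  | oneQudit q U => exact (Realizes.map_gate _ trivial).of_le (by omega)
  | ctrl a t h U => exact (Realizes.map_gate _ trivial).of_le (by omega)
  | classicalCtrl c q U => exact (Realizes.map_gate _ trivial).of_le (by omega)
  | measure q w => exact (Realizes.map_gate _ trivial).of_le (by omega)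
  | boundedClassical a b w f => exact (Realizes.map_gate _ trivial).of_le (by omega)
  | classicalMod S w => exact hg.elim
  | multiCtrl S v t h U =>
    have hS := hcard S
    exact Realizes.map_multiCtrl hp S v t h U (J := p * m + 1) (by nlinarith) hA1
      (hS.trans hcard') hA2 hJ hA3 le_rfl le_rfl
  | qThreshold k S t h =>
    have hS := hcard S
    exact (Realizes.map_qThreshold hp k S t h (Nat.lt_succ_of_le (Nat.mul_le_mul_left _ hS)) hA1
      (hS.trans hcard') hA2 hJ hA3 (Nat.le_succ _) le_rfl).of_le (by omega)

/-! ### The quantum modular gate -/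

/-- The circuit on `n` qudits without gates. -/
def emptyCircuit (p n : ℕ) [NeZero p] : Circuit p n n (Fin n) Empty :=
  ⟨Function.Embedding.refl _, Function.Embedding.refl _, [], by simp⟩

theorem emptyCircuit_initial (n : ℕ) (σ : Matrix (Fin n → ZMod p) (Fin n → ZMod p) ℂ) :
    (emptyCircuit p n).initial σ = fun _ => σ := by
  funext c x y
  rw [Circuit.initial_apply, if_pos ⟨Subsingleton.elim _ _, fun q hq => absurd rfl (hq q)⟩]
  rfl

theorem emptyCircuit_reduced (n : ℕ) (ρ : CQState p (Fin n) Empty) :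
    (emptyCircuit p n).reduced ρ = ρ 0 := by
  funext u v
  have h : ∀ x y : Fin n → ZMod p, ((∀ i, x ((emptyCircuit p n).out i) = u i) ∧
      (∀ i, y ((emptyCircuit p n).out i) = v i) ∧
      ∀ q, (∀ i, (emptyCircuit p n).out i ≠ q) → x q = y q) ↔ x = u ∧ y = v := by
    intro x y
    simp only [emptyCircuit, Function.Embedding.refl_apply, funext_iff]
    exact ⟨fun h => ⟨h.1, h.2.1⟩, fun h => ⟨h.1, h.2, fun q hq => absurd rfl (hq q)⟩⟩
  simp only [Circuit.reduced, h]
  rw [Fintype.sum_unique, Finset.sum_eq_single u, Finset.sum_eq_single v]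
  · rw [if_pos ⟨rfl, rfl⟩]
    exact congrArg (fun c => ρ c u v) (Subsingleton.elim _ _)
  · exact fun y _ hy => if_neg fun h => hy h.2
  · simp
  · exact fun x _ hx => Finset.sum_eq_zero fun y _ => if_neg fun h => hx h.1
  · simp

/-- The gate is a modular sum onto qudit 0. The channel is read off by viewing the initial state as
an embedding of the initial state of the circuit without gates, whose channel is the identity. -/
theorem qMODFamily_mem_iQNCModC (hp : 1 < p) : qMODFamily p ∈ iQNCModC p := by
  refine ⟨6 * p + 19, 8 * Polynomial.X * Polynomial.C (6 * p + 19 + 1), fun n => ?_⟩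
  cases n with
  | zero =>
    refine ⟨Fin 0, Empty, _, _, _, _, emptyCircuit p 0, by simp [emptyCircuit],
      by simp [emptyCircuit, Circuit.depth], by simp [emptyCircuit, Circuit.size], fun σ => ?_⟩
    change (emptyCircuit p 0).reduced ((emptyCircuit p 0).initial σ) = σ
    rw [emptyCircuit_initial, emptyCircuit_reduced]
  | succ k =>
    have h := realizes_sum (p := p) (Q := Fin (k + 1) ⊕ Fin k × Fin 2) (C := StarWires (Fin k)) hp
      (q := .inl 0) (r := fun i : Fin k => .inl i.succ) (fun i j h => by simpa using h)
      (fun i h => Fin.succ_ne_zero i (Sum.inl_injective h)) (fun _ v => v) Function.Embedding.inr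
      (fun i => Sum.inr_ne_inl) (fun i j => Sum.inr_ne_inl) (Function.Embedding.refl _)
    let e : Fin (k + 1) ↪ Fin (k + 1) ⊕ Fin k × Fin 2 := Function.Embedding.inl
    let f : Empty ↪ StarWires (Fin k) := ⟨Empty.elim, fun x => x.elim⟩
    obtain ⟨K, h1, h2, h3, h4, h5, h6⟩ := h.exists_circuit e e
    refine ⟨_, _, _, _, _, _, K, h3, h4, h5.trans ?_, fun σ => ?_⟩
    · simp only [Fintype.card_sum, Fintype.card_prod, Fintype.card_fin, Fintype.card_option,
        Fintype.card_unit, Polynomial.eval_mul, Polynomial.eval_X, Polynomial.eval_C,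
        Polynomial.eval_ofNat]
      -- There are 3k + 1 qudits and 5k + 3 classical wires, together at most 8(k + 1).
      refine Nat.mul_le_mul_right _ ?_
      omega
    · have hi := Circuit.initial_embed (emptyCircuit p (k + 1)) K e f h1 σ
      change K.reduced (K.run (K.initial σ)) = _
      rw [hi, h6 _ ((clean_embed e f _).mono ?_ ?_), ← localOp_shift]
      · have := embed_conjBy e f (0 : Fin (k + 1))
          (fun _ (x : Fin (k + 1) → ZMod p) => shift (∑ i : Fin k, x i.succ))
          ((emptyCircuit p (k + 1)).initial σ)
        refine (congrArg K.reduced this).trans ?_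
        rw [Circuit.reduced_embed (emptyCircuit p (k + 1)) K e f h2, emptyCircuit_reduced,
          emptyCircuit_initial]
        rfl
      · rintro _ ⟨i, rfl⟩ ⟨j, hj⟩
        exact Sum.inl_ne_inr hj
      · rintro j - ⟨i, hi⟩
        exact i.elim

end

end QuditCircuit

end

theorem lemma3p9 (p : ℕ) [Fact p.Prime] :
    QuditCircuit.iQNCModC p = QuditCircuit.iQTC p ∧
      QuditCircuit.qMODFamily p ∈ QuditCircuit.iQNCModC p := by
  have hp : 1 < p := (Fact.out : p.Prime).one_lt
  exact ⟨Set.Subset.antisymm (QuditCircuit.iQNCModC_subset_iQTC hp)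
    (QuditCircuit.iQTC_subset_iQNCModC hp), QuditCircuit.qMODFamily_mem_iQNCModC hp⟩
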